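/- **Setting.** Let $x\in\mathbb R^n$, $y\in\mathbb R^d$, $D=-i\partial$, and let $[t_1,t_2]$ be an interval with smooth (i.e. $C^\infty$ on a neighbourhood of $[t_1,t_2]$) functions $x_0(t),\xi_0(t)\in\mathbb R^n$, $w_0(t),w_\alpha(t)\in\mathbb C$. Fix $y_0\in\mathbb R^d$. Let $f(t,x,\xi)$ be real valued and $A(t,x,y,\tau,\xi,\eta)\in\mathbb C^d$, $B=\{B_{jk}(t,x,y,\tau,\xi,\eta)\}_{j,k\le d}$ be complex valued, and smooth near the curve $\gamma=\{(t,x_0(t),y_0,0,\xi_0(t),0): t\in[t_1,t_2]\}$ (near its projection, for $f$). These are the symbols of $P^*=D_t+F$, where $F\sim F_2+F_1+\cdots$, $F_2=\sum B_{jk}\eta_j\eta_k$ and $F_1=if+A\cdot\eta$. Let $$\omega(t,x)=w_0(t)+\langle x-x_0(t),\xi_0(t)\rangle+\sum_{2\le|\alpha|\le\kappa}w_\alpha(t)(x-x_0(t))^\alpha/\alpha!,\qquad \kappa\ge2 .$$ The value of a symbol at the complex covector $(\tau,\xi)=\partial_{t,x}\omega(t,x)$ is defined by its Taylor expansion of order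 $L$ in $(\tau,\xi)$ at the real covector $(0,\xi_0(t))$. **Assumptions.** 1. For some $r$ with $2\le r\le L+1$, $\partial_t\omega+if(t,x,\partial_x\omega)=O(|x-x_0(t)|^r)$, uniformly for $t\in[t_1,t_2]$. 2. The quadratic form $w_2(t)=\partial_x^2\omega(t,x_0(t))$ satisfies $\operatorname{Im}w_2(t)\ge c>0$ on $[t_1,t_2]$. 3. $\operatorname{Im}w_0\ge0$ on $[t_1,t_2]$, $\operatorname{Im}w_0(t_j)>0$ for $j=1,2$, and $t_0\in(t_1,t_2)$ is a point with $\operatorname{Im}w_0(t_0)=0$. 4. If $t\mapsto f(t,x_0(t),\xi_0(t))$ vanishes of infinite order at $t_0$, then there are $C,\varepsilon'>0$ such that $\|\{B_{jk}\}\|+|A|+|df|\le C|f|^{\varepsilon'}$ on $\{\eta=0\}$ near $\gamma$. **Transport equations.** In the coordinates $(t,x-x_0(t),y-y_0)$ the transport operator is $$D_t+A_0(t,x)\cdot D_x+A_1(t,x,y)\cdot D_y+\sum_{j,l}A_{2,jl}(t,x,y)D_{y_j}D_{y_l}+\sum_{m\ge0}\lambda^{-m}R_m ,$$ where $A_0=i\partial_\xi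 f(t,x,\partial_x\omega)-x_0'(t)$, $A_1=A(t,x,y,\partial_{t,x}\omega,0)$, $A_2=\tfrac12\partial_\eta^2F_2(t,x,y,\partial_{t,x}\omega,0)=\{B_{jk}(t,x,y,\partial_{t,x}\omega,0)\}$ (in $D_{y_j}D_{y_l}$ only the symmetric part matters), evaluated at the shifted points. Here $R_0$ is multiplication by a smooth function, and for $m>0$, $R_m=\sum_{\ell+|\nu|+|\mu|\le m+2}R_{m,\ell,\nu,\mu}(t,x,y)D_t^\ell D_x^\nu D_y^\mu$ is any differential operator of order $\le m+2$; all coefficients are smooth on a common neighbourhood of $[t_1,t_2]\times\{0\}\times\{0\}$. Expand the coefficients in Taylor series in $x$ at $0$, with coefficients $A_{0,\beta,j}(t)$, $A_{1,\beta}(t,y)$, $A_{2,\beta}(t,y)$, $R_{m,\beta,\ell,\nu,\mu}(t,y)$. Let $\lambda=\varrho^N$. After $x$ is replaced by $x/\varrho^2$ and $y$ by $y/\varrho$, the transport equation with index $(k,\alpha)$, for functions $\phi_{k,\alpha}(t,y)$ (which are $0$ if $k<0$ or $\alpha\notin\mathbb N^n$), is $$\begin{aligned}&D_t\phi_{k,\alpha}-i\sum_{\beta\ne0,\,j}A_{0,\beta,j}(\alpha_j+1-\beta_j)\phi_{k+2-2|\beta|,\alpha+e_j-\beta}+\sum_{\beta\ne0}A_{1,\beta}(t,\tfrac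 y\varrho)D_y\phi_{k+1-2|\beta|,\alpha-\beta}\\&+\sum_{\beta\ne0}A_{2,\beta}(t,\tfrac y\varrho)D_y^2\phi_{k+2-2|\beta|,\alpha-\beta}-i\varrho^3\sum_jA_{0,0,j}(\alpha_j+1)\phi_{k-1,\alpha+e_j}\\&+\varrho^3A_{1,0}(t,\tfrac y\varrho)D_y\phi_{k-2,\alpha}+\varrho^3A_{2,0}(t,\tfrac y\varrho)D_y^2\phi_{k-1,\alpha}\\&=-\sum R_{m,\beta,\ell,\nu,\mu}(t,\tfrac y\varrho)\,c_{\alpha,\beta,\nu}\,(\varrho^{-3}D_t)^\ell D_y^\mu\phi_{k-i,\alpha+\nu-\beta}.\end{aligned}$$ The last sum is over $m,\beta,\ell,\nu,\mu$ with $\ell+|\nu|+|\mu|\le m+2$ if $m>0$ and $\ell=|\nu|=|\mu|=0$ if $m=0$; $i$ is defined by $i+3\ell+2|\nu|+|\mu|=mN+2|\beta|$; and $x^\beta D_x^\nu x^{\alpha+\nu-\beta}=c_{\alpha,\beta,\nu}x^\alpha$. **Conclusion.** There are $\varepsilon>0$ and $N_0\ge10$ such that for every integer $N\ge N_0$ there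 is $\lambda_0\ge1$ so that the following holds for all $K,M\in\mathbb N$. There are $M'\in\mathbb N$, a cut-off function $\psi\in C_0^\infty(\mathbb R^n)$ with $\psi=1$ near $0$, and constants $C_0$, $C_m$ $(m\in\mathbb N)$ such that for every $\lambda\ge\lambda_0$, with $\varrho=\lambda^{1/N}$, there are smooth functions $\phi_{k,\alpha}(t,y)$ on $\mathbb R\times\mathbb R^d$, vanishing identically if $|\alpha|>M'$, with these properties: * For $k\le K$ and $|\alpha|\le M$ the transport equation with index $(k,\alpha)$ holds for all $y$ and all $t\in[t_1,t_2]$ such that $\lambda\operatorname{Im}w_0(t)<\lambda^\varepsilon$ (at the other $t\in[t_1,t_2]$, $|e^{i\lambda\omega(t,x_0(t))}|\le e^{-\lambda^\varepsilon}$ is smaller than any power of $\lambda^{-1}$). * For $k\le K$ the amplitudes $$\phi_k(t,x,y)=\psi(\varrho^2(x-x_0(t)))\sum_{|\alpha|\le M'}\phi_{k,\alpha}(t,\varrho(y-y_0))\,(\varrho^2(x-x_0(t)))^\alpha$$ have the form $\phi_k(t,x,y)=\varphi_k(\varrho^3(t-t_0),\varrho^2(x-x_0(t)),\varrho(y-y_0))$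 with $\varphi_k\in C^\infty(\mathbb R\times\mathbb R^n\times\mathbb R^d)$ uniformly: the derivatives of $\varphi_k$ of order $m$ are bounded by $C_m$, for every $m$. * For $k\le K$, in the support of $\varphi_k(s,x,y)$ we have $|x|+|y|\le C_0$, $|s|\le C_0\varrho^3$ and $t_0+\varrho^{-3}s\in[t_1,t_2]$. * $\varphi_0(0,0,0)=1$. -/

import Mathlib

open scoped ContDiff Topology

noncomputable section

namespace Transport

/-! ### Multi-indices and partial derivatives -/

/-- `|α| = α₁ + α₂ + …`. -/
def mdeg {n : ℕ} (α : Fin n → ℕ) : ℕ := ∑ i, α i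

/-- `α! = ∏ αᵢ!`. -/
def mfact {n : ℕ} (α : Fin n → ℕ) : ℕ := ∏ i, (α i).factorial

/-- `v ^ α = ∏ vᵢ ^ αᵢ`. -/
def mpow {n : ℕ} (v : Fin n → ℂ) (α : Fin n → ℕ) : ℂ := ∏ i, v i ^ α i

/-- The multi-indices with `|α| ≤ m`. -/
def midx (n m : ℕ) : Finset (Fin n → ℕ) :=
  (Fintype.piFinset fun _ => Finset.range (m + 1)).filter fun α => mdeg α ≤ m

/-- The partial derivative `∂_i g`. -/
def pderiv {n : ℕ} (i : Fin n) (g : (Fin n → ℝ) → ℂ) : (Fin n → ℝ) → ℂ :=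
  fun x => fderiv ℝ g x (Pi.single i 1)

/-- The partial derivative `∂^α g = ∂_1^{α_1} ⋯ ∂_n^{α_n} g`. -/
def mderiv {n : ℕ} (α : Fin n → ℕ) (g : (Fin n → ℝ) → ℂ) : (Fin n → ℝ) → ℂ :=
  (List.finRange n).foldr (fun i h => (pderiv i)^[α i] h) g

/-! ### The symbols, the phase function, and values of symbols at complex covectors -/

/-- The data of an operator `D_t + F(t,x,y,D_t,D_x,D_y)`, with `x ∈ ℝⁿ`, `y ∈ ℝᵈ`,
`F_2 = ∑ B_{jk} η_j η_k` and `F_1 = i f + A · η`, as they enter its transport equations.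
The arguments of `f` are `(t, x, ξ)`, those of `A` and `B` are `(t, x, y, τ, ξ, η)`.
The function `R m ℓ ν μ` is the coefficient of `D_t^ℓ D_x^ν D_y^μ` in the term `R_m` of order
`λ^{-m}` of the transport operator, in the coordinates `(t, x - x₀(t), y - y₀)`; the coefficients
that are used are those permitted by `ordR` below. -/
structure Symbols (n d : ℕ) where
  f : ℝ × (Fin n → ℝ) × (Fin n → ℝ) → ℝ
  A : ℝ × (Fin n → ℝ) × (Fin d → ℝ) × ℝ × (Fin n → ℝ) × (Fin d → ℝ) → Fin d → ℂ
  B : ℝ × (Fin n → ℝ) × (Fin d → ℝ) × ℝ × (Fin n → ℝ) × (Fin d → ℝ) → Fin d → Fin d → ℂ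
  R : ℕ → ℕ → (Fin n → ℕ) → (Fin d → ℕ) → ℝ × (Fin n → ℝ) × (Fin d → ℝ) → ℂ

/-- The order of `R_m`: `R_0` is a multiplication operator, and `R_m` is a differential operator
of order at most `m + 2` if `m > 0`. -/
def ordR (m : ℕ) : ℕ := if m = 0 then 0 else m + 2

/-- The data of a phase function that is a polynomial of degree `deg` in `x - x₀(t)`. -/
structure Phase (n : ℕ) where
  deg : ℕ
  x0 : ℝ → Fin n → ℝ
  ξ0 : ℝ → Fin n → ℝ
  w0 : ℝ → ℂ
  w : (Fin n → ℕ) → ℝ → ℂ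

variable {n d : ℕ}

/-- `ω(t,x) = w₀(t) + ⟨x - x₀(t), ξ₀(t)⟩ + ∑_{2 ≤ |α| ≤ deg} w_α(t) (x - x₀(t))^α / α!`. -/
def Phase.omega (P : Phase n) (t : ℝ) (x : Fin n → ℝ) : ℂ :=
  P.w0 t + ∑ j, ((x j - P.x0 t j : ℝ) : ℂ) * (P.ξ0 t j : ℂ)
    + ∑ α ∈ (midx n P.deg).filter (fun α => 2 ≤ mdeg α),
        P.w α t * mpow (fun i => ((x i - P.x0 t i : ℝ) : ℂ)) α / (mfact α : ℂ)

/-- `∂_t ω(t,x)`. -/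
def Phase.dt (P : Phase n) (t : ℝ) (x : Fin n → ℝ) : ℂ := deriv (fun s => P.omega s x) t

/-- `∂_x ω(t,x)`. -/
def Phase.dx (P : Phase n) (t : ℝ) (x : Fin n → ℝ) : Fin n → ℂ :=
  fun i => pderiv i (P.omega t) x

/-- The quadratic form `v ↦ ⟨w₂(t) v, v⟩` where `w₂ = ∂_x² ω(t, x₀(t))`. -/
def Phase.w2 (P : Phase n) (t : ℝ) (v : Fin n → ℝ) : ℂ :=
  ∑ α ∈ (midx n 2).filter (fun α => mdeg α = 2),
    (2 / (mfact α : ℂ)) * P.w α t * mpow (fun i => (v i : ℂ)) α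

/-- The function `t ↦ f(t, x₀(t), ξ₀(t))`. -/
def fcurve (S : Symbols n d) (P : Phase n) (t : ℝ) : ℝ := S.f (t, P.x0 t, P.ξ0 t)

/-- The value of `G(τ, ξ)` at the complex covector `(τ, ξ) = ∂_{t,x} ω(t,x)`, given by the Taylor
expansion of order `L` at the real covector `(0, ξ₀(t))`. (By the eikonal equation `(0, ξ₀(t))`
is the real part of `∂_{t,x} ω` at `x = x₀(t)`.) -/
def symAt (P : Phase n) (L : ℕ) (G : ℝ → (Fin n → ℝ) → ℂ) (t : ℝ) (x : Fin n → ℝ) : ℂ :=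
  ∑ p ∈ Finset.range (L + 1), ∑ γ ∈ midx n (L - p),
    iteratedDeriv p (fun τ => mderiv γ (G τ) (P.ξ0 t)) 0 / ((p.factorial : ℂ) * (mfact γ : ℂ))
      * P.dt t x ^ p * mpow (fun i => P.dx t x i - (P.ξ0 t i : ℂ)) γ

/-- The left hand side of the eikonal equation `∂_t ω + i f(t, x, ∂_x ω) = 0`. -/
def eikonal (S : Symbols n d) (P : Phase n) (L : ℕ) (t : ℝ) (x : Fin n → ℝ) : ℂ :=
  P.dt t x + Complex.I * symAt P L (fun _ ξ => (S.f (t, x, ξ) : ℂ)) t x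

/-! ### The hypotheses -/

/-- The symbols are smooth near the curve `(t, x₀(t), y₀, 0, ξ₀(t), 0)`, `t ∈ [t₁, t₂]`. -/
structure SmoothSymbols (S : Symbols n d) (P : Phase n) (y₀ : Fin d → ℝ) (t₁ t₂ : ℝ) : Prop where
  f : ∃ U : Set (ℝ × (Fin n → ℝ) × (Fin n → ℝ)), IsOpen U ∧
    (∀ t ∈ Set.Icc t₁ t₂, (t, P.x0 t, P.ξ0 t) ∈ U) ∧ ContDiffOn ℝ ∞ S.f U
  AB : ∃ V : Set (ℝ × (Fin n → ℝ) × (Fin d → ℝ) × ℝ × (Fin n → ℝ) × (Fin d → ℝ)), IsOpen V ∧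
    (∀ t ∈ Set.Icc t₁ t₂, (t, P.x0 t, y₀, (0 : ℝ), P.ξ0 t, (0 : Fin d → ℝ)) ∈ V) ∧
    ContDiffOn ℝ ∞ S.A V ∧ ContDiffOn ℝ ∞ S.B V
  R : ∃ W : Set (ℝ × (Fin n → ℝ) × (Fin d → ℝ)), IsOpen W ∧
    (∀ t ∈ Set.Icc t₁ t₂, (t, (0 : Fin n → ℝ), (0 : Fin d → ℝ)) ∈ W) ∧
    ∀ m ℓ ν μ, ContDiffOn ℝ ∞ (S.R m ℓ ν μ) W

/-- `ω` is a phase function on `[t₁, t₂]`: its coefficients are smooth, it solves the eikonal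
equation modulo `O(|x - x₀(t)|^r)`, `Im w₂ ≥ c > 0`, and `Im w₀` is nonnegative on `[t₁, t₂]` and
positive at the end points. -/
structure IsPhase (S : Symbols n d) (P : Phase n) (L r : ℕ) (t₁ t₂ : ℝ) : Prop where
  two_le_deg : 2 ≤ P.deg
  smooth : ∃ J : Set ℝ, IsOpen J ∧ Set.Icc t₁ t₂ ⊆ J ∧ ContDiffOn ℝ ∞ P.x0 J ∧
    ContDiffOn ℝ ∞ P.ξ0 J ∧ ContDiffOn ℝ ∞ P.w0 J ∧ ∀ α, ContDiffOn ℝ ∞ (P.w α) J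
  eikonal : ∃ C δ : ℝ, 0 < δ ∧ ∀ t ∈ Set.Icc t₁ t₂, ∀ x, ‖x - P.x0 t‖ < δ →
    ‖eikonal S P L t x‖ ≤ C * ‖x - P.x0 t‖ ^ r
  im_w2 : ∃ c : ℝ, 0 < c ∧ ∀ t ∈ Set.Icc t₁ t₂, ∀ v : Fin n → ℝ,
    c * ∑ i, v i ^ 2 ≤ (P.w2 t v).im
  im_w0_nonneg : ∀ t ∈ Set.Icc t₁ t₂, 0 ≤ (P.w0 t).im
  im_w0_left : 0 < (P.w0 t₁).im
  im_w0_right : 0 < (P.w0 t₂).im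

/-- The estimate `‖{B_{jk}}‖ + |A| + |df| ≤ C |f|^ε` on `{η = 0}` for some `ε > 0`, near the curve
`(t, x₀(t), y₀, 0, ξ₀(t), 0)`, `t ∈ [t₁, t₂]`. -/
def GradBound (S : Symbols n d) (P : Phase n) (y₀ : Fin d → ℝ) (t₁ t₂ : ℝ) : Prop :=
  ∃ C ε : ℝ, 0 < ε ∧
    ∃ V : Set (ℝ × (Fin n → ℝ) × (Fin d → ℝ) × ℝ × (Fin n → ℝ)), IsOpen V ∧
      (∀ t ∈ Set.Icc t₁ t₂, (t, P.x0 t, y₀, (0 : ℝ), P.ξ0 t) ∈ V) ∧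
      ∀ t x y τ ξ, (t, x, y, τ, ξ) ∈ V →
        ‖S.B (t, x, y, τ, ξ, 0)‖ + ‖S.A (t, x, y, τ, ξ, 0)‖ + ‖fderiv ℝ S.f (t, x, ξ)‖
          ≤ C * |S.f (t, x, ξ)| ^ ε

/-! ### The coefficients of the transport equations

They are the Taylor coefficients at `x = x₀(t)` of
`A₀ = i ∂_ξ f(t, x, ∂_x ω) - x₀'(t)`, `A₁ = A(t, x, y, ∂_{t,x} ω, 0)` and
`A₂ = {B_{jk}(t, x, y, ∂_{t,x} ω, 0)} = ∂_η² F_2(t, x, y, ∂_{t,x} ω, 0) / 2`,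
where `y` is replaced by `y₀ + y`, and those at `0` of the coefficients of `R_m`. -/

/-- The `β`-th Taylor coefficient `∂^β g(x) / β!` of `g` at `x`. -/
def tcoef (β : Fin n → ℕ) (g : (Fin n → ℝ) → ℂ) (x : Fin n → ℝ) : ℂ :=
  mderiv β g x / (mfact β : ℂ)

/-- `A_{0,β,j}(t)`. -/
def coefA0 (S : Symbols n d) (P : Phase n) (L : ℕ) (β : Fin n → ℕ) (j : Fin n) (t : ℝ) : ℂ :=
  tcoef β (fun x => Complex.I *
      symAt P L (fun _ => pderiv j (fun ξ => (S.f (t, x, ξ) : ℂ))) t x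
    - ((deriv P.x0 t j : ℝ) : ℂ)) (P.x0 t)

/-- The components of `A_{1,β}(t, y)`. -/
def coefA1 (S : Symbols n d) (P : Phase n) (y₀ : Fin d → ℝ) (L : ℕ) (β : Fin n → ℕ) (j : Fin d)
    (t : ℝ) (y : Fin d → ℝ) : ℂ :=
  tcoef β (fun x => symAt P L (fun τ ξ => S.A (t, x, y₀ + y, τ, ξ, 0) j) t x) (P.x0 t)

/-- The components of `A_{2,β}(t, y)`. -/
def coefA2 (S : Symbols n d) (P : Phase n) (y₀ : Fin d → ℝ) (L : ℕ) (β : Fin n → ℕ)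
    (j l : Fin d) (t : ℝ) (y : Fin d → ℝ) : ℂ :=
  tcoef β (fun x => symAt P L (fun τ ξ => S.B (t, x, y₀ + y, τ, ξ, 0) j l) t x) (P.x0 t)

/-- `R_{m,β,ℓ,ν,μ}(t, y)`. -/
def coefR (S : Symbols n d) (m : ℕ) (β : Fin n → ℕ) (ℓ : ℕ) (ν : Fin n → ℕ) (μ : Fin d → ℕ)
    (t : ℝ) (y : Fin d → ℝ) : ℂ :=
  tcoef β (fun x => S.R m ℓ ν μ (t, x, y)) 0

/-- For `β ≤ α`, the number `c_{α,β,ν}` with `x^β D_x^ν x^{α+ν-β} = c_{α,β,ν} x^α`, where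
`D = -i∂`. -/
def cmon (α β ν : Fin n → ℕ) : ℂ :=
  (-Complex.I) ^ mdeg ν * ∏ i, ((α i + ν i - β i).descFactorial (ν i) : ℂ)

/-! ### The transport equations -/

/-- `D_j g = -i ∂_j g`. -/
def Dy (j : Fin d) (g : (Fin d → ℝ) → ℂ) : (Fin d → ℝ) → ℂ :=
  fun y => -Complex.I * pderiv j g y

/-- `φ_{m,α}`, which is `0` by convention if `m < 0`. -/
def lev (φ : ℕ → (Fin n → ℕ) → ℝ → (Fin d → ℝ) → ℂ) (m : ℤ) (α : Fin n → ℕ) :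
    ℝ → (Fin d → ℝ) → ℂ :=
  if 0 ≤ m then φ m.toNat α else 0

/-- `(ϱ^{-3} D_t)^ℓ D_y^μ g` at `(t, y)`. -/
def DtDy (ϱ : ℝ) (ℓ : ℕ) (μ : Fin d → ℕ) (g : ℝ → (Fin d → ℝ) → ℂ) (t : ℝ) (y : Fin d → ℝ) : ℂ :=
  ((ϱ ^ 3 : ℝ) : ℂ)⁻¹ ^ ℓ * (-Complex.I) ^ (ℓ + mdeg μ) *
    iteratedDeriv ℓ (fun s => mderiv μ (g s) y) t

/-- The left hand side of the transport equation with index `(k, α)`, at `(t, y)`. The terms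
with `β = 0` carry a factor `ϱ³`. Terms with `β ≰ α` do not occur: they
have a factor `φ_{m,γ}` where `γ` has a negative component, or the factor `α_j + 1 - β_j = 0`. -/
def transportLHS (S : Symbols n d) (P : Phase n) (y₀ : Fin d → ℝ) (L : ℕ) (ϱ : ℝ)
    (φ : ℕ → (Fin n → ℕ) → ℝ → (Fin d → ℝ) → ℂ) (k : ℕ) (α : Fin n → ℕ)
    (t : ℝ) (y : Fin d → ℝ) : ℂ :=
  -Complex.I * deriv (fun s => φ k α s y) t
  - Complex.I * ∑ β ∈ (Finset.Iic α).filter (fun β => β ≠ 0), ∑ j,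
      coefA0 S P L β j t * ((α j + 1 - β j : ℕ) : ℂ) *
        lev φ (k + 2 - 2 * mdeg β) (α + Pi.single j 1 - β) t y
  + ∑ β ∈ (Finset.Iic α).filter (fun β => β ≠ 0), ∑ j,
      coefA1 S P y₀ L β j t (ϱ⁻¹ • y) * Dy j (lev φ (k + 1 - 2 * mdeg β) (α - β) t) y
  + ∑ β ∈ (Finset.Iic α).filter (fun β => β ≠ 0), ∑ j, ∑ l,
      coefA2 S P y₀ L β j l t (ϱ⁻¹ • y) *
        Dy j (Dy l (lev φ (k + 2 - 2 * mdeg β) (α - β) t)) y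
  - Complex.I * ((ϱ ^ 3 : ℝ) : ℂ) * ∑ j,
      coefA0 S P L 0 j t * ((α j + 1 : ℕ) : ℂ) * lev φ (k - 1) (α + Pi.single j 1) t y
  + ((ϱ ^ 3 : ℝ) : ℂ) * ∑ j, coefA1 S P y₀ L 0 j t (ϱ⁻¹ • y) * Dy j (lev φ (k - 2) α t) y
  + ((ϱ ^ 3 : ℝ) : ℂ) * ∑ j, ∑ l,
      coefA2 S P y₀ L 0 j l t (ϱ⁻¹ • y) * Dy j (Dy l (lev φ (k - 1) α t)) y

/-- The right hand side of the transport equation with index `(k, α)`, at `(t, y)`: the sum over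
all `m, β, ℓ, ν, μ` with `ℓ + |ν| + |μ| ≤ ordR m` of
`- R_{m,β,ℓ,ν,μ}(t, y/ϱ) c_{α,β,ν} (ϱ^{-3} D_t)^ℓ D_y^μ φ_{k-i,α+ν-β}`, where `i` is given by
`i + 3ℓ + 2|ν| + |μ| = m N + 2|β|`. If `N ≥ 4` then `i > k` for `m > k + 6`, so that
`m` may be restricted to `m < k + 7`; and `c_{α,β,ν} = 0` if `β ≰ α`. -/
def transportRHS (S : Symbols n d) (N : ℕ) (ϱ : ℝ)
    (φ : ℕ → (Fin n → ℕ) → ℝ → (Fin d → ℝ) → ℂ) (k : ℕ) (α : Fin n → ℕ)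
    (t : ℝ) (y : Fin d → ℝ) : ℂ :=
  - ∑ m ∈ Finset.range (k + 7), ∑ β ∈ Finset.Iic α, ∑ ℓ ∈ Finset.range (ordR m + 1),
      ∑ ν ∈ midx n (ordR m), ∑ μ ∈ midx d (ordR m),
        if ℓ + mdeg ν + mdeg μ ≤ ordR m then
          coefR S m β ℓ ν μ t (ϱ⁻¹ • y) * cmon α β ν *
            DtDy ϱ ℓ μ
              (lev φ (k - ((m : ℤ) * N + 2 * mdeg β - 3 * ℓ - 2 * mdeg ν - mdeg μ)) (α + ν - β))
              t y
        else 0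

end Transport

end

/-! In the time s = ϱ³(t - t₀) the transport equation with index (k, α) reads ∂_s φ_{k,α} = ϱ⁻³·(own
terms) + (lower terms). The own terms couple the φ_{k,α'} with |α'| = |α| through the part |β| = 1
of A₀, a matrix depending on t only, and contain multiplication by R₀. All other terms involve
φ_{k',α'} with (k', |α'|) lexicographically smaller than (k, |α|); for R_m with m > 0 this uses N ≥
10. Hence the equations can be solved recursively as linear ODEs in s with parameter y, starting
from a bump in y for (0, 0) and from zero otherwise. Only lower terms are differentiated in y, so
the y-support does not grow (`exists_transport_solution`).

The content is uniformity in λ, since s may range over an interval of length ℓ comparable to ϱ³. The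
own terms are harmless: their propagator is a fixed smooth function of (t, y/ϱ). A source is
harmless if it and its y-derivatives are O(1/ℓ), because differentiating its primitive gives the
source or the primitive of its y-derivative (`IB.prim`). Terms with a factor ϱ⁻³ qualify. The terms
with β = 0 have lost this factor to the ϱ³ in front of them; either their coefficients are small or
ℓ must be bounded.

This decides the cut-off in time. Divide time into steps h = ϱ⁻³ and go from t₀ in both directions
up to the first step on which Im w₀ ≥ λ^{-1/2} (`exists_window`). The cut-off descends inside these
two bounding steps, where no equation is required, and each step between them contains a point where
Im w₀ < λ^{-1/2} ≤ h^p, if N is large. The eikonal equation gives ∂_t Im w₀ = -f on the curve. If f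
vanishes of finite order at t₀, some derivative of Im w₀ is nonzero there, and repeated use of the
mean value theorem bounds the number of steps (`exists_window_le`), so ℓ = O(1). Otherwise either
the number of steps is bounded, or the same interpolation makes f as small as desired on the whole
window (`exists_abs_deriv_le_of_window`), and the bound by |f|^ε' makes A, B and df of size O(h⁴) =
O(ϱ⁻¹²).

The coefficient A₀ at β = 0 also contains x₀'. The part of the eikonal equation that is linear in x
- x₀, taken in the direction x₀', yields Im w₂(x₀', x₀') ≤ C|df||x₀'|, so positivity of Im w₂ bounds
x₀' by |df| (`IsPhase.exists_norm_deriv_x0_le`). Finally Landau's inequality carries the smallness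
over to y-derivatives (`Small.of_norm_le`). -/

namespace Transport

/-! ### Families of functions with uniform bounds for all derivatives. -/

section Families

variable {ι X X' F G H : Type*} [NormedAddCommGroup X] [NormedSpace ℝ X]
  [NormedAddCommGroup X'] [NormedSpace ℝ X']
  [NormedAddCommGroup F] [NormedSpace ℝ F] [NormedAddCommGroup G] [NormedSpace ℝ G]
  [NormedAddCommGroup H] [NormedSpace ℝ H]

/-- A family of smooth functions all of whose derivatives are bounded uniformly. -/
def UB (u : ι → X → F) : Prop :=
  (∀ i, ContDiff ℝ ∞ (u i)) ∧ ∀ m : ℕ, ∃ C : ℝ, ∀ i z, ‖iteratedFDeriv ℝ m (u i) z‖ ≤ C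

theorem UB.differentiable {u : ι → X → F} (hu : UB u) (i : ι) : Differentiable ℝ (u i) :=
  (hu.1 i).differentiable (by simp)

theorem UB.continuous {u : ι → X → F} (hu : UB u) (i : ι) : Continuous (u i) :=
  (hu.1 i).continuous

theorem UB.exists_norm_le {u : ι → X → F} (hu : UB u) : ∃ C : ℝ, ∀ i z, ‖u i z‖ ≤ C := by
  obtain ⟨C, hC⟩ := hu.2 0
  exact ⟨C, fun i z => by simpa using hC i z⟩

theorem UB.add {u v : ι → X → F} (hu : UB u) (hv : UB v) : UB (fun i z => u i z + v i z) := by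
  refine ⟨fun i => (hu.1 i).add (hv.1 i), fun m => ?_⟩
  obtain ⟨C, hC⟩ := hu.2 m
  obtain ⟨D, hD⟩ := hv.2 m
  refine ⟨C + D, fun i z => ?_⟩
  have : iteratedFDeriv ℝ m (fun z => u i z + v i z) z
      = iteratedFDeriv ℝ m (u i) z + iteratedFDeriv ℝ m (v i) z :=
    iteratedFDeriv_add_apply ((hu.1 i).contDiffAt.of_le (by exact_mod_cast le_top))
      ((hv.1 i).contDiffAt.of_le (by exact_mod_cast le_top))
  rw [this]
  exact (norm_add_le _ _).trans (add_le_add (hC i z) (hD i z))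

theorem UB.zero : UB (fun (_ : ι) (_ : X) => (0 : F)) := by
  refine ⟨fun _ => contDiff_const, fun m => ⟨0, fun i z => ?_⟩⟩
  have : (fun _ : X => (0 : F)) = 0 := rfl
  simp [this]

theorem UB.sum {κ : Type*} {s : Finset κ} {u : κ → ι → X → F} (hu : ∀ j ∈ s, UB (u j)) :
    UB (fun i z => ∑ j ∈ s, u j i z) := by
  classical
  induction s using Finset.induction_on with
  | empty => simpa using UB.zero
  | insert a s ha ih =>
    simp only [Finset.sum_insert ha]
    exact (hu a (Finset.mem_insert_self _ _)).add
      (ih fun j hj => hu j (Finset.mem_insert_of_mem hj))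

theorem UB.bilin (B : F →L[ℝ] G →L[ℝ] H) {u : ι → X → F} {v : ι → X → G} (hu : UB u) (hv : UB v) :
    UB (fun i z => B (u i z) (v i z)) := by
  refine ⟨fun i => B.isBoundedBilinearMap.contDiff.comp₂ (hu.1 i) (hv.1 i), fun m => ?_⟩
  choose C hC using hu.2
  choose D hD using hv.2
  refine ⟨‖B‖ * ∑ i ∈ Finset.range (m + 1), (m.choose i : ℝ) * C i * D (m - i), fun i z => ?_⟩
  refine (B.norm_iteratedFDeriv_le_of_bilinear (hu.1 i) (hv.1 i) z
    (by exact_mod_cast le_top)).trans ?_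
  gcongr with j hj
  · exact mul_nonneg (by positivity) ((norm_nonneg _).trans (hC j i z))
  · exact hC j i z
  · exact hD _ i z

theorem UB.mul {u v : ι → X → ℂ} (hu : UB u) (hv : UB v) : UB (fun i z => u i z * v i z) :=
  UB.bilin (ContinuousLinearMap.mul ℝ ℂ) hu hv

theorem UB.clm_comp (B : F →L[ℝ] G) {u : ι → X → F} (hu : UB u) : UB (fun i z => B (u i z)) := by
  refine ⟨fun i => B.contDiff.comp (hu.1 i), fun m => ?_⟩
  obtain ⟨C, hC⟩ := hu.2 m
  refine ⟨‖B‖ * C, fun i z => ?_⟩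
  refine (B.norm_iteratedFDeriv_comp_left (hu.1 i).contDiffAt (by exact_mod_cast le_top)).trans ?_
  gcongr
  exact hC i z

theorem norm_iteratedFDeriv_comp_affine_le {f : X → F} (hf : ContDiff ℝ ∞ f) (a : X)
    (T : X' →L[ℝ] X) (m : ℕ) (z : X') :
    ‖iteratedFDeriv ℝ m (fun z => f (a + T z)) z‖
      ≤ ‖iteratedFDeriv ℝ m f (a + T z)‖ * ‖T‖ ^ m := by
  have h1 : (fun z => f (a + T z)) = (fun x => f (a + x)) ∘ T := rfl
  have h2 : ContDiff ℝ ∞ (fun x => f (a + x)) := hf.comp (contDiff_const.add contDiff_id)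
  rw [h1, T.iteratedFDeriv_comp_right h2 z (by exact_mod_cast le_top),
    iteratedFDeriv_comp_add_left]
  refine (ContinuousMultilinearMap.norm_compContinuousLinearMap_le _ _).trans ?_
  simp

/-- Translations and contractions keep all bounds. The main use is the change of variables (s, y) ↦
(t₀ + s/ϱ³, y/ϱ), a contraction because ϱ ≥ 1. -/
theorem UB.comp_affine {u : ι → X → F} (hu : UB u) (a : ι → X) (T : ι → X' →L[ℝ] X)
    (hT : ∀ i, ‖T i‖ ≤ 1) :
    UB (fun i z => u i (a i + T i z)) := by
  refine ⟨fun i => (hu.1 i).comp (contDiff_const.add (T i).contDiff), fun m => ?_⟩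
  obtain ⟨C, hC⟩ := hu.2 m
  refine ⟨C, fun i z => ?_⟩
  refine (norm_iteratedFDeriv_comp_affine_le (hu.1 i) _ _ _ _).trans ?_
  refine (mul_le_of_le_one_right (norm_nonneg _) (pow_le_one₀ (norm_nonneg _) (hT i))).trans ?_
  exact hC i _

theorem UB.fderiv {u : ι → X → F} (hu : UB u) : UB (fun i z => _root_.fderiv ℝ (u i) z) := by
  refine ⟨fun i => (hu.1 i).fderiv_right (by simp), fun m => ?_⟩
  obtain ⟨C, hC⟩ := hu.2 (m + 1)
  exact ⟨C, fun i z => by rw [norm_iteratedFDeriv_fderiv]; exact hC i z⟩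

theorem UB.fderiv_apply {u : ι → X → F} (hu : UB u) (v : X) :
    UB (fun i z => _root_.fderiv ℝ (u i) z v) :=
  hu.fderiv.clm_comp (ContinuousLinearMap.apply ℝ F v)

theorem UB.of_hasCompactSupport {f : X → F} (hf : ContDiff ℝ ∞ f) (hs : HasCompactSupport f) :
    UB (fun _ : ι => f) := by
  refine ⟨fun _ => hf, fun m => ?_⟩
  obtain ⟨C, hC⟩ := (hs.iteratedFDeriv (𝕜 := ℝ) m).exists_bound_of_continuous
    (hf.continuous_iteratedFDeriv (by exact_mod_cast le_top))
  exact ⟨C, fun _ z => hC z⟩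

/-- Meant for smooth steps, which are not compactly supported although their derivatives are. -/
theorem UB.of_bounded_of_fderiv {f : X → F} (hf : ContDiff ℝ ∞ f) {C : ℝ} (hC : ∀ x, ‖f x‖ ≤ C)
    (hs : HasCompactSupport (_root_.fderiv ℝ f)) : UB (fun _ : ι => f) := by
  refine ⟨fun _ => hf, fun m => ?_⟩
  rcases m with _ | m
  · exact ⟨C, fun _ z => by simpa using hC z⟩
  · obtain ⟨C, hC⟩ := (UB.of_hasCompactSupport (ι := Unit) (hf.fderiv_right (by simp)) hs).2 m
    exact ⟨C, fun _ z => by rw [← norm_iteratedFDeriv_fderiv]; exact hC () z⟩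

theorem UB.const_family {c : ι → F} {C : ℝ} (hc : ∀ i, ‖c i‖ ≤ C) :
    UB (fun i (_ : X) => c i) := by
  refine ⟨fun _ => contDiff_const, fun m => ?_⟩
  rcases m with _ | m
  · exact ⟨C, fun i z => by simpa using hc i⟩
  · exact ⟨0, fun _ _ => by simp [iteratedFDeriv_succ_const]⟩

theorem UB.congr {u v : ι → X → F} (hu : UB u) (h : ∀ i z, u i z = v i z) : UB v := by
  have : u = v := funext fun i => funext (h i)
  exact this ▸ hu

end Families

/-! ### Primitives in s over long intervals. -/

section Primitive

variable {ι E F G H : Type*} [NormedAddCommGroup E] [NormedSpace ℝ E]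
  [NormedAddCommGroup F] [NormedSpace ℝ F] [NormedAddCommGroup G] [NormedSpace ℝ G]
  [NormedAddCommGroup H] [NormedSpace ℝ H]

/-- A family on `ℝ × E` with uniformly bounded derivatives, supported in `|s| ≤ ℓ i`, whose
derivatives in the second variable are `O(1 / ℓ i)`. -/
structure IB (ℓ : ι → ℝ) (g : ι → ℝ × E → F) : Prop where
  ub : UB g
  supp : ∀ i s y, ℓ i < |s| → g i (s, y) = 0
  slice : ∀ m : ℕ, ∃ C : ℝ, ∀ i s y, ‖iteratedFDeriv ℝ m (fun y => g i (s, y)) y‖ * ℓ i ≤ C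

/-- The primitive in the first variable. -/
noncomputable def prim (g : ι → ℝ × E → F) (i : ι) (z : ℝ × E) : F :=
  ∫ σ in (0 : ℝ)..z.1, g i (σ, z.2)

/-- The derivative in the second variable. -/
noncomputable def sliceDeriv (g : ι → ℝ × E → F) (i : ι) (z : ℝ × E) : E →L[ℝ] F :=
  (fderiv ℝ (g i) z).comp (ContinuousLinearMap.inr ℝ ℝ E)

theorem hasFDerivAt_slice {g : ℝ × E → F} (hg : Differentiable ℝ g) (s : ℝ) (y : E) :
    HasFDerivAt (fun y => g (s, y)) ((fderiv ℝ g (s, y)).comp (ContinuousLinearMap.inr ℝ ℝ E)) y :=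
  (hg (s, y)).hasFDerivAt.comp y (hasFDerivAt_prodMk_right s y)

theorem UB.sliceDeriv {g : ι → ℝ × E → F} (hg : UB g) : UB (sliceDeriv g) :=
  hg.fderiv.clm_comp
    ((ContinuousLinearMap.compL ℝ E (ℝ × E) F).flip (ContinuousLinearMap.inr ℝ ℝ E))

theorem IB.sliceDeriv {ℓ : ι → ℝ} {g : ι → ℝ × E → F} (hg : IB ℓ g) : IB ℓ (sliceDeriv g) := by
  have key : ∀ i s, (fun y => Transport.sliceDeriv g i (s, y))
      = fderiv ℝ (fun y => g i (s, y)) := by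
    intro i s
    funext y
    exact (hasFDerivAt_slice (hg.ub.differentiable i) s y).fderiv.symm
  refine ⟨hg.ub.sliceDeriv, fun i s y hs => ?_, fun m => ?_⟩
  · have h0 : (fun y => g i (s, y)) = fun _ => 0 := by
      funext y
      exact hg.supp i s y hs
    have := congrFun (key i s) y
    rw [this, h0]
    simp
  · obtain ⟨C, hC⟩ := hg.slice (m + 1)
    refine ⟨C, fun i s y => ?_⟩
    rw [key, norm_iteratedFDeriv_fderiv]
    exact hC i s y

/-- The derivative contains nothing but the integrand and a primitive of the same kind, that of
`sliceDeriv g`. This is what makes induction on the order of differentiation possible. -/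
theorem hasFDerivAt_prim [CompleteSpace F] {g : ι → ℝ × E → F} (hg : UB g) (i : ι) (z : ℝ × E) :
    HasFDerivAt (prim g i) ((ContinuousLinearMap.fst ℝ ℝ E).smulRight (g i z)
      + (prim (sliceDeriv g) i z).comp (ContinuousLinearMap.snd ℝ ℝ E)) z := by
  have hgc := hg.continuous i
  have hdc := hg.sliceDeriv.continuous i
  obtain ⟨C, hC⟩ := hg.sliceDeriv.exists_norm_le
  -- Both partial derivatives exist and are continuous, which gives joint differentiability.
  have h := hasStrictFDerivAt_uncurry_coprod (𝕜 := ℝ) (u := z)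
    (f := fun s y => prim g i (s, y))
    (f₁ := fun s y => (ContinuousLinearMap.toSpanSingleton ℝ (g i (s, y)) : ℝ →L[ℝ] F))
    (f₂ := fun s y => prim (sliceDeriv g) i (s, y)) ?_ ?_ ?_ ?_
  · refine h.hasFDerivAt.congr_fderiv ?_
    ext v
    · simp [Function.HasUncurry.uncurry]
    · simp [Function.HasUncurry.uncurry]
  · refine Filter.Eventually.of_forall fun v => ?_
    have h1 : Continuous fun σ => g i (σ, v.2) := hgc.comp (by fun_prop)
    have := intervalIntegral.integral_hasDerivAt_right (h1.intervalIntegrable 0 v.1)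
      h1.stronglyMeasurable.stronglyMeasurableAtFilter h1.continuousAt
    exact this.hasFDerivAt
  · refine Filter.Eventually.of_forall fun v => ?_
    have h1 : ∀ y, Continuous fun σ => g i (σ, y) := fun y => hgc.comp (by fun_prop)
    have h2 : ∀ y, Continuous fun σ => sliceDeriv g i (σ, y) := fun y => hdc.comp (by fun_prop)
    exact intervalIntegral.hasFDerivAt_integral_of_dominated_of_fderiv_le
      (F := fun y σ => g i (σ, y)) (F' := fun y σ => sliceDeriv g i (σ, y))
      (bound := fun _ => C) Filter.univ_mem
      (Filter.Eventually.of_forall fun y => (h1 y).aestronglyMeasurable)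
      ((h1 _).intervalIntegrable _ _) (h2 _).aestronglyMeasurable
      (Filter.Eventually.of_forall fun σ _ y _ => hC i _) (by simp)
      (Filter.Eventually.of_forall fun σ _ y _ => hasFDerivAt_slice (hg.differentiable i) σ y)
  · have : Continuous fun z : ℝ × E =>
        (ContinuousLinearMap.toSpanSingleton ℝ (g i z) : ℝ →L[ℝ] F) :=
      (ContinuousLinearMap.smulRightL ℝ ℝ F (ContinuousLinearMap.id ℝ ℝ)).continuous.comp hgc
    exact this.continuousAt
  · have : Continuous fun z : ℝ × E => prim (sliceDeriv g) i z :=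
      intervalIntegral.continuous_parametric_intervalIntegral_of_continuous
        (f := fun z : ℝ × E => fun σ => sliceDeriv g i (σ, z.2)) (hdc.comp (by fun_prop))
        continuous_fst
    exact this.continuousAt

/-- An integrand of size O(1/ℓ) is integrated over a length of at most ℓ, as it vanishes for |s| >
ℓ. -/
theorem norm_prim_le {ℓ : ι → ℝ} (hℓ : ∀ i, 0 < ℓ i) {g : ι → ℝ × E → F} (hg : IB ℓ g) :
    ∃ C : ℝ, ∀ i z, ‖prim g i z‖ ≤ C := by
  obtain ⟨C, hC⟩ := hg.slice 0
  refine ⟨C, fun i z => ?_⟩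
  obtain ⟨s, y⟩ := z
  have hgc : Continuous fun σ => g i (σ, y) := (hg.ub.continuous i).comp (by fun_prop)
  have hb : ∀ σ, ‖g i (σ, y)‖ ≤ C / ℓ i := fun σ => by
    rw [le_div_iff₀ (hℓ i)]
    simpa using hC i σ y
  have hC0 : 0 ≤ C := le_trans (by have := (hℓ i).le; positivity) (hC i 0 y)
  have main : ∀ s, |s| ≤ ℓ i → ‖∫ σ in (0 : ℝ)..s, g i (σ, y)‖ ≤ C := fun s hs => by
    refine (intervalIntegral.norm_integral_le_of_norm_le_const (fun σ _ => hb σ)).trans ?_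
    rw [sub_zero, div_mul_eq_mul_div, div_le_iff₀ (hℓ i)]
    gcongr
  unfold prim
  simp only
  rcases le_or_gt |s| (ℓ i) with h | h
  · exact main s h
  -- Outside the support the end point s can be moved back to ±ℓ.
  · obtain ⟨b, hb, hz⟩ : ∃ b, |b| ≤ ℓ i ∧ ∫ σ in b..s, g i (σ, y) = 0 := by
      rcases le_or_gt 0 s with h0 | h0
      · refine ⟨ℓ i, (abs_of_pos (hℓ i)).le, ?_⟩
        rw [abs_of_nonneg h0] at h
        rw [intervalIntegral.integral_of_le h.le, MeasureTheory.setIntegral_eq_zero_of_forall_eq_zero]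
        intro σ hσ
        exact hg.supp i σ y (hσ.1.trans_le (le_abs_self _))
      · refine ⟨-ℓ i, by rw [abs_neg, abs_of_pos (hℓ i)], ?_⟩
        rw [abs_of_neg h0] at h
        rw [intervalIntegral.integral_of_ge (by linarith),
          MeasureTheory.integral_Ioc_eq_integral_Ioo,
          MeasureTheory.setIntegral_eq_zero_of_forall_eq_zero, neg_zero]
        intro σ hσ
        refine hg.supp i σ y (lt_of_lt_of_le ?_ (neg_le_abs _))
        linarith [hσ.2]
    rw [← intervalIntegral.integral_add_adjacent_intervals (hgc.intervalIntegrable 0 b)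
      (hgc.intervalIntegrable b s), hz, add_zero]
    exact main b hb

theorem fderiv_prim [CompleteSpace F] {g : ι → ℝ × E → F} (hg : UB g) (i : ι) :
    fderiv ℝ (prim g i) = fun z =>
      ((ContinuousLinearMap.smulRightL ℝ (ℝ × E) F) (ContinuousLinearMap.fst ℝ ℝ E)) (g i z)
      + ((ContinuousLinearMap.compL ℝ (ℝ × E) E F).flip (ContinuousLinearMap.snd ℝ ℝ E))
        (prim (sliceDeriv g) i z) := by
  funext z
  rw [(hasFDerivAt_prim hg i z).fderiv]
  rfl

/-- The target space is quantified inside the induction, since the inductive step is applied to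
functions with values in `E →L[ℝ] F`. For the same reason `E` and `F` share one universe. -/
theorem contDiff_prim_nat {ι : Type*} {E : Type} [NormedAddCommGroup E] [NormedSpace ℝ E] (m : ℕ) :
    ∀ (F : Type) [NormedAddCommGroup F] [NormedSpace ℝ F] [CompleteSpace F]
      {g : ι → ℝ × E → F} (_ : UB g) (i : ι), ContDiff ℝ m (prim g i) := by
  induction m with
  | zero =>
    intro F _ _ _ g hg i
    have : Differentiable ℝ (prim g i) := fun z => (hasFDerivAt_prim hg i z).differentiableAt
    exact_mod_cast contDiff_zero.2 this.continuous
  | succ m ih =>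
    intro F _ _ _ g hg i
    have h := contDiff_succ_iff_fderiv (𝕜 := ℝ) (f := prim g i) (n := (m : ℕ∞ω))
    have h2 := h.2 ⟨fun z => (hasFDerivAt_prim hg i z).differentiableAt, by simp, by
      rw [fderiv_prim hg i]
      refine (ContinuousLinearMap.contDiff _ |>.comp ((hg.1 i).of_le ?_)).add
        (ContinuousLinearMap.contDiff _ |>.comp (ih _ hg.sliceDeriv i))
      exact_mod_cast le_top⟩
    exact_mod_cast h2

theorem norm_iteratedFDeriv_prim_le {ι : Type*} {E : Type} [NormedAddCommGroup E] [NormedSpace ℝ E]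
    {ℓ : ι → ℝ} (hℓ : ∀ i, 0 < ℓ i) (m : ℕ) :
    ∀ (F : Type) [NormedAddCommGroup F] [NormedSpace ℝ F] [CompleteSpace F]
      {g : ι → ℝ × E → F} (_ : IB ℓ g), ∃ C : ℝ, ∀ i z, ‖iteratedFDeriv ℝ m (prim g i) z‖ ≤ C := by
  induction m with
  | zero =>
    intro F _ _ _ g hg
    simpa using norm_prim_le hℓ hg
  | succ m ih =>
    intro F _ _ _ g hg
    obtain ⟨C, hC⟩ := ih _ hg.sliceDeriv
    obtain ⟨D, hD⟩ := hg.ub.2 m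
    set A := (ContinuousLinearMap.smulRightL ℝ (ℝ × E) F) (ContinuousLinearMap.fst ℝ ℝ E) with hA
    set B := (ContinuousLinearMap.compL ℝ (ℝ × E) E F).flip (ContinuousLinearMap.snd ℝ ℝ E) with hB
    refine ⟨‖A‖ * D + ‖B‖ * C, fun i z => ?_⟩
    rw [← norm_iteratedFDeriv_fderiv, fderiv_prim hg.ub i]
    have h1 : ContDiff ℝ m (g i) := (hg.ub.1 i).of_le (by exact_mod_cast le_top)
    have h2 := contDiff_prim_nat m _ hg.ub.sliceDeriv i
    have : (fun z => A (g i z) + B (prim (sliceDeriv g) i z))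
      = (A ∘ g i) + (B ∘ prim (sliceDeriv g) i) := rfl
    rw [this, iteratedFDeriv_add (A.contDiff.comp h1) (B.contDiff.comp h2)]
    refine (norm_add_le _ _).trans (add_le_add ?_ ?_)
    · refine (A.norm_iteratedFDeriv_comp_left h1.contDiffAt le_rfl).trans ?_
      gcongr
      exact hD i z
    · refine (B.norm_iteratedFDeriv_comp_left h2.contDiffAt le_rfl).trans ?_
      gcongr
      exact hC i z

theorem IB.prim {E F : Type} [NormedAddCommGroup E] [NormedSpace ℝ E] [NormedAddCommGroup F]
    [NormedSpace ℝ F] [CompleteSpace F] {ℓ : ι → ℝ} (hℓ : ∀ i, 0 < ℓ i) {g : ι → ℝ × E → F}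
    (hg : IB ℓ g) : UB (prim g) :=
  ⟨fun i => contDiff_infty.2 fun m => contDiff_prim_nat m F hg.ub i,
    fun m => norm_iteratedFDeriv_prim_le hℓ m F hg⟩

end Primitive

end Transport

namespace Transport

/-! ### Linear ordinary differential equations: global solutions, smoothness, fundamental solutions.
-/

section LinearODE

variable {X : Type*} [NormedAddCommGroup X] [NormedSpace ℝ X]

/-- The terms of the Dyson series. -/
noncomputable def dyson (L : ℝ → X →L[ℝ] X) (t₀ : ℝ) (x : X) : ℕ → ℝ → X
  | 0, _ => x
  | k + 1, t => ∫ σ in t₀..t, L σ (dyson L t₀ x k σ)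

variable {L : ℝ → X →L[ℝ] X} {t₀ : ℝ} {x : X}

theorem continuous_dyson (hL : Continuous L) (k : ℕ) : Continuous (dyson L t₀ x k) := by
  induction k with
  | zero => exact continuous_const
  | succ k ih =>
    refine intervalIntegral.continuous_primitive (fun a b => ?_) t₀
    exact (hL.clm_apply ih).intervalIntegrable a b

theorem hasDerivAt_dyson_succ [CompleteSpace X] (hL : Continuous L) (k : ℕ) (t : ℝ) :
    HasDerivAt (dyson L t₀ x (k + 1)) (L t (dyson L t₀ x k t)) t := by
  have h : Continuous fun σ => L σ (dyson L t₀ x k σ) := hL.clm_apply (continuous_dyson hL k)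
  exact intervalIntegral.integral_hasDerivAt_right (h.intervalIntegrable _ _)
    h.stronglyMeasurable.stronglyMeasurableAtFilter h.continuousAt

/-- Integrating |σ - t₀|^k repeatedly produces the factorial, so the series converges at all times
and the solution is global. -/
theorem norm_dyson_le (hL : Continuous L) {K : ℝ} (hK : ∀ t, ‖L t‖ ≤ K) (k : ℕ) (t : ℝ) :
    ‖dyson L t₀ x k t‖ ≤ (K * |t - t₀|) ^ k / k.factorial * ‖x‖ := by
  have hK0 : 0 ≤ K := (norm_nonneg _).trans (hK 0)
  induction k generalizing t with
  | zero => simp [dyson]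
  | succ k ih =>
    have h : Continuous fun σ => L σ (dyson L t₀ x k σ) := hL.clm_apply (continuous_dyson hL k)
    calc ‖dyson L t₀ x (k + 1) t‖
        ≤ ∫ σ in Set.uIoc t₀ t, ‖L σ (dyson L t₀ x k σ)‖ :=
          intervalIntegral.norm_integral_le_integral_norm_uIoc
      _ ≤ ∫ σ in Set.uIoc t₀ t, (K ^ (k + 1) / k.factorial * ‖x‖) * |σ - t₀| ^ k := by
          refine MeasureTheory.setIntegral_mono ?_ ?_ fun σ => ?_
          · exact (h.norm.intervalIntegrable t₀ t).def'
          · have : Continuous fun σ : ℝ => (K ^ (k + 1) / k.factorial * ‖x‖) * |σ - t₀| ^ k := by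
              fun_prop
            exact (this.intervalIntegrable t₀ t).def'
          · refine ((L σ).le_opNorm _).trans ?_
            calc ‖L σ‖ * ‖dyson L t₀ x k σ‖
                ≤ K * ((K * |σ - t₀|) ^ k / k.factorial * ‖x‖) := by
                  gcongr
                  · exact hK σ
                  · exact ih σ
              _ = _ := by rw [mul_pow]; ring
      _ = (K * |t - t₀|) ^ (k + 1) / (k + 1).factorial * ‖x‖ := by
          rw [MeasureTheory.integral_const_mul, integral_pow_abs_sub_uIoc, mul_pow,
            Nat.factorial_succ]
          push_cast
          field_simp

theorem exists_linear_flow [CompleteSpace X] (hL : Continuous L) {K : ℝ} (hK : ∀ t, ‖L t‖ ≤ K) (t₀ : ℝ) (x : X) :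
    ∃ u : ℝ → X, u t₀ = x ∧ ∀ t, HasDerivAt u (L t (u t)) t := by
  have hK0 : 0 ≤ K := (norm_nonneg _).trans (hK 0)
  have hsum : ∀ t, Summable fun k => dyson L t₀ x k t := fun t =>
    Summable.of_norm_bounded ((Real.summable_pow_div_factorial (K * |t - t₀|)).mul_right ‖x‖)
      fun k => norm_dyson_le hL hK k t
  refine ⟨fun t => ∑' k, dyson L t₀ x k t, ?_, fun t => ?_⟩
  · change ∑' k, dyson L t₀ x k t₀ = x
    rw [tsum_eq_single 0]
    · rfl
    · intro k hk
      obtain ⟨j, rfl⟩ := Nat.exists_eq_succ_of_ne_zero hk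
      simp [dyson]
  · set ρ := |t - t₀| + 1 with hρ
    have hmem : ∀ τ, τ ∈ Metric.ball t₀ ρ ↔ |τ - t₀| < ρ := fun τ => by
      rw [Metric.mem_ball, Real.dist_eq]
    have hu : Summable fun k : ℕ => K * ((K * ρ) ^ k / k.factorial * ‖x‖) :=
      ((Real.summable_pow_div_factorial (K * ρ)).mul_right ‖x‖).mul_left K
    have key := hasDerivAt_tsum_of_isPreconnected (𝕜 := ℝ) (t := Metric.ball t₀ ρ)
      (g := fun k => dyson L t₀ x (k + 1)) (g' := fun k τ => L τ (dyson L t₀ x k τ))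
      (y₀ := t) (y := t) hu
      Metric.isOpen_ball (convex_ball t₀ ρ).isPreconnected
      (fun k τ _ => hasDerivAt_dyson_succ hL k τ) (fun k τ hτ => ?_) ((hmem t).2 (by linarith))
      ((summable_nat_add_iff 1).2 (hsum t)) ((hmem t).2 (by linarith))
    · rw [← (L t).map_tsum (hsum t)] at key
      have : (fun t => ∑' k, dyson L t₀ x k t) = fun t => x + ∑' k, dyson L t₀ x (k + 1) t := by
        funext τ
        rw [(hsum τ).tsum_eq_zero_add]
        rfl
      have h3 := key.const_add x
      rw [← this] at h3
      exact h3
    · refine ((L τ).le_opNorm _).trans ?_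
      have h1 := norm_dyson_le (x := x) (t₀ := t₀) hL hK k τ
      gcongr
      · exact hK τ
      · refine h1.trans ?_
        have := ((hmem τ).1 hτ).le
        gcongr

theorem contDiff_of_linear_ode (hL : ContDiff ℝ ∞ L) {u : ℝ → X}
    (hu : ∀ t, HasDerivAt u (L t (u t)) t) : ContDiff ℝ ∞ u := by
  have hd : Differentiable ℝ u := fun t => (hu t).differentiableAt
  have hderiv : deriv u = fun t => L t (u t) := funext fun t => (hu t).deriv
  refine contDiff_infty.2 fun k => ?_
  induction k with
  | zero => exact_mod_cast contDiff_zero.2 hd.continuous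
  | succ k ih =>
    have : ContDiff ℝ ((k : ℕ∞ω) + 1) u := by
      rw [contDiff_succ_iff_deriv]
      refine ⟨hd, by simp, ?_⟩
      rw [hderiv]
      exact (hL.of_le (by exact_mod_cast le_top)).clm_apply ih
    exact_mod_cast this

/-- The fundamental solution of `u' = M u` and its left inverse. -/
theorem exists_fundamental_pair {A : Type*} [NormedRing A] [NormedAlgebra ℝ A] [CompleteSpace A]
    {M : ℝ → A} (hM : ContDiff ℝ ∞ M) (hc : HasCompactSupport M) (t₀ : ℝ) :
    ∃ U V : ℝ → A, ContDiff ℝ ∞ U ∧ ContDiff ℝ ∞ V ∧ U t₀ = 1 ∧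
      (∀ t, HasDerivAt U (M t * U t) t) ∧
      ∀ J, (∀ t, Commute J (M t)) → ∀ t, V t * J * U t = J := by
  obtain ⟨K, hK⟩ := hc.exists_bound_of_continuous hM.continuous
  let B := ContinuousLinearMap.mul ℝ A
  have hA : ContDiff ℝ ∞ fun t => B (M t) := B.contDiff.comp hM
  have hB : ContDiff ℝ ∞ fun t => B.flip (-M t) := B.flip.contDiff.comp hM.neg
  obtain ⟨U, hU0, hU⟩ := exists_linear_flow hA.continuous (K := ‖B‖ * K)
    (fun t => (B.le_opNorm _).trans (by gcongr; exact hK t)) t₀ 1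
  obtain ⟨V, hV0, hV⟩ := exists_linear_flow hB.continuous (K := ‖B.flip‖ * K)
    (fun t => (B.flip.le_opNorm _).trans (by rw [norm_neg]; gcongr; exact hK t)) t₀ 1
  refine ⟨U, V, contDiff_of_linear_ode hA hU, contDiff_of_linear_ode hB hV, hU0, hU,
    fun J hJ t => ?_⟩
  -- As U' = MU and V' = -VM, the product VJU is conserved if J commutes with M. Taking J = 1 gives
  -- the left inverse, and other J give commutation with U.
  have hd : ∀ t, HasDerivAt (fun t => V t * J * U t) 0 t := fun t => by
    refine (((hV t).mul_const J).mul (hU t)).congr_deriv ?_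
    simp only [B, ContinuousLinearMap.flip_apply, ContinuousLinearMap.mul_apply']
    have : V t * J * (M t * U t) = V t * M t * J * U t := by
      rw [mul_assoc (V t) J, ← mul_assoc J, (hJ t).eq]
      noncomm_ring
    rw [this]
    noncomm_ring
  have := is_const_of_deriv_eq_zero (fun t => (hd t).differentiableAt) (fun t => (hd t).deriv) t t₀
  simpa [hU0, hV0] using this

/-- The fundamental solution of `u' = M u` in finite dimension and its inverse. -/
theorem exists_fundamental_solution {F : Type*} [NormedAddCommGroup F] [NormedSpace ℝ F]
    [FiniteDimensional ℝ F] {M : ℝ → F →L[ℝ] F} (hM : ContDiff ℝ ∞ M) (hc : HasCompactSupport M)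
    (t₀ : ℝ) :
    ∃ U V : ℝ → F →L[ℝ] F, ContDiff ℝ ∞ U ∧ ContDiff ℝ ∞ V ∧ U t₀ = 1 ∧
      (∀ t, HasDerivAt U (M t * U t) t) ∧ (∀ t, U t * V t = 1) ∧
      ∀ J, (∀ t, Commute J (M t)) → ∀ t, Commute J (U t) := by
  have : CompleteSpace F := FiniteDimensional.complete ℝ F
  obtain ⟨U, V, h1, h2, h3, h4, h5⟩ := exists_fundamental_pair hM hc t₀
  have h6 : ∀ t, U t * V t = 1 := fun t => by
    have h := h5 1 (fun t => Commute.one_left _) t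
    rw [mul_one] at h
    -- In finite dimension a left inverse is also a right inverse.
    have h' : (V t : F →ₗ[ℝ] F) * (U t : F →ₗ[ℝ] F) = 1 := by
      ext v
      exact congrArg (fun W : F →L[ℝ] F => W v) h
    have h'' := mul_eq_one_comm.1 h'
    ext v
    exact congrArg (fun W : F →ₗ[ℝ] F => W v) h''
  refine ⟨U, V, h1, h2, h3, h4, h6, fun J hJ t => ?_⟩
  have := h5 J hJ t
  calc J * U t = (U t * V t) * J * U t := by rw [h6, one_mul]
    _ = U t * (V t * J * U t) := by noncomm_ring
    _ = U t * J := by rw [this]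

end LinearODE

end Transport

namespace Transport

/-! ### Linear evolution equations in the scaled time. -/

section ScaledEvolution

variable {ι E F G H : Type*} [NormedAddCommGroup E] [NormedSpace ℝ E]
  [NormedAddCommGroup F] [NormedSpace ℝ F] [NormedAddCommGroup G] [NormedSpace ℝ G]
  [NormedAddCommGroup H] [NormedSpace ℝ H]

theorem exists_cutoff [FiniteDimensional ℝ E] {a b δ η : ℝ} (hab : a < b) (hδ : 0 < δ)
    (hη : 0 < η) :
    ∃ κ : ℝ × E → ℝ, ContDiff ℝ ∞ κ ∧ HasCompactSupport κ ∧
      (∀ t ∈ Set.Icc a b, ∀ y, ‖y‖ ≤ δ → κ (t, y) = 1) ∧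
      tsupport κ ⊆ Set.Icc (a - η) (b + η) ×ˢ Metric.closedBall 0 (2 * δ) := by
  let p : ContDiffBump ((a + b) / 2) := ⟨(b - a) / 2, (b - a) / 2 + η, by linarith, by linarith⟩
  let q : ContDiffBump (0 : E) := ⟨δ, 2 * δ, hδ, by linarith⟩
  have hsub : tsupport (fun z : ℝ × E => p z.1 * q z.2)
      ⊆ Set.Icc (a - η) (b + η) ×ˢ Metric.closedBall 0 (2 * δ) := by
    refine closure_minimal (fun z hz => ?_) (isClosed_Icc.prod Metric.isClosed_closedBall)
    rw [Function.mem_support] at hz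
    have h1 : z.1 ∈ Function.support p := left_ne_zero_of_mul hz
    have h2 : z.2 ∈ Function.support q := right_ne_zero_of_mul hz
    rw [ContDiffBump.support_eq, Metric.mem_ball, Real.dist_eq] at h1
    rw [ContDiffBump.support_eq] at h2
    change |z.1 - (a + b) / 2| < (b - a) / 2 + η at h1
    rw [abs_lt] at h1
    exact ⟨⟨by linarith, by linarith⟩, Metric.ball_subset_closedBall h2⟩
  refine ⟨fun z => p z.1 * q z.2, (p.contDiff.comp contDiff_fst).mul (q.contDiff.comp contDiff_snd),
    ?_, fun t ht y hy => ?_, hsub⟩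
  · have : ProperSpace E := FiniteDimensional.proper ℝ E
    exact (isCompact_Icc.prod (isCompact_closedBall 0 (2 * δ))).of_isClosed_subset
      (isClosed_tsupport _) hsub
  · have h1 : p t = 1 := p.one_of_mem_closedBall (by
      rw [Metric.mem_closedBall, Real.dist_eq, abs_le]
      change -((b - a) / 2) ≤ _ ∧ _ ≤ (b - a) / 2
      constructor <;> linarith [ht.1, ht.2])
    have h2 : q y = 1 := q.one_of_mem_closedBall (by simpa using hy)
    simp [h1, h2]

/-- The point `(t₀ + s / ϱ³, y / ϱ)`. -/
noncomputable def unscale (t₀ ϱ : ℝ) (z : ℝ × E) : ℝ × E := (t₀ + z.1 / ϱ ^ 3, ϱ⁻¹ • z.2)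

theorem UB.comp_unscale {c : ι → ℝ × E → F} (hc : UB c) (t₀ : ℝ) {ϱ : ι → ℝ}
    (hϱ : ∀ i, 1 ≤ ϱ i) : UB (fun i z => c i (unscale t₀ (ϱ i) z)) := by
  have h1 : ∀ i, 0 < ϱ i := fun i => by linarith [hϱ i]
  refine (hc.comp_affine (fun _ => (t₀, 0)) (fun i =>
    (((ϱ i ^ 3)⁻¹ • ContinuousLinearMap.fst ℝ ℝ E).prod
      ((ϱ i)⁻¹ • ContinuousLinearMap.snd ℝ ℝ E))) fun i => ?_).congr fun i z => ?_
  · refine ContinuousLinearMap.opNorm_le_bound _ zero_le_one fun z => ?_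
    rw [ContinuousLinearMap.prod_apply, Prod.norm_def, one_mul]
    refine max_le ?_ ?_
    · simp only [_root_.smul_apply, ContinuousLinearMap.coe_fst', norm_smul]
      have := h1 i
      refine (mul_le_of_le_one_left (norm_nonneg _) ?_).trans (norm_fst_le z)
      rw [norm_inv, Real.norm_of_nonneg (by positivity)]
      exact inv_le_one_of_one_le₀ (one_le_pow₀ (hϱ i))
    · simp only [_root_.smul_apply, ContinuousLinearMap.coe_snd', norm_smul]
      refine (mul_le_of_le_one_left (norm_nonneg _) ?_).trans (norm_snd_le z)
      rw [norm_inv, Real.norm_of_nonneg (h1 i).le]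
      exact inv_le_one_of_one_le₀ (hϱ i)
  · simp [unscale, div_eq_inv_mul]

theorem UB.slice {u : ι → ℝ × E → F} (hu : UB u) (m : ℕ) :
    ∃ C : ℝ, ∀ i s y, ‖iteratedFDeriv ℝ m (fun y => u i (s, y)) y‖ ≤ C := by
  obtain ⟨C, hC⟩ := hu.2 m
  refine ⟨C, fun i s y => ?_⟩
  have h := norm_iteratedFDeriv_comp_affine_le (hu.1 i) (s, 0) (ContinuousLinearMap.inr ℝ ℝ E) m y
  simp only [ContinuousLinearMap.inr_apply, Prod.mk_add_mk, add_zero, zero_add] at h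
  refine h.trans ((mul_le_of_le_one_right (norm_nonneg _) ?_).trans (hC i _))
  exact pow_le_one₀ (norm_nonneg _) (ContinuousLinearMap.norm_inr_le_one ℝ ℝ E)

theorem contDiff_slice {u : ℝ × E → F} (hu : ContDiff ℝ ∞ u) (s : ℝ) :
    ContDiff ℝ ∞ fun y => u (s, y) := hu.comp (by fun_prop)

theorem IB.bilin (B : F →L[ℝ] G →L[ℝ] H) {ℓ : ι → ℝ} (hℓ : ∀ i, 0 < ℓ i) {u : ι → ℝ × E → F}
    {g : ι → ℝ × E → G} (hu : UB u) (hg : IB ℓ g) : IB ℓ (fun i z => B (u i z) (g i z)) := by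
  refine ⟨hu.bilin B hg.ub, fun i s y h => by simp [hg.supp i s y h], fun m => ?_⟩
  choose C hC using hu.slice
  choose D hD using hg.slice
  refine ⟨‖B‖ * ∑ i ∈ Finset.range (m + 1), (m.choose i : ℝ) * C i * D (m - i), fun i s y => ?_⟩
  refine (mul_le_mul_of_nonneg_right (B.norm_iteratedFDeriv_le_of_bilinear
    (contDiff_slice (hu.1 i) s) (contDiff_slice (hg.ub.1 i) s) y
    (by exact_mod_cast le_top)) (hℓ i).le).trans ?_
  rw [mul_assoc, Finset.sum_mul]
  refine mul_le_mul_of_nonneg_left (Finset.sum_le_sum fun j _ => ?_) (norm_nonneg B)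
  rw [mul_assoc]
  refine mul_le_mul ?_ (hD _ i s y) (mul_nonneg (norm_nonneg _) (hℓ i).le)
    (mul_nonneg (by positivity) ((norm_nonneg _).trans (hC j i s y)))
  gcongr
  exact hC j i s y

theorem IB.add {ℓ : ι → ℝ} (hℓ : ∀ i, 0 < ℓ i) {u v : ι → ℝ × E → F} (hu : IB ℓ u)
    (hv : IB ℓ v) : IB ℓ (fun i z => u i z + v i z) := by
  refine ⟨hu.ub.add hv.ub, fun i s y h => by simp [hu.supp i s y h, hv.supp i s y h], fun m => ?_⟩
  obtain ⟨C, hC⟩ := hu.slice m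
  obtain ⟨D, hD⟩ := hv.slice m
  refine ⟨C + D, fun i s y => ?_⟩
  have : iteratedFDeriv ℝ m (fun y => u i (s, y) + v i (s, y)) y
      = iteratedFDeriv ℝ m (fun y => u i (s, y)) y + iteratedFDeriv ℝ m (fun y => v i (s, y)) y :=
    iteratedFDeriv_add_apply ((contDiff_slice (hu.ub.1 i) s).contDiffAt.of_le
      (by exact_mod_cast le_top)) ((contDiff_slice (hv.ub.1 i) s).contDiffAt.of_le
      (by exact_mod_cast le_top))
  rw [this]
  refine (mul_le_mul_of_nonneg_right (norm_add_le _ _) (hℓ i).le).trans ?_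
  rw [add_mul]
  exact add_le_add (hC i s y) (hD i s y)

theorem IB.zero (ℓ : ι → ℝ) : IB ℓ (fun _ (_ : ℝ × E) => (0 : F)) := by
  refine ⟨UB.zero, fun _ _ _ _ => rfl, fun m => ⟨0, fun i s y => ?_⟩⟩
  have : (fun _ : E => (0 : F)) = 0 := rfl
  simp [this]

theorem IB.sum {κ : Type*} {ℓ : ι → ℝ} (hℓ : ∀ i, 0 < ℓ i) {s : Finset κ}
    {u : κ → ι → ℝ × E → F} (hu : ∀ j ∈ s, IB ℓ (u j)) : IB ℓ (fun i z => ∑ j ∈ s, u j i z) := by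
  classical
  induction s using Finset.induction_on with
  | empty => simpa using IB.zero ℓ
  | insert a s ha ih =>
    simp only [Finset.sum_insert ha]
    exact (hu a (Finset.mem_insert_self _ _)).add hℓ
      (ih fun j hj => hu j (Finset.mem_insert_of_mem hj))

/-- The functions of the family vanish where `‖y‖ > 1`. -/
def YSupp (u : ι → ℝ × E → F) : Prop := ∀ i s y, 1 < ‖y‖ → u i (s, y) = 0

theorem UB.hasDerivAt_fst {u : ι → ℝ × E → F} (hu : UB u) (i : ι) (s : ℝ) (y : E) :
    HasDerivAt (fun s => u i (s, y)) (_root_.fderiv ℝ (u i) (s, y) (1, 0)) s :=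
  (hu.differentiable i (s, y)).hasFDerivAt.comp_hasDerivAt s
    ((hasDerivAt_id s).prodMk (hasDerivAt_const s y))

end ScaledEvolution

/-- Solution of linear evolution equations with bounds for all derivatives. -/
theorem exists_scaled_evolution {ι : Type*} {E F : Type} [NormedAddCommGroup E] [NormedSpace ℝ E]
    [FiniteDimensional ℝ E] [NormedAddCommGroup F] [NormedSpace ℝ F] [NormedSpace ℂ F]
    [IsScalarTower ℝ ℂ F] [FiniteDimensional ℝ F] {ϱ ℓ : ι → ℝ} (hϱ : ∀ i, 1 ≤ ϱ i)
    (hℓ : ∀ i, 0 < ℓ i) {a b δ : ℝ} (hab : a < b) (hδ : 0 < δ) (hδϱ : ∀ i, (ϱ i)⁻¹ ≤ δ) (t₀ : ℝ)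
    (ht₀ : t₀ ∈ Set.Ioo a b)
    {M : ℝ → F →L[ℝ] F} (hM : ContDiff ℝ ∞ M) (hMc : HasCompactSupport M)
    (hMl : ∀ t (c : ℂ) v, M t (c • v) = c • M t v)
    {R : ℝ × E → ℂ} (hR : ContDiff ℝ ∞ R) (hRc : HasCompactSupport R)
    {g : ι → ℝ × E → F} (hg : IB ℓ g) (hgy : YSupp g)
    {u₀ : E → F} (hu₀ : ContDiff ℝ ∞ u₀) (hu₀y : ∀ y, 1 < ‖y‖ → u₀ y = 0) :
    ∃ u : ι → ℝ × E → F, UB u ∧ YSupp u ∧ (∀ i y, u i (0, y) = u₀ y) ∧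
      ∀ i s y, t₀ + s / ϱ i ^ 3 ∈ Set.Ioo a b →
        fderiv ℝ (u i) (s, y) (1, 0)
          = (ϱ i ^ 3)⁻¹ • (M (t₀ + s / ϱ i ^ 3) (u i (s, y))
              + R (unscale t₀ (ϱ i) (s, y)) • u i (s, y)) + g i (s, y) := by
  have : CompleteSpace F := FiniteDimensional.complete ℝ F
  have : ProperSpace E := FiniteDimensional.proper ℝ E
  have hϱ0 : ∀ i, 0 < ϱ i := fun i => by linarith [hϱ i]
  obtain ⟨U, V, hU, hV, hU0, hUd, hUV, hUJ⟩ := exists_fundamental_solution hM hMc t₀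
  obtain ⟨κ, hκ, hκc, hκ1, -⟩ := exists_cutoff (E := E) hab hδ one_pos
  -- the integrating factor
  let R' : Unit → ℝ × E → ℂ := fun _ z => R (t₀ + z.1, z.2)
  have hR' : UB R' := by
    refine ((UB.of_hasCompactSupport (ι := Unit) hR hRc).comp_affine (fun _ => (t₀, 0))
      (fun _ => ContinuousLinearMap.id ℝ (ℝ × E)) fun _ =>
        ContinuousLinearMap.norm_id_le).congr fun _ z => ?_
    obtain ⟨s, y⟩ := z
    simp [R']
  let r : ℝ × E → ℂ := fun z => prim R' () (z.1 - t₀, z.2)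
  have hr : ContDiff ℝ ∞ r := (contDiff_infty.2 fun m => contDiff_prim_nat m ℂ hR' ()).comp
    ((contDiff_fst.sub contDiff_const).prodMk contDiff_snd)
  have hr0 : ∀ y, r (t₀, y) = 0 := fun y => by simp [r, prim]
  have hrd : ∀ t y, HasDerivAt (fun t => r (t, y)) (R (t, y)) t := fun t y => by
    have h1 := hasFDerivAt_prim hR' () (t - t₀, y)
    have h2 : HasDerivAt (fun t => (t - t₀, y)) ((1 : ℝ), (0 : E)) t :=
      ((hasDerivAt_id t).sub_const t₀).prodMk (hasDerivAt_const t y)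
    refine (h1.comp_hasDerivAt t h2).congr_deriv ?_
    simp [R']
  -- The propagator e^r U and its inverse, cut off by κ. They are fixed compactly supported
  -- functions of (t, y/ϱ), so their bounds do not depend on ϱ or on the length of the interval in
  -- s.
  let PU : ℝ × E → F →L[ℝ] F := fun z =>
    ContinuousLinearMap.lsmul ℝ ℂ ((κ z : ℂ) * Complex.exp (r z)) * U z.1
  let PV : ℝ × E → F →L[ℝ] F := fun z =>
    ContinuousLinearMap.lsmul ℝ ℂ ((κ z : ℂ) * Complex.exp (-r z)) * V z.1
  have hPUa : ∀ z v, PU z v = ((κ z : ℂ) * Complex.exp (r z)) • U z.1 v := fun z v => rfl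
  have hPVa : ∀ z v, PV z v = ((κ z : ℂ) * Complex.exp (-r z)) • V z.1 v := fun z v => rfl
  have hsm : ∀ {w : ℝ × E → ℂ} {W : ℝ → F →L[ℝ] F}, ContDiff ℝ ∞ w → ContDiff ℝ ∞ W →
      UB (fun (_ : ι) (z : ℝ × E) =>
        (ContinuousLinearMap.lsmul ℝ ℂ ((κ z : ℂ) * w z) : F →L[ℝ] F) * W z.1) := by
    intro w W hw hW
    refine UB.of_hasCompactSupport ?_ ?_
    · have h1 : ContDiff ℝ ∞ fun z => (κ z : ℂ) * w z :=
        (Complex.ofRealCLM.contDiff.comp hκ).mul hw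
      exact ((ContinuousLinearMap.lsmul ℝ ℂ : ℂ →L[ℝ] F →L[ℝ] F).contDiff.comp h1).clm_comp
        (hW.comp contDiff_fst)
    · refine hκc.mono fun z hz => ?_
      rw [Function.mem_support] at hz ⊢
      contrapose! hz
      ext v
      simp [hz]
  have hPU : UB fun (_ : ι) => PU := hsm (Complex.contDiff_exp.comp hr) hU
  have hPV : UB fun (_ : ι) => PV := hsm (Complex.contDiff_exp.comp hr.neg) hV
  let ev : (F →L[ℝ] F) →L[ℝ] F →L[ℝ] F := ContinuousLinearMap.id ℝ (F →L[ℝ] F)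
  -- Variation of constants: u = PU (u₀ + ∫ PV g). The source is the only thing that is integrated
  -- in s.
  let g' : ι → ℝ × E → F := fun i z => PV (unscale t₀ (ϱ i) z) (g i z)
  have hg' : IB ℓ g' := IB.bilin ev hℓ (hPV.comp_unscale t₀ hϱ) hg
  have hG := hg'.prim hℓ
  have hGd : ∀ i s y, HasDerivAt (fun s => prim g' i (s, y)) (g' i (s, y)) s := fun i s y => by
    have h1 := hasFDerivAt_prim hg'.ub i (s, y)
    refine (h1.comp_hasDerivAt s ((hasDerivAt_id s).prodMk (hasDerivAt_const s y))).congr_deriv ?_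
    simp
  have hgz : ∀ i s y, 1 < ‖y‖ → prim g' i (s, y) = 0 := fun i s y hy => by
    have : ∀ σ, g' i (σ, y) = 0 := fun σ => by simp [g', hgy i σ y hy]
    simp [prim, this]
  have hu₀c : HasCompactSupport u₀ := by
    refine (isCompact_closedBall (0 : E) 1).of_isClosed_subset (isClosed_tsupport _)
      (closure_minimal (fun y hy => ?_) Metric.isClosed_closedBall)
    by_contra h
    exact hy (hu₀y y (by simpa using h))
  have hu₀' : UB fun (_ : ι) (z : ℝ × E) => u₀ z.2 := by
    refine ((UB.of_hasCompactSupport (ι := ι) hu₀ hu₀c).comp_affine (fun _ => 0)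
      (fun _ => ContinuousLinearMap.snd ℝ ℝ E) fun _ =>
        ContinuousLinearMap.norm_snd_le ℝ ℝ E).congr fun _ z => by simp
  have hw := hu₀'.add hG
  let u : ι → ℝ × E → F := fun i z => PU (unscale t₀ (ϱ i) z) (u₀ z.2 + prim g' i z)
  have hu : UB u := UB.bilin ev (hPU.comp_unscale t₀ hϱ) hw
  have huy : YSupp u := fun i s y hy => by simp [u, hu₀y y hy, hgz i s y hy]
  have hκ' : ∀ i t y, t ∈ Set.Ioo a b → ‖y‖ ≤ 1 → κ (t, (ϱ i)⁻¹ • y) = 1 := fun i t y ht hy => by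
    refine hκ1 t (Set.Ioo_subset_Icc_self ht) _ ?_
    rw [norm_smul, norm_inv, Real.norm_of_nonneg (hϱ0 i).le]
    exact (mul_le_of_le_one_right (inv_nonneg.2 (hϱ0 i).le) hy).trans (hδϱ i)
  refine ⟨u, hu, huy, fun i y => ?_, fun i s y ht => ?_⟩
  · rcases le_or_gt ‖y‖ 1 with hy | hy
    · simp only [u, hPUa]
      have : unscale t₀ (ϱ i) ((0 : ℝ), y) = (t₀, (ϱ i)⁻¹ • y) := by simp [unscale]
      rw [this, hκ' i t₀ y ht₀ hy, hr0]
      simp [hU0, prim]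
    · rw [huy i 0 y hy, hu₀y y hy]
  · rcases le_or_gt ‖y‖ 1 with hy | hy
    · set τ : ℝ → ℝ := fun s => t₀ + s / ϱ i ^ 3 with hτ
      have hτd : HasDerivAt τ (ϱ i ^ 3)⁻¹ s := by
        have h := ((hasDerivAt_id s).div_const (ϱ i ^ 3)).const_add t₀
        rw [one_div] at h
        exact h
      have hr1 : HasDerivAt (fun s => r (τ s, (ϱ i)⁻¹ • y))
          ((ϱ i ^ 3)⁻¹ • R (τ s, (ϱ i)⁻¹ • y)) s :=
        HasDerivAt.scomp s (hrd (τ s) ((ϱ i)⁻¹ • y)) hτd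
      have hU1 : HasDerivAt (fun s => U (τ s)) ((ϱ i ^ 3)⁻¹ • (M (τ s) * U (τ s))) s :=
        HasDerivAt.scomp s (hUd (τ s)) hτd
      have hw1 : HasDerivAt (fun s => u₀ y + prim g' i (s, y)) (g' i (s, y)) s :=
        (hGd i s y).const_add _
      have h1 := (hr1.cexp).smul (hU1.clm_apply hw1)
      have hev : (fun s => u i (s, y)) =ᶠ[𝓝 s] fun s =>
          Complex.exp (r (τ s, (ϱ i)⁻¹ • y)) • U (τ s) (u₀ y + prim g' i (s, y)) := by
        have : ∀ᶠ s' in 𝓝 s, τ s' ∈ Set.Ioo a b :=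
          hτd.continuousAt.eventually_mem (isOpen_Ioo.mem_nhds ht)
        filter_upwards [this] with s' hs'
        simp only [u, hPUa]
        change ((κ (τ s', (ϱ i)⁻¹ • y) : ℂ) * _) • _ = _
        rw [hκ' i _ y hs' hy]
        simp [unscale, hτ]
      have h2 := (hu.hasDerivAt_fst i s y).unique (h1.congr_of_eventuallyEq hev)
      have hgu : g' i (s, y) = Complex.exp (-r (τ s, (ϱ i)⁻¹ • y)) • V (τ s) (g i (s, y)) := by
        simp only [g', hPVa]
        change ((κ (τ s, (ϱ i)⁻¹ • y) : ℂ) * _) • _ = _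
        rw [hκ' i _ y ht hy]
        simp [unscale, hτ]
      rw [h2, hgu, show u i (s, y) = _ from hev.self_of_nhds]
      -- U is complex linear, because multiplication by a complex scalar commutes with M. This
      -- allows the scalar factor e^r to pass through U.
      have hUc : ∀ (c : ℂ) v, U (τ s) (c • v) = c • U (τ s) v := by
        intro c v
        have h3 := hUJ (ContinuousLinearMap.lsmul ℝ ℂ c) (fun t => by
          ext w
          exact (hMl t c w).symm) (τ s)
        exact (congrArg (fun W : F →L[ℝ] F => W v) h3.eq).symm
      have hUVa : ∀ v, U (τ s) (V (τ s) v) = v := fun v =>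
        congrArg (fun W : F →L[ℝ] F => W v) (hUV (τ s))
      have hex : Complex.exp (r (τ s, (ϱ i)⁻¹ • y)) * Complex.exp (-r (τ s, (ϱ i)⁻¹ • y)) = 1 := by
        rw [← Complex.exp_add, add_neg_cancel, Complex.exp_zero]
      have hsc : unscale t₀ (ϱ i) (s, y) = (τ s, (ϱ i)⁻¹ • y) := rfl
      rw [hsc]
      set v := u₀ y + prim g' i (s, y)
      set e := Complex.exp (r (τ s, (ϱ i)⁻¹ • y))
      have h4 : (e * (ϱ i ^ 3)⁻¹ • R (τ s, (ϱ i)⁻¹ • y)) • U (τ s) v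
          = (ϱ i ^ 3)⁻¹ • (R (τ s, (ϱ i)⁻¹ • y) • e • U (τ s) v) := by
        rw [smul_smul (R _), ← smul_assoc, mul_smul_comm, mul_comm e]
      rw [h4, hMl, hUc, hUVa, smul_add, smul_smul e, hex, one_smul, _root_.smul_apply,
        mul_apply_eq_comp, smul_comm e (ϱ i ^ 3)⁻¹, smul_add]
      abel
    · have h0 : (fun s => u i (s, y)) = fun _ => 0 := funext fun s => huy i s y hy
      have h1 := hu.hasDerivAt_fst i s y
      rw [h0] at h1
      rw [h1.unique (hasDerivAt_const s 0), huy i s y hy, hgy i s y hy]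
      simp

end Transport

namespace Transport

/-! ### Smoothness near a point, and uniform neighbourhoods of curves. -/

section SmoothNear

variable {X Y F G : Type*} [NormedAddCommGroup X] [NormedSpace ℝ X]
  [NormedAddCommGroup Y] [NormedSpace ℝ Y]
  [NormedAddCommGroup F] [NormedSpace ℝ F] [NormedAddCommGroup G] [NormedSpace ℝ G]

/-- `f` is smooth in a neighbourhood of `p`. -/
def Sm (f : X → F) (p : X) : Prop := ∃ U, IsOpen U ∧ p ∈ U ∧ ContDiffOn ℝ ∞ f U

variable {f g : X → F} {p : X}

theorem Sm.contDiffAt (h : Sm f p) : ContDiffAt ℝ ∞ f p := by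
  obtain ⟨U, hU, hp, hf⟩ := h
  exact hf.contDiffAt (hU.mem_nhds hp)

/-- Here it matters that one neighbourhood serves for all orders. `ContDiffAt ℝ ∞` gives a
neighbourhood depending on the order, which would not suffice for identities between derivatives
near the point. -/
theorem Sm.eventually (h : Sm f p) : ∀ᶠ q in 𝓝 p, Sm f q := by
  obtain ⟨U, hU, hp, hf⟩ := h
  filter_upwards [hU.mem_nhds hp] with q hq
  exact ⟨U, hU, hq, hf⟩

theorem Sm.differentiableAt (h : Sm f p) : DifferentiableAt ℝ f p :=
  h.contDiffAt.differentiableAt (by simp)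

theorem ContDiff.sm (h : ContDiff ℝ ∞ f) : Sm f p := ⟨Set.univ, isOpen_univ, trivial, h.contDiffOn⟩

theorem Sm.congr (h : Sm f p) (hfg : g =ᶠ[𝓝 p] f) : Sm g p := by
  obtain ⟨U, hU, hp, hf⟩ := h
  obtain ⟨V, hV, hVo, hpV⟩ := eventually_nhds_iff.1 hfg
  exact ⟨U ∩ V, hU.inter hVo, ⟨hp, hpV⟩,
    (hf.mono Set.inter_subset_left).congr fun x hx => hV x hx.2⟩

theorem Sm.comp {h : Y → X} {q : Y} (hf : Sm f (h q)) (hh : Sm h q) :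
    Sm (fun y => f (h y)) q := by
  obtain ⟨U, hU, hp, hf⟩ := hf
  obtain ⟨V, hV, hq, hh⟩ := hh
  exact ⟨V ∩ h ⁻¹' U, hh.continuousOn.isOpen_inter_preimage hV hU, ⟨hq, hp⟩,
    hf.comp (hh.mono Set.inter_subset_left) fun x hx => hx.2⟩

theorem Sm.prodMk {h : X → G} (hf : Sm f p) (hh : Sm h p) : Sm (fun x => (f x, h x)) p := by
  obtain ⟨U, hU, hp, hf⟩ := hf
  obtain ⟨V, hV, hq, hh⟩ := hh
  exact ⟨U ∩ V, hU.inter hV, ⟨hp, hq⟩,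
    (hf.mono Set.inter_subset_left).prodMk (hh.mono Set.inter_subset_right)⟩

theorem Sm.comp_contDiff {φ : F → G} (hφ : ContDiff ℝ ∞ φ) (hf : Sm f p) :
    Sm (fun x => φ (f x)) p := Sm.comp (ContDiff.sm hφ) hf

theorem Sm.add (hf : Sm f p) (hg : Sm g p) : Sm (fun x => f x + g x) p :=
  Sm.comp_contDiff (contDiff_fst.add contDiff_snd) (hf.prodMk hg)

theorem Sm.sub (hf : Sm f p) (hg : Sm g p) : Sm (fun x => f x - g x) p :=
  Sm.comp_contDiff (contDiff_fst.sub contDiff_snd) (hf.prodMk hg)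

theorem Sm.mul {f g : X → ℂ} (hf : Sm f p) (hg : Sm g p) : Sm (fun x => f x * g x) p :=
  Sm.comp_contDiff (contDiff_fst.mul contDiff_snd) (hf.prodMk hg)

theorem Sm.const (c : F) : Sm (fun _ : X => c) p := ContDiff.sm contDiff_const

theorem Sm.div_const {f : X → ℂ} (hf : Sm f p) (c : ℂ) : Sm (fun x => f x / c) p := by
  simp only [div_eq_mul_inv]
  exact hf.mul (Sm.const _)

theorem Sm.pow {f : X → ℂ} (hf : Sm f p) (k : ℕ) : Sm (fun x => f x ^ k) p :=
  Sm.comp_contDiff (contDiff_id.pow k) hf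

theorem Sm.sum {κ : Type*} {s : Finset κ} {f : κ → X → F} (hf : ∀ j ∈ s, Sm (f j) p) :
    Sm (fun x => ∑ j ∈ s, f j x) p := by
  classical
  induction s using Finset.induction_on with
  | empty => simpa using Sm.const (0 : F)
  | insert a s ha ih =>
    simp only [Finset.sum_insert ha]
    exact (hf a (Finset.mem_insert_self _ _)).add
      (ih fun j hj => hf j (Finset.mem_insert_of_mem hj))

theorem Sm.prod {κ : Type*} {s : Finset κ} {f : κ → X → ℂ} (hf : ∀ j ∈ s, Sm (f j) p) :
    Sm (fun x => ∏ j ∈ s, f j x) p := by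
  classical
  induction s using Finset.induction_on with
  | empty => simpa using Sm.const (1 : ℂ)
  | insert a s ha ih =>
    simp only [Finset.prod_insert ha]
    exact (hf a (Finset.mem_insert_self _ _)).mul
      (ih fun j hj => hf j (Finset.mem_insert_of_mem hj))

theorem Sm.ofReal {f : X → ℝ} (hf : Sm f p) : Sm (fun x => (f x : ℂ)) p :=
  Sm.comp_contDiff Complex.ofRealCLM.contDiff hf

theorem Sm.pi_apply {n : ℕ} {F : Type*} [NormedAddCommGroup F] [NormedSpace ℝ F]
    {f : X → Fin n → F} (hf : Sm f p) (j : Fin n) : Sm (fun x => f x j) p :=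
  Sm.comp_contDiff (contDiff_apply ℝ F j) hf

theorem Sm.mpow {n : ℕ} {v : X → Fin n → ℂ} (hv : ∀ i, Sm (fun x => v x i) p) (α : Fin n → ℕ) :
    Sm (fun x => mpow (v x) α) p :=
  Sm.prod fun i _ => (hv i).pow (α i)

theorem Sm.fderiv (hf : Sm f p) : Sm (_root_.fderiv ℝ f) p := by
  obtain ⟨U, hU, hp, hf⟩ := hf
  exact ⟨U, hU, hp, hf.fderiv_of_isOpen hU (by simp)⟩

theorem Sm.fderiv_apply (hf : Sm f p) (v : X) : Sm (fun x => _root_.fderiv ℝ f x v) p :=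
  Sm.comp_contDiff (ContinuousLinearMap.apply ℝ F v).contDiff hf.fderiv

theorem DifferentiableAt.fderiv_snd {f : X × Y → F} {q : X × Y} (hf : DifferentiableAt ℝ f q)
    (v : Y) : fderiv ℝ (fun y => f (q.1, y)) q.2 v = fderiv ℝ f q (0, v) := by
  have h : HasFDerivAt (fun y => f (q.1, y)) _ q.2 :=
    HasFDerivAt.comp q.2 (f := fun y => (q.1, y)) hf.hasFDerivAt
      (hasFDerivAt_prodMk_right q.1 q.2)
  rw [h.fderiv]
  simp

theorem Sm.pderiv {n : ℕ} {f : X × (Fin n → ℝ) → ℂ} {q : X × (Fin n → ℝ)} (hf : Sm f q)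
    (i : Fin n) : Sm (fun q : X × (Fin n → ℝ) => pderiv i (fun x => f (q.1, x)) q.2) q := by
  refine (hf.fderiv_apply (0, Pi.single i 1)).congr ?_
  filter_upwards [hf.eventually] with r hr
  exact DifferentiableAt.fderiv_snd hr.differentiableAt _

theorem Sm.pderiv_iterate {n : ℕ} {f : X × (Fin n → ℝ) → ℂ} {q : X × (Fin n → ℝ)} (hf : Sm f q)
    (i : Fin n) (k : ℕ) :
    Sm (fun q : X × (Fin n → ℝ) => (Transport.pderiv i)^[k] (fun x => f (q.1, x)) q.2) q := by
  induction k with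
  | zero => exact hf
  | succ k ih =>
    simp only [Function.iterate_succ_apply']
    exact Sm.pderiv ih i

theorem Sm.mderiv {n : ℕ} {f : X × (Fin n → ℝ) → ℂ} {q : X × (Fin n → ℝ)} (hf : Sm f q)
    (α : Fin n → ℕ) : Sm (fun q : X × (Fin n → ℝ) => mderiv α (fun x => f (q.1, x)) q.2) q := by
  unfold Transport.mderiv
  induction List.finRange n with
  | nil => exact hf
  | cons i l ih => exact Sm.pderiv_iterate ih i (α i)

theorem Sm.iteratedDeriv {f : X × ℝ → F} {q : X × ℝ} (hf : Sm f q) (k : ℕ) :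
    Sm (fun q : X × ℝ => iteratedDeriv k (fun t => f (q.1, t)) q.2) q := by
  induction k with
  | zero => simpa using hf
  | succ k ih =>
    simp only [iteratedDeriv_succ]
    refine (ih.fderiv_apply (0, 1)).congr ?_
    filter_upwards [ih.eventually] with r hr
    exact DifferentiableAt.fderiv_snd hr.differentiableAt 1

/-- Multiplication by a cutoff function. -/
theorem contDiff_cutoff_mul {κ : X → ℝ} {c : X → ℂ} (hκ : ContDiff ℝ ∞ κ)
    (hc : ∀ p ∈ tsupport κ, Sm c p) : ContDiff ℝ ∞ fun x => (κ x : ℂ) * c x := by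
  refine contDiff_iff_contDiffAt.2 fun p => ?_
  by_cases hp : p ∈ tsupport κ
  · exact (Complex.ofRealCLM.contDiff.comp hκ).contDiffAt.mul (hc p hp).contDiffAt
  · refine (contDiffAt_const (c := (0 : ℂ))).congr_of_eventuallyEq ?_
    filter_upwards [(isClosed_tsupport κ).isOpen_compl.mem_nhds hp] with x hx
    rw [image_eq_zero_of_notMem_tsupport hx]
    simp

/-- Compactness of [a, b] × {0}: some closed thickening stays in the open set. The time interval is
enlarged too, so that its original end points become interior points for the differential equations.
-/
theorem exists_uniform_tube {X : Type*} [NormedAddCommGroup X] {p : ℝ × X → Prop} {a b : ℝ}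
    (hab : a ≤ b)
    (h : ∀ t ∈ Set.Icc a b, ∀ᶠ q in 𝓝 (t, (0 : X)), p q) :
    ∃ η > 0, ∀ t ∈ Set.Icc (a - η) (b + η), ∀ y, ‖y‖ ≤ η → p (t, y) := by
  have hK : IsCompact (Set.Icc a b ×ˢ ({0} : Set X)) := isCompact_Icc.prod isCompact_singleton
  have hsub : Set.Icc a b ×ˢ ({0} : Set X) ⊆ interior {q | p q} := by
    rintro ⟨t, y⟩ ⟨ht, hy⟩
    obtain rfl : y = 0 := hy
    exact mem_interior_iff_mem_nhds.2 (h t ht)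
  obtain ⟨η, hη, hs⟩ := hK.exists_cthickening_subset_open isOpen_interior hsub
  refine ⟨η, hη, fun t ht y hy => interior_subset (hs ?_)⟩
  refine Metric.mem_cthickening_of_dist_le (t, y) (max a (min t b), 0) η _
    ⟨⟨le_max_left _ _, max_le hab (min_le_right _ _)⟩, rfl⟩ ?_
  rw [Prod.dist_eq, dist_zero_right]
  refine max_le ?_ hy
  rw [Real.dist_eq, abs_le]
  rcases max_cases a (min t b) with h1 | h1 <;> rcases min_cases t b with h2 | h2 <;>
    constructor <;> linarith [ht.1, ht.2]

end SmoothNear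

/-! ### Smoothness of the coefficients of the transport equations. -/

section CoefficientSmoothness

variable {n d : ℕ} {S : Symbols n d} {P : Phase n} {J : Set ℝ}

/-- The coefficients of the phase are smooth on `J`. -/
structure SmoothPhase (P : Phase n) (J : Set ℝ) : Prop where
  isOpen : IsOpen J
  x0 : ContDiffOn ℝ ∞ P.x0 J
  ξ0 : ContDiffOn ℝ ∞ P.ξ0 J
  w0 : ContDiffOn ℝ ∞ P.w0 J
  w : ∀ α, ContDiffOn ℝ ∞ (P.w α) J

variable {X : Type*} [NormedAddCommGroup X] [NormedSpace ℝ X]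

theorem SmoothPhase.sm_x0 (h : SmoothPhase P J) {t : ℝ} (ht : t ∈ J) : Sm P.x0 t :=
  ⟨J, h.isOpen, ht, h.x0⟩

theorem SmoothPhase.sm_ξ0 (h : SmoothPhase P J) {t : ℝ} (ht : t ∈ J) : Sm P.ξ0 t :=
  ⟨J, h.isOpen, ht, h.ξ0⟩

theorem SmoothPhase.sm_w0 (h : SmoothPhase P J) {t : ℝ} (ht : t ∈ J) : Sm P.w0 t :=
  ⟨J, h.isOpen, ht, h.w0⟩

theorem SmoothPhase.sm_omega (h : SmoothPhase P J) {q : ℝ × (Fin n → ℝ)} (hq : q.1 ∈ J) :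
    Sm (fun q : ℝ × (Fin n → ℝ) => P.omega q.1 q.2) q := by
  have h1 : Sm (fun q : ℝ × (Fin n → ℝ) => q.1) q := ContDiff.sm contDiff_fst
  have h2 : Sm (fun q : ℝ × (Fin n → ℝ) => q.2) q := ContDiff.sm contDiff_snd
  have hx := (h.sm_x0 hq).comp h1
  have hd : ∀ i, Sm (fun q : ℝ × (Fin n → ℝ) => ((q.2 i - P.x0 q.1 i : ℝ) : ℂ)) q := fun i =>
    ((h2.pi_apply i).sub (hx.pi_apply i)).ofReal
  refine (((h.sm_w0 hq).comp h1).add (Sm.sum fun j _ => (hd j).mul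
    (((h.sm_ξ0 hq).comp h1).pi_apply j).ofReal)).add (Sm.sum fun α _ => ?_)
  have hw : Sm (P.w α) q.1 := ⟨J, h.isOpen, hq, h.w α⟩
  exact ((hw.comp h1).mul (Sm.mpow hd α)).div_const _

theorem SmoothPhase.dt_eq (h : SmoothPhase P J) {q : ℝ × (Fin n → ℝ)} (hq : q.1 ∈ J) :
    P.dt q.1 q.2 = fderiv ℝ (fun q : ℝ × (Fin n → ℝ) => P.omega q.1 q.2) q (1, 0) := by
  have h1 := (h.sm_omega hq).differentiableAt.hasFDerivAt
  exact (h1.comp_hasDerivAt q.1 (f := fun s => (s, q.2))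
    ((hasDerivAt_id q.1).prodMk (hasDerivAt_const _ _))).deriv

theorem SmoothPhase.dx_eq (h : SmoothPhase P J) {q : ℝ × (Fin n → ℝ)} (hq : q.1 ∈ J) (i : Fin n) :
    P.dx q.1 q.2 i
      = fderiv ℝ (fun q : ℝ × (Fin n → ℝ) => P.omega q.1 q.2) q (0, Pi.single i 1) :=
  DifferentiableAt.fderiv_snd (f := fun q : ℝ × (Fin n → ℝ) => P.omega q.1 q.2)
    (h.sm_omega hq).differentiableAt _

theorem SmoothPhase.eventually_mem (h : SmoothPhase P J) {q : ℝ × (Fin n → ℝ)} (hq : q.1 ∈ J) :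
    ∀ᶠ r : ℝ × (Fin n → ℝ) in 𝓝 q, r.1 ∈ J :=
  continuous_fst.continuousAt.eventually_mem (h.isOpen.mem_nhds hq)

theorem SmoothPhase.sm_dt (h : SmoothPhase P J) {q : ℝ × (Fin n → ℝ)} (hq : q.1 ∈ J) :
    Sm (fun q : ℝ × (Fin n → ℝ) => P.dt q.1 q.2) q := by
  refine ((h.sm_omega hq).fderiv_apply (1, 0)).congr ?_
  filter_upwards [h.eventually_mem hq] with r hr using h.dt_eq hr

theorem SmoothPhase.sm_dx (h : SmoothPhase P J) {q : ℝ × (Fin n → ℝ)} (hq : q.1 ∈ J) (i : Fin n) :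
    Sm (fun q : ℝ × (Fin n → ℝ) => P.dx q.1 q.2 i) q := by
  refine ((h.sm_omega hq).fderiv_apply (0, Pi.single i 1)).congr ?_
  filter_upwards [h.eventually_mem hq] with r hr using h.dx_eq hr i

/-- Only derivatives at the real covector (0, ξ₀) enter the Taylor polynomial, so smoothness of the
symbol near this real point is all that is needed. -/
theorem SmoothPhase.sm_symAt (h : SmoothPhase P J) (L : ℕ) {K : X → ℝ → (Fin n → ℝ) → ℂ}
    {tf : X → ℝ} {xf : X → Fin n → ℝ} {p : X} (ht : Sm tf p) (hx : Sm xf p) (hp : tf p ∈ J)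
    (hK : Sm (fun q : (X × ℝ) × (Fin n → ℝ) => K q.1.1 q.1.2 q.2) ((p, 0), P.ξ0 (tf p))) :
    Sm (fun p => symAt P L (K p) (tf p) (xf p)) p := by
  have hξ := (h.sm_ξ0 hp).comp ht
  refine Sm.sum fun m _ => Sm.sum fun γ _ => ?_
  have h1 := Sm.mderiv hK γ
  have h2 : Sm (fun q : X × ℝ => Transport.mderiv γ (fun ξ => K q.1 q.2 ξ) (P.ξ0 (tf q.1)))
      (p, 0) :=
    Sm.comp (h := fun q : X × ℝ => (q, P.ξ0 (tf q.1))) h1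
      ((ContDiff.sm contDiff_id).prodMk (Sm.comp (f := fun p => P.ξ0 (tf p)) (h := Prod.fst) (q := (p, (0 : ℝ))) hξ
        (ContDiff.sm contDiff_fst)))
  have h3 := Sm.iteratedDeriv h2 m
  have h4 := Sm.comp (h := fun p : X => (p, (0 : ℝ))) h3
    (ContDiff.sm (contDiff_id.prodMk contDiff_const))
  refine ((h4.div_const _).mul ((Sm.comp (h := fun p => (tf p, xf p)) (h.sm_dt hp)
    (ht.prodMk hx)).pow m)).mul (Sm.mpow (fun i => ?_) γ)
  exact (Sm.comp (h := fun p => (tf p, xf p)) (h.sm_dx hp i) (ht.prodMk hx)).sub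
    (hξ.pi_apply i).ofReal

/-- The symbols are smooth near the points that determine the coefficients of the transport
equations at `(t, y)`. -/
structure Admissible (S : Symbols n d) (P : Phase n) (y₀ : Fin d → ℝ) (t : ℝ) (y : Fin d → ℝ) :
    Prop where
  f : Sm S.f (t, P.x0 t, P.ξ0 t)
  A : Sm S.A (t, P.x0 t, y₀ + y, 0, P.ξ0 t, 0)
  B : Sm S.B (t, P.x0 t, y₀ + y, 0, P.ξ0 t, 0)
  R : ∀ m ℓ ν μ, Sm (S.R m ℓ ν μ) (t, 0, y)

theorem SmoothPhase.sm_tcoef (h : SmoothPhase P J) {K : X → (Fin n → ℝ) → ℂ} {tf : X → ℝ} {p : X}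
    (ht : Sm tf p) (hp : tf p ∈ J)
    (hK : Sm (fun q : X × (Fin n → ℝ) => K q.1 q.2) (p, P.x0 (tf p))) (β : Fin n → ℕ) :
    Sm (fun p => tcoef β (K p) (P.x0 (tf p))) p :=
  (Sm.comp (f := fun q : X × (Fin n → ℝ) => mderiv β (fun x => K q.1 x) q.2)
    (h := fun p => (p, P.x0 (tf p))) (Sm.mderiv hK β)
    ((ContDiff.sm contDiff_id).prodMk ((h.sm_x0 hp).comp ht))).div_const _

variable {y₀ : Fin d → ℝ} {t : ℝ} {y : Fin d → ℝ}

theorem SmoothPhase.sm_coefA1 (h : SmoothPhase P J) (hS : Admissible S P y₀ t y) (ht : t ∈ J)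
    (L : ℕ) (β : Fin n → ℕ) (j : Fin d) :
    Sm (fun q : ℝ × (Fin d → ℝ) => coefA1 S P y₀ L β j q.1 q.2) (t, y) := by
  have h0 : Sm (fun q : (((ℝ × (Fin d → ℝ)) × (Fin n → ℝ)) × ℝ) × (Fin n → ℝ) =>
      (q.1.1.1.1, q.1.1.2, y₀ + q.1.1.1.2, q.1.2, q.2, (0 : Fin d → ℝ)))
      ((((t, y), P.x0 t), (0 : ℝ)), P.ξ0 t) := ContDiff.sm (by fun_prop)
  have h1 : Sm (fun q : (((ℝ × (Fin d → ℝ)) × (Fin n → ℝ)) × ℝ) × (Fin n → ℝ) =>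
      S.A (q.1.1.1.1, q.1.1.2, y₀ + q.1.1.1.2, q.1.2, q.2, (0 : Fin d → ℝ)))
      ((((t, y), P.x0 t), 0), P.ξ0 t) :=
    Sm.comp (f := S.A) (q := ((((t, y), P.x0 t), (0 : ℝ)), P.ξ0 t)) hS.A h0
  have h1' := h1.pi_apply j
  have h2 := h.sm_symAt (tf := fun q : (ℝ × (Fin d → ℝ)) × (Fin n → ℝ) => q.1.1)
    (xf := fun q => q.2) L
    (K := fun q τ ξ => S.A (q.1.1, q.2, y₀ + q.1.2, τ, ξ, 0) j) (p := ((t, y), P.x0 t))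
    (ContDiff.sm (by fun_prop)) (ContDiff.sm (by fun_prop)) ht h1'
  exact h.sm_tcoef
    (X := ℝ × (Fin d → ℝ))
    (K := fun q x => symAt P L (fun τ ξ => S.A (q.1, x, y₀ + q.2, τ, ξ, 0) j) q.1 x)
    (tf := fun q => q.1) (p := (t, y)) (ContDiff.sm contDiff_fst) ht
    (by with_reducible exact h2) β

theorem SmoothPhase.sm_coefA2 (h : SmoothPhase P J) (hS : Admissible S P y₀ t y) (ht : t ∈ J)
    (L : ℕ) (β : Fin n → ℕ) (j l : Fin d) :
    Sm (fun q : ℝ × (Fin d → ℝ) => coefA2 S P y₀ L β j l q.1 q.2) (t, y) := by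
  have h0 : Sm (fun q : (((ℝ × (Fin d → ℝ)) × (Fin n → ℝ)) × ℝ) × (Fin n → ℝ) =>
      (q.1.1.1.1, q.1.1.2, y₀ + q.1.1.1.2, q.1.2, q.2, (0 : Fin d → ℝ)))
      ((((t, y), P.x0 t), (0 : ℝ)), P.ξ0 t) := ContDiff.sm (by fun_prop)
  have h1 : Sm (fun q : (((ℝ × (Fin d → ℝ)) × (Fin n → ℝ)) × ℝ) × (Fin n → ℝ) =>
      S.B (q.1.1.1.1, q.1.1.2, y₀ + q.1.1.1.2, q.1.2, q.2, (0 : Fin d → ℝ)))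
      ((((t, y), P.x0 t), 0), P.ξ0 t) :=
    Sm.comp (f := S.B) (q := ((((t, y), P.x0 t), (0 : ℝ)), P.ξ0 t)) hS.B h0
  have h1' := h1.pi_apply j
  have h1'' := h1'.pi_apply l
  have h2 := h.sm_symAt (tf := fun q : (ℝ × (Fin d → ℝ)) × (Fin n → ℝ) => q.1.1)
    (xf := fun q => q.2) L
    (K := fun q τ ξ => S.B (q.1.1, q.2, y₀ + q.1.2, τ, ξ, 0) j l) (p := ((t, y), P.x0 t))
    (ContDiff.sm (by fun_prop)) (ContDiff.sm (by fun_prop)) ht h1''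
  exact h.sm_tcoef
    (X := ℝ × (Fin d → ℝ))
    (K := fun q x => symAt P L (fun τ ξ => S.B (q.1, x, y₀ + q.2, τ, ξ, 0) j l) q.1 x)
    (tf := fun q => q.1) (p := (t, y)) (ContDiff.sm contDiff_fst) ht
    (by with_reducible exact h2) β

theorem SmoothPhase.sm_coefA0 (h : SmoothPhase P J) (hS : Sm S.f (t, P.x0 t, P.ξ0 t)) (ht : t ∈ J)
    (L : ℕ) (β : Fin n → ℕ) (j : Fin n) : Sm (coefA0 S P L β j) t := by
  have h1 : Sm (fun q : (ℝ × (Fin n → ℝ)) × (Fin n → ℝ) => (S.f (q.1.1, q.1.2, q.2) : ℂ))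
      ((t, P.x0 t), P.ξ0 t) :=
    (Sm.comp (f := S.f) (q := ((t, P.x0 t), P.ξ0 t))
      (h := fun q : (ℝ × (Fin n → ℝ)) × (Fin n → ℝ) => (q.1.1, q.1.2, q.2)) hS
      (ContDiff.sm (by fun_prop))).ofReal
  have h2 := Sm.pderiv h1 j
  have h3 : Sm (fun q : ((ℝ × (Fin n → ℝ)) × ℝ) × (Fin n → ℝ) => (q.1.1, q.2))
    (((t, P.x0 t), (0 : ℝ)), P.ξ0 t) := ContDiff.sm (by fun_prop)
  have h4 := h.sm_symAt (tf := fun q : ℝ × (Fin n → ℝ) => q.1) (xf := Prod.snd) L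
    (K := fun q _ ξ => pderiv j (fun ξ => (S.f (q.1, q.2, ξ) : ℂ)) ξ) (p := (t, P.x0 t))
    (ContDiff.sm (by fun_prop)) (ContDiff.sm (by fun_prop)) ht
    (Sm.comp (q := (((t, P.x0 t), (0 : ℝ)), P.ξ0 t)) h2 h3)
  have h5 : Sm (deriv P.x0) t := (h.sm_x0 ht).fderiv_apply 1
  have h6 : Sm (fun q : ℝ × (Fin n → ℝ) => ((deriv P.x0 q.1 j : ℝ) : ℂ)) (t, P.x0 t) :=
    ((Sm.comp (f := deriv P.x0) (h := Prod.fst) (q := (t, P.x0 t)) h5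
      (ContDiff.sm contDiff_fst)).pi_apply j).ofReal
  exact h.sm_tcoef (K := fun t x => Complex.I *
      symAt P L (fun _ => pderiv j (fun ξ => (S.f (t, x, ξ) : ℂ))) t x
    - ((deriv P.x0 t j : ℝ) : ℂ)) (tf := fun t => t) (p := t) (ContDiff.sm contDiff_id) ht
    (((Sm.const Complex.I).mul h4).sub h6) β

theorem sm_coefR (hS : Admissible S P y₀ t y) (m : ℕ) (β : Fin n → ℕ) (ℓ : ℕ) (ν : Fin n → ℕ)
    (μ : Fin d → ℕ) : Sm (fun q : ℝ × (Fin d → ℝ) => coefR S m β ℓ ν μ q.1 q.2) (t, y) := by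
  have h1 : Sm (fun q : (ℝ × (Fin d → ℝ)) × (Fin n → ℝ) => S.R m ℓ ν μ (q.1.1, q.2, q.1.2))
      ((t, y), 0) :=
    Sm.comp (h := fun q : (ℝ × (Fin d → ℝ)) × (Fin n → ℝ) => (q.1.1, q.2, q.1.2)) (hS.R m ℓ ν μ)
      (ContDiff.sm (by fun_prop))
  exact (Sm.comp (h := fun q : ℝ × (Fin d → ℝ) => (q, (0 : Fin n → ℝ))) (Sm.mderiv h1 β)
    (ContDiff.sm (contDiff_id.prodMk contDiff_const))).div_const _

theorem exists_admissible_tube {t₁ t₂ : ℝ} (ht : t₁ ≤ t₂) (h : SmoothPhase P J) (hJ : Set.Icc t₁ t₂ ⊆ J)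
    (hS : SmoothSymbols S P y₀ t₁ t₂) :
    ∃ η > 0, ∀ t ∈ Set.Icc (t₁ - η) (t₂ + η), ∀ y, ‖y‖ ≤ η → t ∈ J ∧ Admissible S P y₀ t y := by
  obtain ⟨U, hU, hUm, hf⟩ := hS.f
  obtain ⟨V, hV, hVm, hA, hB⟩ := hS.AB
  obtain ⟨W, hW, hWm, hR⟩ := hS.R
  refine exists_uniform_tube ht (p := fun q : ℝ × (Fin d → ℝ) => q.1 ∈ J ∧ Admissible S P y₀ q.1 q.2)
    fun t ht => ?_
  have hx : ContinuousAt (fun q : ℝ × (Fin d → ℝ) => P.x0 q.1) (t, 0) :=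
    ContinuousAt.comp (f := Prod.fst) (h.sm_x0 (hJ ht)).contDiffAt.continuousAt continuousAt_fst
  have hξ : ContinuousAt (fun q : ℝ × (Fin d → ℝ) => P.ξ0 q.1) (t, 0) :=
    ContinuousAt.comp (f := Prod.fst) (h.sm_ξ0 (hJ ht)).contDiffAt.continuousAt continuousAt_fst
  have e1 : ∀ᶠ q : ℝ × (Fin d → ℝ) in 𝓝 (t, 0), q.1 ∈ J :=
    continuousAt_fst.eventually_mem (h.isOpen.mem_nhds (hJ ht))
  have e2 : ∀ᶠ q : ℝ × (Fin d → ℝ) in 𝓝 (t, 0), (q.1, P.x0 q.1, P.ξ0 q.1) ∈ U :=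
    (continuousAt_fst.prodMk (hx.prodMk hξ)).eventually_mem (hU.mem_nhds (hUm t ht))
  have e3 : ∀ᶠ q : ℝ × (Fin d → ℝ) in 𝓝 (t, 0),
      (q.1, P.x0 q.1, y₀ + q.2, (0 : ℝ), P.ξ0 q.1, (0 : Fin d → ℝ)) ∈ V := by
    refine (continuousAt_fst.prodMk (hx.prodMk ((continuousAt_const.add continuousAt_snd).prodMk
      (continuousAt_const.prodMk (hξ.prodMk continuousAt_const))))).eventually_mem
      (hV.mem_nhds ?_)
    simpa using hVm t ht
  have e4 : ∀ᶠ q : ℝ × (Fin d → ℝ) in 𝓝 (t, 0), (q.1, (0 : Fin n → ℝ), q.2) ∈ W :=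
    (continuousAt_fst.prodMk (continuousAt_const.prodMk continuousAt_snd)).eventually_mem
      (hW.mem_nhds (hWm t ht))
  filter_upwards [e1, e2, e3, e4] with q h1 h2 h3 h4
  exact ⟨h1, ⟨U, hU, h2, hf⟩, ⟨V, hV, h3, hA⟩, ⟨V, hV, h3, hB⟩,
    fun m ℓ ν μ => ⟨W, hW, h4, hR m ℓ ν μ⟩⟩

end CoefficientSmoothness

end Transport

namespace Transport

/-! ### Multi-indices and monomials. -/

section MultiIndex

variable {n : ℕ}

theorem mem_midx {m : ℕ} {α : Fin n → ℕ} : α ∈ midx n m ↔ mdeg α ≤ m := by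
  refine ⟨fun h => (Finset.mem_filter.1 h).2, fun h => Finset.mem_filter.2 ⟨?_, h⟩⟩
  refine Fintype.mem_piFinset.2 fun i => Finset.mem_range.2 ?_
  have : α i ≤ mdeg α := Finset.single_le_sum (f := α) (fun _ _ => Nat.zero_le _)
    (Finset.mem_univ i)
  omega

theorem mdeg_eq_zero {α : Fin n → ℕ} : mdeg α = 0 ↔ α = 0 := by
  simp [mdeg, funext_iff]

theorem mpow_zero_left (α : Fin n → ℕ) : mpow (fun _ => 0) α = if α = 0 then 1 else 0 := by
  unfold mpow
  split_ifs with h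
  · simp [h]
  · obtain ⟨i, hi⟩ : ∃ i, α i ≠ 0 := by
      by_contra hc
      push Not at hc
      exact h (funext hc)
    exact Finset.prod_eq_zero (Finset.mem_univ i) (zero_pow hi)

theorem mpow_smul (c : ℂ) (v : Fin n → ℂ) (α : Fin n → ℕ) :
    mpow (fun i => c * v i) α = c ^ mdeg α * mpow v α := by
  simp [mpow, mdeg, mul_pow, Finset.prod_mul_distrib, Finset.prod_pow_eq_pow_sum]

theorem mfact_pos (α : Fin n → ℕ) : 0 < mfact α := Finset.prod_pos fun _ _ => Nat.factorial_pos _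

theorem one_le_mfact (α : Fin n → ℕ) : (1 : ℝ) ≤ (mfact α : ℝ) := by
  exact_mod_cast mfact_pos α

theorem mderiv_zero (g : (Fin n → ℝ) → ℂ) : mderiv 0 g = g := by
  simp [mderiv]

theorem mderiv_single (j : Fin n) (g : (Fin n → ℝ) → ℂ) :
    mderiv (Pi.single j 1) g = pderiv j g := by
  have key : ∀ l : List (Fin n), l.Nodup →
      l.foldr (fun i h => (pderiv i)^[(Pi.single j 1 : Fin n → ℕ) i] h) g
        = if j ∈ l then pderiv j g else g := by
    intro l hl
    induction l with
    | nil => simp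
    | cons i l ih =>
      rw [List.nodup_cons] at hl
      rw [List.foldr_cons, ih hl.2]
      by_cases hij : i = j
      · subst hij
        simp [hl.1]
      · have hji : ¬ j = i := fun h => hij h.symm
        simp [hij, hji]
  rw [mderiv, key _ (List.nodup_finRange n), if_pos (List.mem_finRange j)]

theorem tcoef_zero (g : (Fin n → ℝ) → ℂ) (x : Fin n → ℝ) : tcoef 0 g x = g x := by
  simp [tcoef, mderiv_zero, mfact]

/-- Derivative of a monomial at a common zero of its factors. -/
theorem hasDerivAt_mpow {z : ℝ → Fin n → ℂ} {b : Fin n → ℂ} {σ : ℝ}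
    (hz : ∀ i, HasDerivAt (fun σ => z σ i) (b i) σ) (h0 : ∀ i, z σ i = 0) (γ : Fin n → ℕ) :
    HasDerivAt (fun σ => mpow (z σ) γ) (∑ i, if γ = Pi.single i 1 then b i else 0) σ := by
  have h := HasDerivAt.fun_finsetProd (u := Finset.univ) (f := fun i σ => z σ i ^ γ i)
    (f' := fun i => (γ i : ℂ) * z σ i ^ (γ i - 1) * b i) (x := σ) fun i _ => (hz i).fun_pow (γ i)
  refine h.congr_deriv (Finset.sum_congr rfl fun i _ => ?_)
  simp only [h0, smul_eq_mul]
  split_ifs with hγ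
  · subst hγ
    rw [Finset.prod_eq_one]
    · simp
    · intro j hj
      rw [Pi.single_eq_of_ne (Finset.ne_of_mem_erase hj), pow_zero]
  · by_cases hi : γ i = 1
    · have : ∃ j, j ≠ i ∧ γ j ≠ 0 := by
        by_contra hc
        push Not at hc
        refine hγ (funext fun j => ?_)
        by_cases hj : j = i
        · subst hj; simp [hi]
        · rw [hc j hj, Pi.single_eq_of_ne hj]
      obtain ⟨j, hj, hj0⟩ := this
      rw [Finset.prod_eq_zero (Finset.mem_erase.2 ⟨hj, Finset.mem_univ j⟩) (zero_pow hj0), zero_mul]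
    · rcases Nat.eq_zero_or_pos (γ i) with h1 | h1
      · simp [h1]
      · have : γ i - 1 ≠ 0 := by omega
        simp [zero_pow this]

end MultiIndex

theorem hasDerivAt_fderiv_apply {X F : Type*} [NormedAddCommGroup X] [NormedSpace ℝ X]
    [NormedAddCommGroup F] [NormedSpace ℝ F] {f : X → F} {p : X} (hf : Sm f p) {c : ℝ → X} {v : X}
    {σ : ℝ} (hc : HasDerivAt c v σ) (hp : c σ = p) (q : X) :
    HasDerivAt (fun σ => fderiv ℝ f (c σ) q) (fderiv ℝ (fderiv ℝ f) p v q) σ := by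
  subst hp
  have h1 := hf.fderiv.differentiableAt.hasFDerivAt.comp_hasDerivAt σ hc
  simpa using h1.clm_apply (hasDerivAt_const σ q)

/-! ### Derivatives of the phase on the curve. -/

section PhaseGeometry

variable {n d : ℕ} {S : Symbols n d} {P : Phase n} {J : Set ℝ} {t : ℝ}

/-- The phase as a function of `(t, x)`. -/
noncomputable def Phase.fn (P : Phase n) (q : ℝ × (Fin n → ℝ)) : ℂ := P.omega q.1 q.2

/-- On a line through x₀(t) the phase is a polynomial in σ, from which the x-derivatives in the
direction v can be read off. -/
theorem Phase.omega_line (P : Phase n) (t σ : ℝ) (v : Fin n → ℝ) :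
    P.omega t (P.x0 t + σ • v) = P.w0 t + (σ : ℂ) * ((∑ j, v j * P.ξ0 t j : ℝ) : ℂ)
      + ∑ α ∈ (midx n P.deg).filter (fun α => 2 ≤ mdeg α),
        P.w α t * mpow (fun i => (v i : ℂ)) α / (mfact α : ℂ) * (σ : ℂ) ^ mdeg α := by
  unfold Phase.omega
  have h : ∀ i, (((P.x0 t + σ • v) i - P.x0 t i : ℝ) : ℂ) = (σ : ℂ) * (v i : ℂ) := fun i => by
    simp
  simp only [h, mpow_smul]
  congr 1
  · congr 1
    push_cast
    rw [Finset.mul_sum]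
    exact Finset.sum_congr rfl fun j _ => by ring
  · exact Finset.sum_congr rfl fun α _ => by ring

theorem hasDerivAt_poly {κ : Type*} (s : Finset κ) (a b : ℂ) (c : κ → ℂ) (e : κ → ℕ) (σ : ℝ) :
    HasDerivAt (fun σ : ℝ => a + (σ : ℂ) * b + ∑ j ∈ s, c j * (σ : ℂ) ^ e j)
      (b + ∑ j ∈ s, c j * e j * (σ : ℂ) ^ (e j - 1)) σ := by
  have h0 : HasDerivAt (fun σ : ℝ => (σ : ℂ)) 1 σ := Complex.ofRealCLM.hasDerivAt
  have h1 : HasDerivAt (fun σ : ℝ => a + (σ : ℂ) * b) b σ := by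
    simpa using (h0.mul_const b).const_add a
  refine h1.add (HasDerivAt.fun_sum fun j _ => ?_)
  have := (h0.fun_pow (e j)).const_mul (c j)
  exact this.congr_deriv (by ring)

theorem SmoothPhase.fderiv_fn_line (h : SmoothPhase P J) (ht : t ∈ J) (v : Fin n → ℝ) (σ : ℝ) :
    fderiv ℝ P.fn (t, P.x0 t + σ • v) (0, v) = ((∑ j, v j * P.ξ0 t j : ℝ) : ℂ)
      + ∑ α ∈ (midx n P.deg).filter (fun α => 2 ≤ mdeg α),
        P.w α t * mpow (fun i => (v i : ℂ)) α / (mfact α : ℂ) * mdeg α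
          * (σ : ℂ) ^ (mdeg α - 1) := by
  have h1 := (h.sm_omega (q := (t, P.x0 t + σ • v)) ht).differentiableAt.hasFDerivAt
  have h2 : HasDerivAt (fun σ : ℝ => (t, P.x0 t + σ • v)) ((0 : ℝ), v) σ := by
    refine (hasDerivAt_const σ t).prodMk ?_
    simpa using ((hasDerivAt_id σ).smul_const v).const_add (P.x0 t)
  have h3 := h1.comp_hasDerivAt σ h2
  have h4 := hasDerivAt_poly ((midx n P.deg).filter (fun α => 2 ≤ mdeg α)) (P.w0 t)
    ((∑ j, v j * P.ξ0 t j : ℝ) : ℂ)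
    (fun α => P.w α t * mpow (fun i => (v i : ℂ)) α / (mfact α : ℂ)) mdeg σ
  refine h3.unique (h4.congr_of_eventuallyEq (Filter.Eventually.of_forall fun σ => ?_))
  exact P.omega_line t σ v

theorem SmoothPhase.fderiv_fn_snd (h : SmoothPhase P J) (ht : t ∈ J) (v : Fin n → ℝ) :
    fderiv ℝ P.fn (t, P.x0 t) (0, v) = ((∑ j, v j * P.ξ0 t j : ℝ) : ℂ) := by
  have h1 := h.fderiv_fn_line ht v 0
  rw [zero_smul, add_zero] at h1
  rw [h1, add_eq_left]
  refine Finset.sum_eq_zero fun α hα => ?_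
  have : mdeg α - 1 ≠ 0 := by have := (Finset.mem_filter.1 hα).2; omega
  simp [this]

theorem SmoothPhase.dx_x0 (h : SmoothPhase P J) (ht : t ∈ J) (i : Fin n) :
    P.dx t (P.x0 t) i = (P.ξ0 t i : ℂ) := by
  have h1 := h.dx_eq (q := (t, P.x0 t)) ht i
  have h2 := h.fderiv_fn_snd ht (Pi.single i 1)
  refine h1.trans (h2.trans ?_)
  congr 1
  rw [Finset.sum_eq_single i] <;> simp +contextual

theorem SmoothPhase.sm_fn (h : SmoothPhase P J) {q : ℝ × (Fin n → ℝ)} (hq : q.1 ∈ J) :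
    Sm P.fn q := h.sm_omega hq

theorem SmoothPhase.hasDerivAt_fderiv_fn_line (h : SmoothPhase P J) (ht : t ∈ J)
    (v : Fin n → ℝ) (q : ℝ × (Fin n → ℝ)) :
    HasDerivAt (fun σ : ℝ => fderiv ℝ P.fn (t, P.x0 t + σ • v) q)
      (fderiv ℝ (fderiv ℝ P.fn) (t, P.x0 t) (0, v) q) 0 := by
  have h2 : HasDerivAt (fun σ : ℝ => (t, P.x0 t + σ • v)) ((0 : ℝ), v) 0 := by
    refine (hasDerivAt_const 0 t).prodMk ?_
    simpa using ((hasDerivAt_id (0 : ℝ)).smul_const v).const_add (P.x0 t)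
  exact hasDerivAt_fderiv_apply (h.sm_fn (q := (t, P.x0 t)) ht) h2 (by simp) q

/-- The second derivative of the phase in `x` is `w₂`. -/
theorem SmoothPhase.fderiv2_fn_snd (h : SmoothPhase P J) (hdeg : 2 ≤ P.deg) (ht : t ∈ J)
    (v : Fin n → ℝ) :
    fderiv ℝ (fderiv ℝ P.fn) (t, P.x0 t) (0, v) (0, v) = P.w2 t v := by
  have h1 := h.hasDerivAt_fderiv_fn_line ht v (0, v)
  have h2 := hasDerivAt_poly ((midx n P.deg).filter (fun α => 2 ≤ mdeg α))
    ((∑ j, v j * P.ξ0 t j : ℝ) : ℂ) 0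
    (fun α => P.w α t * mpow (fun i => (v i : ℂ)) α / (mfact α : ℂ) * mdeg α)
    (fun α => mdeg α - 1) 0
  have h3 := h1.unique (h2.congr_of_eventuallyEq (Filter.Eventually.of_forall fun σ => by
    simpa using h.fderiv_fn_line ht v σ))
  rw [h3, zero_add, Phase.w2]
  have hsub : (midx n 2).filter (fun α => mdeg α = 2)
      ⊆ (midx n P.deg).filter (fun α => 2 ≤ mdeg α) := fun α hα => by
    rw [Finset.mem_filter, mem_midx] at hα ⊢
    omega
  rw [← Finset.sum_subset hsub]
  · refine Finset.sum_congr rfl fun α hα => ?_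
    rw [(Finset.mem_filter.1 hα).2]
    push_cast
    ring
  · intro α hα hα'
    rw [Finset.mem_filter, mem_midx] at hα hα'
    have : mdeg α - 1 - 1 ≠ 0 := by omega
    simp [this]

theorem SmoothPhase.hasDerivAt_x0 (h : SmoothPhase P J) (ht : t ∈ J) :
    HasDerivAt P.x0 (deriv P.x0 t) t := (h.sm_x0 ht).differentiableAt.hasDerivAt

/-- This is ∂_x ω = ξ₀ differentiated along the curve. The point is that the result is real. -/
theorem SmoothPhase.fderiv2_fn_curve (h : SmoothPhase P J) (ht : t ∈ J) (v : Fin n → ℝ) :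
    fderiv ℝ (fderiv ℝ P.fn) (t, P.x0 t) (1, deriv P.x0 t) (0, v)
      = ((∑ j, v j * deriv P.ξ0 t j : ℝ) : ℂ) := by
  have h1 : HasDerivAt (fun τ => (τ, P.x0 τ)) ((1 : ℝ), deriv P.x0 t) t :=
    (hasDerivAt_id t).prodMk (h.hasDerivAt_x0 ht)
  have h2 := hasDerivAt_fderiv_apply (h.sm_fn (q := (t, P.x0 t)) ht) h1 rfl ((0 : ℝ), v)
  have h3 : HasDerivAt (fun τ => ((∑ j, v j * P.ξ0 τ j : ℝ) : ℂ))
      ((∑ j, v j * deriv P.ξ0 t j : ℝ) : ℂ) t := by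
    refine HasDerivAt.ofReal_comp (HasDerivAt.fun_sum fun j _ => ?_)
    exact ((hasDerivAt_pi.1 (h.sm_ξ0 ht).differentiableAt.hasDerivAt j).const_mul (v j))
  have h4 : (fun τ => fderiv ℝ P.fn (τ, P.x0 τ) (0, v)) =ᶠ[𝓝 t]
      fun τ => ((∑ j, v j * P.ξ0 τ j : ℝ) : ℂ) := by
    filter_upwards [h.isOpen.mem_nhds ht] with τ hτ using h.fderiv_fn_snd hτ v
  exact h2.unique (h3.congr_of_eventuallyEq h4)

/-- Split the vector (1, 0) into the tangent (1, x₀') of the curve and -(0, x₀'). The first part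
contributes a real number and the second one -w₂(x₀', x₀'). -/
theorem SmoothPhase.im_fderiv2_fn (h : SmoothPhase P J) (hdeg : 2 ≤ P.deg) (ht : t ∈ J) :
    (fderiv ℝ (fderiv ℝ P.fn) (t, P.x0 t) (0, deriv P.x0 t) (1, 0)).im
      = - (P.w2 t (deriv P.x0 t)).im := by
  have hsym := (h.sm_fn (q := (t, P.x0 t)) ht).contDiffAt.isSymmSndFDerivAt (by
    simp only [minSmoothness_of_isRCLikeNormedField]; exact WithTop.coe_le_coe.2 le_top)
  rw [hsym.eq]
  have h1 : ((1 : ℝ), (0 : Fin n → ℝ)) = (1, deriv P.x0 t) - (0, deriv P.x0 t) := by simp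
  rw [h1, map_sub, _root_.sub_apply, h.fderiv2_fn_curve ht, h.fderiv2_fn_snd hdeg ht,
    Complex.sub_im, Complex.ofReal_im, zero_sub]

/-- Since ∂_x ω = ξ₀ on the curve, the complex covector differs from the real one only in τ, and all
terms with γ ≠ 0 drop out. -/
theorem symAt_x0 (h : SmoothPhase P J) (ht : t ∈ J) (L : ℕ) (G : ℝ → (Fin n → ℝ) → ℂ) :
    symAt P L G t (P.x0 t) = ∑ p ∈ Finset.range (L + 1),
      iteratedDeriv p (fun τ => G τ (P.ξ0 t)) 0 / (p.factorial : ℂ) * P.dt t (P.x0 t) ^ p := by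
  refine Finset.sum_congr rfl fun p _ => ?_
  simp only [h.dx_x0 ht, sub_self, mpow_zero_left]
  rw [Finset.sum_eq_single 0]
  · simp [mderiv_zero, mfact]
  · intro γ _ hγ
    simp [hγ]
  · intro h0
    exact absurd (mem_midx.2 (by simp [mdeg])) h0

theorem symAt_const (P : Phase n) (L : ℕ) (g : (Fin n → ℝ) → ℂ) (t : ℝ) (x : Fin n → ℝ) :
    symAt P L (fun _ => g) t x = ∑ γ ∈ midx n L, mderiv γ g (P.ξ0 t) / (mfact γ : ℂ)
      * mpow (fun i => P.dx t x i - (P.ξ0 t i : ℂ)) γ := by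
  unfold symAt
  rw [Finset.sum_eq_single 0]
  · simp
  · intro p _ hp
    refine Finset.sum_eq_zero fun γ _ => ?_
    rw [iteratedDeriv_const, if_neg hp]
    simp
  · simp

theorem symAt_const_x0 (h : SmoothPhase P J) (ht : t ∈ J) (L : ℕ) (g : (Fin n → ℝ) → ℂ) :
    symAt P L (fun _ => g) t (P.x0 t) = g (P.ξ0 t) := by
  rw [symAt_x0 h ht, Finset.sum_eq_single 0]
  · simp
  · intro p _ hp
    rw [iteratedDeriv_const, if_neg hp]
    simp
  · simp

/-- The derivative of `f(t, x, ∂_x ω)` along a line through `x₀(t)`. -/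
theorem SmoothPhase.exists_hasDerivAt_symAt_line (h : SmoothPhase P J) (ht : t ∈ J)
    (hf : Sm S.f (t, P.x0 t, P.ξ0 t)) (L : ℕ) (v : Fin n → ℝ) :
    ∃ s' : ℂ, HasDerivAt (fun σ : ℝ =>
        symAt P L (fun _ ξ => (S.f (t, P.x0 t + σ • v, ξ) : ℂ)) t (P.x0 t + σ • v)) s' 0 ∧
      ‖s'‖ ≤ ((midx n L).card * (1 + n * ‖fderiv ℝ (fderiv ℝ P.fn) (t, P.x0 t)‖))
        * ‖fderiv ℝ S.f (t, P.x0 t, P.ξ0 t)‖ * ‖v‖ := by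
  set D := ‖fderiv ℝ S.f (t, P.x0 t, P.ξ0 t)‖
  set W := ‖fderiv ℝ (fderiv ℝ P.fn) (t, P.x0 t)‖
  have hline : Sm (fun σ : ℝ => P.x0 t + σ • v) 0 := ContDiff.sm (by fun_prop)
  -- the Taylor coefficients of `f` at the real covector
  have hc : ∀ γ, Sm (fun σ : ℝ => mderiv γ (fun ξ => (S.f (t, P.x0 t + σ • v, ξ) : ℂ)) (P.ξ0 t))
      0 := by
    intro γ
    have h0 : Sm (fun q : ℝ × (Fin n → ℝ) => (t, P.x0 t + q.1 • v, q.2)) (0, P.ξ0 t) :=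
      ContDiff.sm (by fun_prop)
    have hf' : Sm S.f ((fun q : ℝ × (Fin n → ℝ) => (t, P.x0 t + q.1 • v, q.2)) (0, P.ξ0 t)) := by
      simpa using hf
    have h1 := (Sm.comp (q := ((0 : ℝ), P.ξ0 t)) hf' h0).ofReal
    have h2 := Sm.mderiv (X := ℝ) (f := fun q => (S.f (t, P.x0 t + q.1 • v, q.2) : ℂ)) h1 γ
    have h3 : Sm (fun σ : ℝ => (σ, P.ξ0 t)) 0 := ContDiff.sm (by fun_prop)
    exact Sm.comp (q := (0 : ℝ)) (h := fun σ : ℝ => (σ, P.ξ0 t)) h2 h3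
  have hz : ∀ i, HasDerivAt (fun σ : ℝ => P.dx t (P.x0 t + σ • v) i - (P.ξ0 t i : ℂ))
      (fderiv ℝ (fderiv ℝ P.fn) (t, P.x0 t) (0, v) (0, Pi.single i 1)) 0 := by
    intro i
    refine HasDerivAt.sub_const _ ((h.hasDerivAt_fderiv_fn_line ht v
      (0, Pi.single i 1)).congr_of_eventuallyEq (Filter.Eventually.of_forall fun σ => ?_))
    exact h.dx_eq (q := (t, P.x0 t + σ • v)) ht i
  have hz0 : ∀ i, P.dx t (P.x0 t + (0 : ℝ) • v) i - (P.ξ0 t i : ℂ) = 0 := fun i => by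
    simp [h.dx_x0 ht]
  have hb : ∀ i, ‖fderiv ℝ (fderiv ℝ P.fn) (t, P.x0 t) (0, v) (0, Pi.single i 1)‖ ≤ W * ‖v‖ := by
    intro i
    refine ((fderiv ℝ (fderiv ℝ P.fn) (t, P.x0 t)).le_opNorm₂ _ _).trans ?_
    have h1 : ‖((0 : ℝ), v)‖ = ‖v‖ := by simp [Prod.norm_def]
    have h2 : ‖((0 : ℝ), (Pi.single i 1 : Fin n → ℝ))‖ ≤ 1 := by
      simp [Prod.norm_def, Pi.norm_single]
    rw [h1]
    exact mul_le_of_le_one_right (by positivity) h2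
  -- Since ∂_x ω - ξ₀ vanishes at σ = 0, the Taylor coefficient is differentiated only in the term γ
  -- = 0, and the monomial only in terms with |γ| = 1. These are the x- and ξ-derivatives of f.
  have hder := HasDerivAt.fun_sum (u := midx n L) fun γ _ =>
    (((hc γ).differentiableAt.hasDerivAt.div_const (mfact γ : ℂ)).mul (hasDerivAt_mpow hz hz0 γ))
  refine ⟨_, hder.congr_of_eventuallyEq (Filter.Eventually.of_forall fun σ => ?_), ?_⟩
  · exact symAt_const P L _ t _
  have hf1 : HasFDerivAt S.f (fderiv ℝ S.f (t, P.x0 t, P.ξ0 t)) (t, P.x0 t + (0 : ℝ) • v, P.ξ0 t) := by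
    simpa using hf.differentiableAt.hasFDerivAt
  calc _ ≤ ∑ γ ∈ midx n L, (1 + n * W) * D * ‖v‖ := by
        refine norm_sum_le_of_le _ fun γ _ => ?_
        have hfac : ∀ x : ℂ, ‖x / (mfact γ : ℂ)‖ ≤ ‖x‖ := fun x => by
          rw [norm_div, Complex.norm_natCast]
          exact div_le_self (norm_nonneg _) (one_le_mfact γ)
        have e1 : ‖deriv (fun σ : ℝ => mderiv γ (fun ξ => (S.f (t, P.x0 t + σ • v, ξ) : ℂ)) (P.ξ0 t)) 0
            / (mfact γ : ℂ) * mpow (fun i => P.dx t (P.x0 t + (0 : ℝ) • v) i - (P.ξ0 t i : ℂ)) γ‖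
            ≤ D * ‖v‖ := by
          simp only [hz0, mpow_zero_left]
          split_ifs with hγ
          · subst hγ
            rw [mul_one]
            refine (hfac _).trans ?_
            simp only [mderiv_zero]
            have h2 : HasDerivAt (fun σ : ℝ => (t, P.x0 t + σ • v, P.ξ0 t))
                ((0 : ℝ), v, (0 : Fin n → ℝ)) 0 := by
              refine (hasDerivAt_const _ _).prodMk (HasDerivAt.prodMk ?_ (hasDerivAt_const _ _))
              simpa using ((hasDerivAt_id (0 : ℝ)).smul_const v).const_add (P.x0 t)
            have h3 := (hf1.comp_hasDerivAt 0 h2).ofReal_comp.deriv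
            simp only [Function.comp_apply] at h3
            rw [h3, Complex.norm_real]
            refine (ContinuousLinearMap.le_opNorm _ _).trans (le_of_eq ?_)
            simp [Prod.norm_def, D]
          · rw [mul_zero, norm_zero]
            positivity
        have e2 : ‖mderiv γ (fun ξ => (S.f (t, P.x0 t + (0 : ℝ) • v, ξ) : ℂ)) (P.ξ0 t) / (mfact γ : ℂ)
            * ∑ i, if γ = Pi.single i 1 then
              fderiv ℝ (fderiv ℝ P.fn) (t, P.x0 t) (0, v) (0, Pi.single i 1) else 0‖
            ≤ n * (D * (W * ‖v‖)) := by
          rw [Finset.mul_sum]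
          refine (norm_sum_le_of_le (f := _) Finset.univ (n := fun _ => D * (W * ‖v‖))
            fun i _ => ?_).trans (by simp)
          split_ifs with hγ
          · subst hγ
            rw [norm_mul]
            refine mul_le_mul ((hfac _).trans ?_) (hb i) (norm_nonneg _) (norm_nonneg _)
            rw [mderiv_single]
            have h2 : HasFDerivAt (fun ξ => (t, P.x0 t + (0 : ℝ) • v, ξ)) _ (P.ξ0 t) :=
              (hasFDerivAt_const t (P.ξ0 t)).prodMk ((hasFDerivAt_const _ _).prodMk
                (hasFDerivAt_id (𝕜 := ℝ) (P.ξ0 t)))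
            have h3 := Complex.ofRealCLM.hasFDerivAt.comp (P.ξ0 t) (hf1.comp (P.ξ0 t) h2)
            have h4 : pderiv i (fun ξ => (S.f (t, P.x0 t + (0 : ℝ) • v, ξ) : ℂ)) (P.ξ0 t) = _ :=
              congrArg (fun T => T (Pi.single i (1 : ℝ))) h3.fderiv
            rw [h4]
            simp only [ContinuousLinearMap.comp_apply, Complex.ofRealCLM_apply, Complex.norm_real]
            refine (ContinuousLinearMap.le_opNorm _ _).trans
              (mul_le_of_le_one_right (norm_nonneg _) ?_)
            simp [Prod.norm_def, Pi.norm_single]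
          · rw [mul_zero, norm_zero]
            positivity
        refine (norm_add_le _ _).trans ((add_le_add e1 e2).trans (le_of_eq ?_))
        ring
    _ = _ := by rw [Finset.sum_const, nsmul_eq_mul]; ring

end PhaseGeometry

end Transport

namespace Transport

/-! ### Consequences of the eikonal equation, and bounds for the coefficients with β = 0. -/

section Eikonal

variable {n d : ℕ} {S : Symbols n d} {P : Phase n} {J : Set ℝ} {L r : ℕ} {t t₁ t₂ : ℝ}

theorem IsPhase.smoothPhase (hP : IsPhase S P L r t₁ t₂) :
    ∃ J, Set.Icc t₁ t₂ ⊆ J ∧ SmoothPhase P J := by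
  obtain ⟨J, h1, h2, h3, h4, h5, h6⟩ := hP.smooth
  exact ⟨J, h2, h1, h3, h4, h5, h6⟩

/-- The eikonal equation at `x = x₀(t)`. -/
theorem IsPhase.dt_x0 (hP : IsPhase S P L r t₁ t₂) (hr : 2 ≤ r) (h : SmoothPhase P J)
    (hJ : Set.Icc t₁ t₂ ⊆ J) (ht : t ∈ Set.Icc t₁ t₂) :
    P.dt t (P.x0 t) = -Complex.I * fcurve S P t := by
  obtain ⟨C, δ, hδ, hE⟩ := hP.eikonal
  have h1 := hE t ht (P.x0 t) (by simpa using hδ)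
  rw [sub_self, norm_zero, zero_pow (by omega), mul_zero, norm_le_zero_iff, Transport.eikonal,
    symAt_const_x0 h (hJ ht)] at h1
  rw [eq_neg_of_add_eq_zero_left h1, neg_mul]
  rfl

/-- `∂_t Im w₀ = -f` on the curve. -/
theorem IsPhase.hasDerivAt_im_w0 (hP : IsPhase S P L r t₁ t₂) (hr : 2 ≤ r) (h : SmoothPhase P J)
    (hJ : Set.Icc t₁ t₂ ⊆ J) (ht : t ∈ Set.Icc t₁ t₂) :
    HasDerivAt (fun t => (P.w0 t).im) (-fcurve S P t) t := by
  have h1 : HasDerivAt (fun τ => (τ, P.x0 τ)) ((1 : ℝ), deriv P.x0 t) t :=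
    (hasDerivAt_id t).prodMk (h.hasDerivAt_x0 (hJ ht))
  have h2 := (h.sm_fn (q := (t, P.x0 t)) (hJ ht)).differentiableAt.hasFDerivAt.comp_hasDerivAt t h1
  have h3 : P.fn ∘ (fun τ => (τ, P.x0 τ)) = P.w0 := by
    funext τ
    have := P.omega_line τ 0 0
    rw [zero_smul, add_zero] at this
    rw [Function.comp_apply, Phase.fn, this]
    simp only [Complex.ofReal_zero, zero_mul, add_zero, add_eq_left]
    refine Finset.sum_eq_zero fun α hα => ?_
    have : mdeg α ≠ 0 := by have := (Finset.mem_filter.1 hα).2; omega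
    simp [this]
  -- That is, w₀' = -i f + ⟨x₀', ξ₀⟩, where the last term is real.
  have h4 : fderiv ℝ P.fn (t, P.x0 t) (1, deriv P.x0 t)
      = -Complex.I * fcurve S P t + ((∑ j, deriv P.x0 t j * P.ξ0 t j : ℝ) : ℂ) := by
    have h5 : ((1 : ℝ), deriv P.x0 t) = (1, 0) + (0, deriv P.x0 t) := by simp
    rw [h5, map_add, h.fderiv_fn_snd (hJ ht), ← hP.dt_x0 hr h hJ ht]
    congr 1
    exact (h.dt_eq (q := (t, P.x0 t)) (hJ ht)).symm
  rw [h3, h4] at h2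
  have h6 := Complex.imCLM.hasFDerivAt.comp_hasDerivAt t h2
  refine h6.congr_deriv ?_
  simp

/-- The velocity of the curve is controlled by the gradient of `f`. -/
theorem IsPhase.exists_norm_deriv_x0_le (hP : IsPhase S P L r t₁ t₂) (hr : 2 ≤ r)
    (h : SmoothPhase P J) (hJ : Set.Icc t₁ t₂ ⊆ J)
    (hf : ∀ t ∈ Set.Icc t₁ t₂, Sm S.f (t, P.x0 t, P.ξ0 t)) :
    ∃ C : ℝ, 0 ≤ C ∧ ∀ t ∈ Set.Icc t₁ t₂,
      ‖deriv P.x0 t‖ ≤ C * ‖fderiv ℝ S.f (t, P.x0 t, P.ξ0 t)‖ := by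
  obtain ⟨c, hc, hw⟩ := hP.im_w2
  obtain ⟨C, δ, hδ, hE⟩ := hP.eikonal
  obtain ⟨W, hW⟩ : ∃ W, ∀ t ∈ Set.Icc t₁ t₂, ‖fderiv ℝ (fderiv ℝ P.fn) (t, P.x0 t)‖ ≤ W := by
    refine isCompact_Icc.exists_bound_of_continuousOn
      (f := fun t => fderiv ℝ (fderiv ℝ P.fn) (t, P.x0 t)) fun t ht => ?_
    have h1 : ContinuousAt (fun t => (t, P.x0 t)) t :=
      continuousAt_id.prodMk (h.sm_x0 (hJ ht)).differentiableAt.continuousAt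
    exact (ContinuousAt.comp (f := fun t => (t, P.x0 t))
      (h.sm_fn (q := (t, P.x0 t)) (hJ ht)).fderiv.fderiv.differentiableAt.continuousAt
      h1).continuousWithinAt
  set A := (midx n L).card * (1 + n * |W|) with hA
  refine ⟨A / c, by positivity, fun t ht => ?_⟩
  set v := deriv P.x0 t with hv
  obtain ⟨s', hs', hs'le⟩ := h.exists_hasDerivAt_symAt_line (hJ ht) (hf t ht) L v
  -- the eikonal equation to first order
  have hdt : HasDerivAt (fun σ : ℝ => P.dt t (P.x0 t + σ • v))
      (fderiv ℝ (fderiv ℝ P.fn) (t, P.x0 t) (0, v) (1, 0)) 0 :=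
    (h.hasDerivAt_fderiv_fn_line (hJ ht) v (1, 0)).congr_of_eventuallyEq
      (Filter.Eventually.of_forall fun σ => h.dt_eq (q := (t, P.x0 t + σ • v)) (hJ ht))
  have hE1 : HasDerivAt (fun σ : ℝ => Transport.eikonal S P L t (P.x0 t + σ • v))
      (fderiv ℝ (fderiv ℝ P.fn) (t, P.x0 t) (0, v) (1, 0) + Complex.I * s') 0 :=
    hdt.add (hs'.const_mul Complex.I)
  -- Because r ≥ 2, the error in the eikonal equation has no linear part.
  have hE2 : HasDerivAt (fun σ : ℝ => Transport.eikonal S P L t (P.x0 t + σ • v)) 0 0 := by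
    have hbound : ∀ᶠ σ : ℝ in 𝓝 0, ‖Transport.eikonal S P L t (P.x0 t + σ • v)‖
        ≤ (|C| * ‖v‖ ^ r) * ‖σ ^ 2‖ := by
      have h1 : ∀ᶠ σ : ℝ in 𝓝 0, ‖σ • v‖ < δ := by
        have : Continuous fun σ : ℝ => ‖σ • v‖ := by fun_prop
        exact this.continuousAt.eventually_lt continuousAt_const (by simpa using hδ)
      have h2 : ∀ᶠ σ : ℝ in 𝓝 0, ‖σ‖ < 1 :=
        continuous_norm.continuousAt.eventually_lt continuousAt_const (by simp)
      filter_upwards [h1, h2] with σ h1 h2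
      refine (hE t ht _ (by simpa using h1)).trans ?_
      rw [add_sub_cancel_left, norm_smul, mul_pow, norm_pow]
      calc C * (‖σ‖ ^ r * ‖v‖ ^ r) ≤ |C| * (‖σ‖ ^ 2 * ‖v‖ ^ r) := by
            gcongr ?_ * (?_ * _)
            · exact le_abs_self C
            · exact pow_le_pow_of_le_one (norm_nonneg _) h2.le hr
        _ = _ := by ring
    have hO : (fun σ : ℝ => Transport.eikonal S P L t (P.x0 t + σ • v)) =O[𝓝 0] fun σ : ℝ => (σ - 0) ^ 2 := by
      simp only [sub_zero]
      exact Asymptotics.IsBigO.of_bound _ hbound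
    have hO' : (fun σ : ℝ => Transport.eikonal S P L t (P.x0 t + σ • v)) =O[𝓝 0]
        fun σ : ℝ => ‖σ - 0‖ ^ 2 := by
      refine hO.trans (Asymptotics.IsBigO.of_bound 1 (Filter.Eventually.of_forall fun σ => ?_))
      simp
    exact (hO'.hasFDerivAt (by norm_num)).hasDerivAt
  have h0 := hE1.unique hE2
  have him := h.im_fderiv2_fn hP.two_le_deg (hJ ht)
  -- The linear part in the direction v = x₀' becomes Re s' = Im w₂(v, v): the left side is at most
  -- a multiple of |df||v|, the right side at least c|v|².
  rw [eq_neg_of_add_eq_zero_left h0, Complex.neg_im, Complex.I_mul_im, neg_inj] at him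
  have h3 : c * ‖v‖ ^ 2 ≤ A * ‖fderiv ℝ S.f (t, P.x0 t, P.ξ0 t)‖ * ‖v‖ := by
    calc c * ‖v‖ ^ 2 ≤ c * ∑ i, v i ^ 2 := by
          gcongr
          have hle : ‖v‖ ≤ Real.sqrt (∑ i, v i ^ 2) := by
            refine (pi_norm_le_iff_of_nonneg (Real.sqrt_nonneg _)).2 fun i => ?_
            rw [Real.norm_eq_abs, ← Real.sqrt_sq_eq_abs]
            exact Real.sqrt_le_sqrt (Finset.single_le_sum (f := fun i => v i ^ 2)
              (fun _ _ => sq_nonneg _) (Finset.mem_univ i))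
          calc ‖v‖ ^ 2 ≤ Real.sqrt (∑ i, v i ^ 2) ^ 2 := by gcongr
            _ = _ := Real.sq_sqrt (Finset.sum_nonneg fun _ _ => sq_nonneg _)
      _ ≤ (P.w2 t v).im := hw t ht v
      _ = s'.re := him.symm
      _ ≤ ‖s'‖ := Complex.re_le_norm s'
      _ ≤ _ := hs'le
      _ ≤ _ := by
          have := (hW t ht).trans (le_abs_self W)
          rw [hA]
          gcongr
  rcases (norm_nonneg v).eq_or_lt with hv0 | hv0
  · rw [← hv0]
    positivity
  · rw [div_mul_eq_mul_div, le_div_iff₀ hc]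
    have : (‖v‖ * c) * ‖v‖ ≤ (A * ‖fderiv ℝ S.f (t, P.x0 t, P.ξ0 t)‖) * ‖v‖ := by
      calc (‖v‖ * c) * ‖v‖ = c * ‖v‖ ^ 2 := by ring
        _ ≤ _ := h3
    exact le_of_mul_le_mul_right this hv0

theorem norm_coefA0_zero_le (h : SmoothPhase P J) (ht : t ∈ J)
    (hf : Sm S.f (t, P.x0 t, P.ξ0 t)) (L : ℕ) (j : Fin n) :
    ‖coefA0 S P L 0 j t‖ ≤ ‖fderiv ℝ S.f (t, P.x0 t, P.ξ0 t)‖ + ‖deriv P.x0 t‖ := by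
  rw [coefA0, tcoef_zero, symAt_const_x0 h ht]
  refine (norm_sub_le _ _).trans (add_le_add ?_ ?_)
  · have h2 : HasFDerivAt (fun ξ => (t, P.x0 t, ξ)) _ (P.ξ0 t) :=
      (hasFDerivAt_const t (P.ξ0 t)).prodMk ((hasFDerivAt_const _ _).prodMk
        (hasFDerivAt_id (𝕜 := ℝ) (P.ξ0 t)))
    have h3 := Complex.ofRealCLM.hasFDerivAt.comp (P.ξ0 t)
      (hf.differentiableAt.hasFDerivAt.comp (P.ξ0 t) h2)
    have h4 : pderiv j (fun ξ => (S.f (t, P.x0 t, ξ) : ℂ)) (P.ξ0 t) = _ :=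
      congrArg (fun T => T (Pi.single j (1 : ℝ))) h3.fderiv
    rw [norm_mul, Complex.norm_I, one_mul, h4]
    simp only [ContinuousLinearMap.comp_apply, Complex.ofRealCLM_apply, Complex.norm_real]
    refine (ContinuousLinearMap.le_opNorm _ _).trans (mul_le_of_le_one_right (norm_nonneg _) ?_)
    simp [Prod.norm_def, Pi.norm_single]
  · rw [Complex.norm_real]
    exact norm_le_pi_norm (deriv P.x0 t) j

/-- Values of symbols at the complex covector on the curve, up to multiples of `f`. -/
theorem exists_norm_symAt_x0_le {E : Type*} [NormedAddCommGroup E] [NormedSpace ℝ E]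
    [ProperSpace E] (hP : IsPhase S P L r t₁ t₂) (hr : 2 ≤ r) (h : SmoothPhase P J)
    (hJ : Set.Icc t₁ t₂ ⊆ J) (hfc : ContinuousOn (fcurve S P) (Set.Icc t₁ t₂)) {η : ℝ}
    {K : ℝ × E → ℝ → (Fin n → ℝ) → ℂ}
    (hK : ∀ t ∈ Set.Icc t₁ t₂, ∀ y, ‖y‖ ≤ η →
      Sm (fun q : (ℝ × E) × ℝ => K q.1 q.2 (P.ξ0 q.1.1)) ((t, y), 0)) :
    ∃ C : ℝ, 0 ≤ C ∧ ∀ t ∈ Set.Icc t₁ t₂, ∀ y, ‖y‖ ≤ η →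
      ‖symAt P L (K (t, y)) t (P.x0 t)‖ ≤ ‖K (t, y) 0 (P.ξ0 t)‖ + C * |fcurve S P t| := by
  obtain ⟨F, hF⟩ := isCompact_Icc.exists_bound_of_continuousOn hfc
  have hcomp : IsCompact (Set.Icc t₁ t₂ ×ˢ Metric.closedBall (0 : E) η) :=
    isCompact_Icc.prod (isCompact_closedBall 0 η)
  have hb : ∀ p : ℕ, ∃ C : ℝ, ∀ q ∈ Set.Icc t₁ t₂ ×ˢ Metric.closedBall (0 : E) η,
      ‖iteratedDeriv p (fun τ => K q τ (P.ξ0 q.1)) 0‖ ≤ C := by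
    intro p
    refine hcomp.exists_bound_of_continuousOn fun q hq => ?_
    obtain ⟨t, y⟩ := q
    have h1 := Sm.iteratedDeriv (hK t hq.1 y (by simpa using hq.2)) p
    have h2 : Sm (fun q : ℝ × E => (q, (0 : ℝ))) (t, y) :=
      ContDiff.sm (contDiff_id.prodMk contDiff_const)
    exact (Sm.comp (q := (t, y)) (h := fun q : ℝ × E => (q, (0 : ℝ))) h1
      h2).differentiableAt.continuousAt.continuousWithinAt
  choose B hB using hb
  refine ⟨∑ p ∈ Finset.range L, |B (p + 1)| * |F| ^ p, by positivity, fun t ht y hy => ?_⟩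
  have hmem : (t, y) ∈ Set.Icc t₁ t₂ ×ˢ Metric.closedBall (0 : E) η := ⟨ht, by simpa using hy⟩
  -- The term p = 0 is the value at the real covector, and every other term has a factor ∂_t ω = -i
  -- f.
  rw [symAt_x0 h (hJ ht), Finset.sum_range_succ', Finset.sum_mul, add_comm]
  refine (norm_add_le _ _).trans (add_le_add (by simp) (norm_sum_le_of_le _ fun p _ => ?_))
  rw [norm_mul, norm_div, norm_pow, hP.dt_x0 hr h hJ ht, Complex.norm_natCast, norm_mul, norm_neg,
    Complex.norm_I, one_mul, Complex.norm_real, Real.norm_eq_abs, pow_succ, ← mul_assoc]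
  refine mul_le_mul_of_nonneg_right (mul_le_mul ?_ ?_ (pow_nonneg (abs_nonneg _) _)
    (abs_nonneg _)) (abs_nonneg _)
  · refine (div_le_self (norm_nonneg _) ?_).trans ((hB (p + 1) _ hmem).trans (le_abs_self _))
    exact_mod_cast Nat.factorial_pos _
  · exact pow_le_pow_left₀ (abs_nonneg _) ((hF t ht).trans (le_abs_self F)) _

theorem GradBound.exists_tube {y₀ : Fin d → ℝ} (hG : GradBound S P y₀ t₁ t₂) (ht : t₁ ≤ t₂)
    (h : SmoothPhase P J) (hJ : Set.Icc t₁ t₂ ⊆ J) :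
    ∃ C ε η : ℝ, 0 ≤ C ∧ 0 < ε ∧ 0 < η ∧ ∀ t ∈ Set.Icc t₁ t₂, ∀ y, ‖y‖ ≤ η →
      ‖S.B (t, P.x0 t, y₀ + y, 0, P.ξ0 t, 0)‖ + ‖S.A (t, P.x0 t, y₀ + y, 0, P.ξ0 t, 0)‖
        + ‖fderiv ℝ S.f (t, P.x0 t, P.ξ0 t)‖ ≤ C * |fcurve S P t| ^ ε := by
  obtain ⟨C, ε, hε, V, hV, hVm, hb⟩ := hG
  obtain ⟨η, hη, hη'⟩ := exists_uniform_tube ht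
    (p := fun q : ℝ × (Fin d → ℝ) => (q.1, P.x0 q.1, y₀ + q.2, (0 : ℝ), P.ξ0 q.1) ∈ V)
    fun t ht => by
      have hx : ContinuousAt (fun q : ℝ × (Fin d → ℝ) => P.x0 q.1) (t, 0) :=
        ContinuousAt.comp (f := Prod.fst) (h.sm_x0 (hJ ht)).contDiffAt.continuousAt continuousAt_fst
      have hξ : ContinuousAt (fun q : ℝ × (Fin d → ℝ) => P.ξ0 q.1) (t, 0) :=
        ContinuousAt.comp (f := Prod.fst) (h.sm_ξ0 (hJ ht)).contDiffAt.continuousAt continuousAt_fst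
      refine (continuousAt_fst.prodMk (hx.prodMk ((continuousAt_const.add continuousAt_snd).prodMk
        (continuousAt_const.prodMk hξ)))).eventually_mem (hV.mem_nhds ?_)
      simpa using hVm t ht
  refine ⟨|C|, ε, η, abs_nonneg C, hε, hη, fun t ht y hy => ?_⟩
  refine (hb t _ _ _ _ (hη' t ⟨by linarith [ht.1], by linarith [ht.2]⟩ y hy)).trans ?_
  exact mul_le_mul_of_nonneg_right (le_abs_self C) (Real.rpow_nonneg (abs_nonneg _) _)

theorem sm_fcurve (h : SmoothPhase P J) (ht : t ∈ J) (hf : Sm S.f (t, P.x0 t, P.ξ0 t)) :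
    Sm (fcurve S P) t :=
  Sm.comp (f := S.f) (h := fun t => (t, P.x0 t, P.ξ0 t)) (q := t) hf
    ((ContDiff.sm contDiff_id).prodMk ((h.sm_x0 ht).prodMk (h.sm_ξ0 ht)))

/-- Under the gradient bound, the coefficients of the transport equations with `β = 0` are
controlled by a power of `f`. -/
theorem GradBound.exists_coef_le {y₀ : Fin d → ℝ} (hG : GradBound S P y₀ t₁ t₂) (ht : t₁ ≤ t₂)
    (hP : IsPhase S P L r t₁ t₂) (hr : 2 ≤ r) (h : SmoothPhase P J) (hJ : Set.Icc t₁ t₂ ⊆ J)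
    (hS : SmoothSymbols S P y₀ t₁ t₂) :
    ∃ C ε η : ℝ, 0 ≤ C ∧ 0 < ε ∧ 0 < η ∧ ∀ t ∈ Set.Icc t₁ t₂, ∀ y : Fin d → ℝ, ‖y‖ ≤ η →
      (∀ j, ‖coefA0 S P L 0 j t‖ ≤ C * (|fcurve S P t| ^ ε + |fcurve S P t|)) ∧
      (∀ j, ‖coefA1 S P y₀ L 0 j t y‖ ≤ C * (|fcurve S P t| ^ ε + |fcurve S P t|)) ∧
      ∀ j l, ‖coefA2 S P y₀ L 0 j l t y‖ ≤ C * (|fcurve S P t| ^ ε + |fcurve S P t|) := by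
  obtain ⟨C, ε, η, hC, hε, hη, hb⟩ := hG.exists_tube ht h hJ
  obtain ⟨η', hη', hadm⟩ := exists_admissible_tube ht h hJ hS
  have hadm' : ∀ t ∈ Set.Icc t₁ t₂, ∀ y, ‖y‖ ≤ min η η' → Admissible S P y₀ t y :=
    fun t ht y hy => (hadm t ⟨by linarith [ht.1], by linarith [ht.2]⟩ y
      (hy.trans (min_le_right _ _))).2
  have hf : ∀ t ∈ Set.Icc t₁ t₂, Sm S.f (t, P.x0 t, P.ξ0 t) := fun t ht =>
    (hadm' t ht 0 (by simpa using ⟨hη.le, hη'.le⟩)).f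
  obtain ⟨D, hD, hx⟩ := hP.exists_norm_deriv_x0_le hr h hJ hf
  have hfc : ContinuousOn (fcurve S P) (Set.Icc t₁ t₂) := fun t ht =>
    (sm_fcurve h (hJ ht) (hf t ht)).contDiffAt.continuousAt.continuousWithinAt
  have hs : ∀ t ∈ Set.Icc t₁ t₂, ∀ y : Fin d → ℝ,
      Sm (fun q : (ℝ × (Fin d → ℝ)) × ℝ =>
        (q.1.1, P.x0 q.1.1, y₀ + q.1.2, q.2, P.ξ0 q.1.1, (0 : Fin d → ℝ))) ((t, y), 0) := by
    intro t ht y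
    have h1 : Sm (fun q : (ℝ × (Fin d → ℝ)) × ℝ => q.1.1) ((t, y), 0) :=
      ContDiff.sm (by fun_prop)
    have h2 : Sm (fun q : (ℝ × (Fin d → ℝ)) × ℝ => P.x0 q.1.1) ((t, y), 0) :=
      Sm.comp (f := P.x0) (q := ((t, y), (0 : ℝ))) (h.sm_x0 (hJ ht)) h1
    have h3 : Sm (fun q : (ℝ × (Fin d → ℝ)) × ℝ => P.ξ0 q.1.1) ((t, y), 0) :=
      Sm.comp (f := P.ξ0) (q := ((t, y), (0 : ℝ))) (h.sm_ξ0 (hJ ht)) h1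
    have h4 : Sm (fun q : (ℝ × (Fin d → ℝ)) × ℝ => y₀ + q.1.2) ((t, y), 0) :=
      ContDiff.sm (by fun_prop)
    exact h1.prodMk (h2.prodMk (h4.prodMk ((ContDiff.sm contDiff_snd).prodMk
      (h3.prodMk (Sm.const 0)))))
  have hA : ∀ j, ∃ C : ℝ, 0 ≤ C ∧ ∀ t ∈ Set.Icc t₁ t₂, ∀ y : Fin d → ℝ, ‖y‖ ≤ min η η' →
      ‖coefA1 S P y₀ L 0 j t y‖ ≤ ‖S.A (t, P.x0 t, y₀ + y, 0, P.ξ0 t, 0) j‖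
        + C * |fcurve S P t| := by
    intro j
    obtain ⟨C, hC, hb⟩ := exists_norm_symAt_x0_le (L := L) hP hr h hJ hfc (η := min η η')
      (K := fun q τ ξ => S.A (q.1, P.x0 q.1, y₀ + q.2, τ, ξ, 0) j) fun t ht y hy => by
        exact (Sm.comp (f := S.A) (q := ((t, y), (0 : ℝ))) (hadm' t ht y hy).A
          (hs t ht y)).pi_apply j
    refine ⟨C, hC, fun t ht y hy => ?_⟩
    rw [coefA1, tcoef_zero]
    exact hb t ht y hy
  have hB : ∀ j l, ∃ C : ℝ, 0 ≤ C ∧ ∀ t ∈ Set.Icc t₁ t₂, ∀ y : Fin d → ℝ, ‖y‖ ≤ min η η' →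
      ‖coefA2 S P y₀ L 0 j l t y‖ ≤ ‖S.B (t, P.x0 t, y₀ + y, 0, P.ξ0 t, 0) j l‖
        + C * |fcurve S P t| := by
    intro j l
    obtain ⟨C, hC, hb⟩ := exists_norm_symAt_x0_le (L := L) hP hr h hJ hfc (η := min η η')
      (K := fun q τ ξ => S.B (q.1, P.x0 q.1, y₀ + q.2, τ, ξ, 0) j l) fun t ht y hy => by
        exact ((Sm.comp (f := S.B) (q := ((t, y), (0 : ℝ))) (hadm' t ht y hy).B
          (hs t ht y)).pi_apply j).pi_apply l
    refine ⟨C, hC, fun t ht y hy => ?_⟩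
    rw [coefA2, tcoef_zero]
    exact hb t ht y hy
  choose CA hCA hA using hA
  choose CB hCB hB using hB
  have hSA : 0 ≤ ∑ j, CA j := Finset.sum_nonneg fun j _ => hCA j
  have hSB : 0 ≤ ∑ j, ∑ l, CB j l := Finset.sum_nonneg fun j _ => Finset.sum_nonneg fun l _ => hCB j l
  -- The factor 1 + D accounts for ∂_ξ f and x₀' in A₀, and the sums dominate the multiples of f in
  -- the single components of A₁ and A₂.
  refine ⟨C * (1 + D) + ∑ j, CA j + ∑ j, ∑ l, CB j l, ε, min η η', by positivity, hε,
    lt_min hη hη', fun t ht y hy => ?_⟩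
  have hb' := hb t ht y (hy.trans (min_le_left _ _))
  set G := |fcurve S P t| with hGdef
  have hG0 : 0 ≤ G := abs_nonneg _
  have hGε : 0 ≤ G ^ ε := Real.rpow_nonneg hG0 ε
  have nB := norm_nonneg (S.B (t, P.x0 t, y₀ + y, 0, P.ξ0 t, 0))
  have nA := norm_nonneg (S.A (t, P.x0 t, y₀ + y, 0, P.ξ0 t, 0))
  have nf := norm_nonneg (fderiv ℝ S.f (t, P.x0 t, P.ξ0 t))
  have hCD : 0 ≤ C * D * G ^ ε := by positivity
  have p1 : 0 ≤ (∑ j, CA j) * G ^ ε := by positivity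
  have p2 : 0 ≤ (∑ j, CA j) * G := by positivity
  have p3 : 0 ≤ (∑ j, ∑ l, CB j l) * G ^ ε := by positivity
  have p4 : 0 ≤ (∑ j, ∑ l, CB j l) * G := by positivity
  have p5 : 0 ≤ C * (1 + D) * G := by positivity
  refine ⟨fun j => ?_, fun j => ?_, fun j l => ?_⟩
  · have h1 := norm_coefA0_zero_le h (hJ ht) (hf t ht) L j
    have h2 := hx t ht
    have h3 : D * ‖fderiv ℝ S.f (t, P.x0 t, P.ξ0 t)‖ ≤ D * (C * G ^ ε) :=
      mul_le_mul_of_nonneg_left (by linarith) hD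
    nlinarith
  · have h1 := hA j t ht y hy
    have h2 := norm_le_pi_norm (S.A (t, P.x0 t, y₀ + y, 0, P.ξ0 t, 0)) j
    have h3 : CA j * G ≤ (∑ j, CA j) * G := mul_le_mul_of_nonneg_right
      (Finset.single_le_sum (fun j _ => hCA j) (Finset.mem_univ j)) hG0
    nlinarith
  · have h1 := hB j l t ht y hy
    have h2 := (norm_le_pi_norm (S.B (t, P.x0 t, y₀ + y, 0, P.ξ0 t, 0) j) l).trans
      (norm_le_pi_norm (S.B (t, P.x0 t, y₀ + y, 0, P.ξ0 t, 0)) j)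
    have h3 : CB j l * G ≤ (∑ j, ∑ l, CB j l) * G := mul_le_mul_of_nonneg_right
      ((Finset.single_le_sum (fun l _ => hCB j l) (Finset.mem_univ l)).trans
        (Finset.single_le_sum (f := fun j => ∑ l, CB j l)
          (fun j _ => Finset.sum_nonneg fun l _ => hCB j l) (Finset.mem_univ j))) hG0
    nlinarith

end Eikonal

end Transport

namespace Transport

/-! ### Smallness of derivatives from smallness at many points. -/

section Interpolation

/-- If `G` is small at `2^k` points with gaps at least `h`, then its derivative of order `k` is
small somewhere between them. -/
theorem exists_abs_iterate_deriv_le {h : ℝ} (hh : 0 < h) {a b : ℝ} (k : ℕ) :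
    ∀ (g : ℕ → ℝ → ℝ), (∀ i, ∀ t ∈ Set.Icc a b, HasDerivAt (g i) (g (i + 1) t) t) →
    ∀ (δ : ℝ) (p : ℕ → ℝ), (∀ j < 2 ^ k, p j ∈ Set.Icc a b) →
      (∀ j, j + 1 < 2 ^ k → p j + h ≤ p (j + 1)) → (∀ j < 2 ^ k, |g 0 (p j)| ≤ δ) →
      ∃ q ∈ Set.Icc a b, |g k q| ≤ δ * (2 / h) ^ k := by
  induction k with
  | zero =>
    intro g _ δ p hp _ hd
    exact ⟨p 0, hp 0 (by simp), by simpa using hd 0 (by simp)⟩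
  | succ k ih =>
    intro g hg δ p hp hgap hd
    have hpow : 2 ^ (k + 1) = 2 * 2 ^ k := by ring
    -- The mean value theorem on the disjoint intervals [p(2j), p(2j+1)] halves the number of points
    -- and costs a factor 2/h. The unused gaps between p(2j+1) and p(2j+2) separate the new points.
    have hmvt : ∀ j, ∃ q, j < 2 ^ k →
        q ∈ Set.Icc (p (2 * j)) (p (2 * j + 1)) ∧ |g 1 q| ≤ δ * (2 / h) := by
      intro j
      by_cases hj : j < 2 ^ k
      · have h1 := hp (2 * j) (by omega)
        have h2 := hp (2 * j + 1) (by omega)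
        have h3 := hgap (2 * j) (by omega)
        have h4 := hd (2 * j) (by omega)
        have h5 := hd (2 * j + 1) (by omega)
        have hsub : Set.Icc (p (2 * j)) (p (2 * j + 1)) ⊆ Set.Icc a b :=
          Set.Icc_subset_Icc h1.1 h2.2
        obtain ⟨q, hq, hq'⟩ := exists_hasDerivAt_eq_slope (g 0) (g 1)
          (show p (2 * j) < p (2 * j + 1) by linarith)
          (fun t ht => (hg 0 t (hsub ht)).continuousAt.continuousWithinAt)
          (fun t ht => hg 0 t (hsub (Set.Ioo_subset_Icc_self ht)))
        refine ⟨q, fun _ => ⟨Set.Ioo_subset_Icc_self hq, ?_⟩⟩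
        rw [hq', abs_div, abs_of_pos (show 0 < p (2 * j + 1) - p (2 * j) by linarith),
          div_le_iff₀ (by linarith)]
        have h6 : |g 0 (p (2 * j + 1)) - g 0 (p (2 * j))| ≤ δ + δ :=
          (abs_sub _ _).trans (add_le_add h5 h4)
        have h7 : 0 ≤ δ := (abs_nonneg _).trans h4
        calc _ ≤ δ + δ := h6
          _ = δ * (2 / h) * h := by field_simp; ring
          _ ≤ _ := by
            apply mul_le_mul_of_nonneg_left _ (by positivity)
            linarith
      · exact ⟨0, fun h => absurd h hj⟩
    choose q hq using hmvt
    obtain ⟨z, hz, hz'⟩ := ih (fun i => g (i + 1)) (fun i => hg (i + 1)) (δ * (2 / h)) q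
      (fun j hj => Set.Icc_subset_Icc (hp (2 * j) (by omega)).1 (hp (2 * j + 1) (by omega)).2
        (hq j hj).1)
      (fun j hj => by
        have h1 := (hq j (by omega)).1.2
        have h2 := (hq (j + 1) hj).1.1
        have h3 := hgap (2 * j + 1) (by omega)
        have h4 : 2 * (j + 1) = 2 * j + 1 + 1 := by ring
        rw [h4] at h2
        linarith)
      (fun j hj => (hq j hj).2)
    exact ⟨z, hz, hz'.trans_eq (by ring)⟩

/-- A function that is `O(h^k)` at `2^k` points with gaps at least `h`, in an interval of length
`O(h)`, has derivatives of order `i` of size `O(h^{k-i})` there. -/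
theorem exists_abs_deriv_le_of_points (k : ℕ) (B C : ℝ) (hB : 0 ≤ B) (hC : 0 ≤ C) :
    ∃ A, ∀ (h : ℝ), 0 < h → ∀ (a b δ : ℝ), b - a ≤ B * h → δ ≤ h ^ k →
    ∀ (g : ℕ → ℝ → ℝ), (∀ i, ∀ t ∈ Set.Icc a b, HasDerivAt (g i) (g (i + 1) t) t) →
    (∀ t ∈ Set.Icc a b, |g k t| ≤ C) →
    ∀ p : ℕ → ℝ, (∀ j < 2 ^ k, p j ∈ Set.Icc a b) →
      (∀ j, j + 1 < 2 ^ k → p j + h ≤ p (j + 1)) → (∀ j < 2 ^ k, |g 0 (p j)| ≤ δ) →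
      ∀ i ≤ k, ∀ t ∈ Set.Icc a b, |g i t| ≤ A * h ^ (k - i) := by
  -- Descending induction on the order k - m. The bound for one order is integrated, over a length
  -- of at most Bh, from a point where the derivative of the preceding order is small.
  suffices H : ∀ m ≤ k, ∃ A, 0 ≤ A ∧ ∀ (h : ℝ), 0 < h → ∀ (a b δ : ℝ), b - a ≤ B * h → δ ≤ h ^ k →
      ∀ (g : ℕ → ℝ → ℝ), (∀ i, ∀ t ∈ Set.Icc a b, HasDerivAt (g i) (g (i + 1) t) t) →
      (∀ t ∈ Set.Icc a b, |g k t| ≤ C) →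
      ∀ p : ℕ → ℝ, (∀ j < 2 ^ k, p j ∈ Set.Icc a b) →
        (∀ j, j + 1 < 2 ^ k → p j + h ≤ p (j + 1)) → (∀ j < 2 ^ k, |g 0 (p j)| ≤ δ) →
        ∀ t ∈ Set.Icc a b, |g (k - m) t| ≤ A * h ^ m by
    choose! A hA0 hA using H
    refine ⟨∑ m ∈ Finset.range (k + 1), A m, fun h hh a b δ hab hδ g hg hgk p hp hgap hd i hi t ht => ?_⟩
    have h1 := hA (k - i) (by omega) h hh a b δ hab hδ g hg hgk p hp hgap hd t ht
    rw [Nat.sub_sub_self hi] at h1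
    refine h1.trans (mul_le_mul_of_nonneg_right ?_ (by positivity))
    exact Finset.single_le_sum (f := A) (fun m hm => hA0 m (by
      have := Finset.mem_range.1 hm; omega)) (Finset.mem_range.2 (by omega))
  intro m
  induction m with
  | zero =>
    intro _
    exact ⟨C, hC, fun h hh a b δ hab hδ g hg hgk p hp hgap hd t ht => by simpa using hgk t ht⟩
  | succ m ih =>
    intro hm
    obtain ⟨A, hA0, hA⟩ := ih (by omega)
    refine ⟨2 ^ (k - (m + 1)) + B * A, by positivity,
      fun h hh a b δ hab hδ g hg hgk p hp hgap hd t ht => ?_⟩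
    have hle : 2 ^ (k - (m + 1)) ≤ 2 ^ k := Nat.pow_le_pow_right (by norm_num) (by omega)
    obtain ⟨q, hq, hq'⟩ := exists_abs_iterate_deriv_le hh (k - (m + 1)) g hg δ p
      (fun j hj => hp j (by omega)) (fun j hj => hgap j (by omega)) (fun j hj => hd j (by omega))
    have hb : ∀ s ∈ Set.Icc a b, ‖g (k - m) s‖ ≤ A * h ^ m :=
      hA h hh a b δ hab hδ g hg hgk p hp hgap hd
    have hk : k - (m + 1) + 1 = k - m := by omega
    have h1 := (convex_Icc a b).norm_image_sub_le_of_norm_hasDerivWithin_le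
      (f := g (k - (m + 1))) (f' := g (k - m)) (C := A * h ^ m)
      (fun s hs => (hk ▸ hg (k - (m + 1)) s hs).hasDerivWithinAt) hb hq ht
    have h2 : ‖t - q‖ ≤ B * h := by
      rw [Real.norm_eq_abs, abs_le]
      constructor <;> linarith [hq.1, hq.2, ht.1, ht.2]
    have h3 : |g (k - (m + 1)) t| ≤ ‖g (k - (m + 1)) t - g (k - (m + 1)) q‖
        + |g (k - (m + 1)) q| := by
      have := norm_add_le (g (k - (m + 1)) t - g (k - (m + 1)) q) (g (k - (m + 1)) q)
      simpa using this
    have h4 : |g (k - (m + 1)) q| ≤ 2 ^ (k - (m + 1)) * h ^ (m + 1) := by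
      refine hq'.trans ?_
      calc δ * (2 / h) ^ (k - (m + 1)) ≤ h ^ k * (2 / h) ^ (k - (m + 1)) := by gcongr
        _ = h ^ (m + 1) * h ^ (k - (m + 1)) * (2 / h) ^ (k - (m + 1)) := by
          rw [← pow_add]; congr 2; omega
        _ = _ := by rw [mul_assoc, ← mul_pow, mul_div_cancel₀ _ hh.ne']; ring
    calc |g (k - (m + 1)) t| ≤ A * h ^ m * (B * h) + 2 ^ (k - (m + 1)) * h ^ (m + 1) := by
          refine h3.trans (add_le_add (h1.trans ?_) h4)
          gcongr
      _ = _ := by ring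

end Interpolation

/-! ### Time windows around t₀ and their length. -/

section Windows

/-- The first of the intervals `[jh, (j+1)h]` on which `G ≥ δ`. -/
theorem exists_first_interval {G : ℝ → ℝ} {T : ℝ} (hT : 0 < T) (hG : ContinuousOn G (Set.Icc 0 T))
    (hGT : 0 < G T) : ∃ h₀ > 0, ∃ δ₀ > 0, ∀ h, 0 < h → h ≤ h₀ → ∀ δ ≤ δ₀, ∃ j : ℕ,
      (j + 1) * h ≤ T ∧ (∀ u ∈ Set.Icc (j * h) ((j + 1) * h), δ ≤ G u) ∧
      ∀ i < j, ∃ u ∈ Set.Icc (i * h) ((i + 1) * h), G u < δ := by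
  classical
  obtain ⟨r, hr, hr'⟩ := Metric.continuousWithinAt_iff.1 (hG T ⟨hT.le, le_rfl⟩) (G T / 2)
    (by positivity)
  -- The last complete step before T lies within 2h of T, hence in the region where G > G(T)/2. This
  -- shows that the search ends. The bound h ≤ T provides at least one complete step.
  refine ⟨min (r / 3) T, by positivity, G T / 2, by positivity, fun h hh hh0 δ hδ => ?_⟩
  have hex : ∃ j : ℕ, (j + 1) * h ≤ T ∧ ∀ u ∈ Set.Icc (j * h) ((j + 1) * h), δ ≤ G u := by
    have h1 : 1 ≤ ⌊T / h⌋₊ := Nat.le_floor (by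
      rw [Nat.cast_one, le_div_iff₀ hh, one_mul]; exact hh0.trans (min_le_right _ _))
    obtain ⟨j, hj⟩ : ∃ j, ⌊T / h⌋₊ = j + 1 := ⟨⌊T / h⌋₊ - 1, by omega⟩
    have h2 : ((j + 1 : ℕ) : ℝ) ≤ T / h := hj ▸ Nat.floor_le (by positivity)
    have h3 : T / h < ((j + 1 : ℕ) : ℝ) + 1 := hj ▸ Nat.lt_floor_add_one (T / h)
    rw [le_div_iff₀ hh] at h2
    rw [div_lt_iff₀ hh] at h3
    push_cast at h2 h3
    refine ⟨j, h2, fun u hu => ?_⟩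
    have h4 : 3 * h ≤ r := by have := hh0.trans (min_le_left _ _); linarith
    have hu0 : 0 ≤ u := le_trans (by positivity) hu.1
    have hd : dist u T < r := by
      rw [Real.dist_eq, abs_lt]
      constructor <;> nlinarith [hu.1, hu.2]
    have h5 := hr' ⟨hu0, hu.2.trans h2⟩ hd
    rw [Real.dist_eq, abs_lt] at h5
    linarith [h5.1]
  refine ⟨Nat.find hex, (Nat.find_spec hex).1, (Nat.find_spec hex).2, fun i hi => ?_⟩
  have h1 := Nat.find_min hex hi
  push Not at h1
  refine h1 (le_trans ?_ (Nat.find_spec hex).1)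
  have : (i : ℝ) ≤ (Nat.find hex : ℝ) := by exact_mod_cast hi.le
  gcongr

/-- A union of intervals of length `h` around `t₀` which have a point where `F < δ`, bounded on
both sides by intervals of length `h` on which `F ≥ δ`. -/
structure Window (F : ℝ → ℝ) (t₀ t₁ t₂ h δ : ℝ) (jm jp : ℕ) : Prop where
  left : t₁ ≤ t₀ - (jm + 1) * h
  right : t₀ + (jp + 1) * h ≤ t₂
  le_left : ∀ t ∈ Set.Icc (t₀ - (jm + 1) * h) (t₀ - jm * h), δ ≤ F t
  le_right : ∀ t ∈ Set.Icc (t₀ + jp * h) (t₀ + (jp + 1) * h), δ ≤ F t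
  inner : ∀ i : ℤ, -(jm : ℤ) ≤ i → i < jp → ∃ p ∈ Set.Icc (t₀ + i * h) (t₀ + (i + 1) * h), F p < δ

theorem exists_window {F : ℝ → ℝ} {t₀ t₁ t₂ : ℝ} (ht : t₀ ∈ Set.Ioo t₁ t₂)
    (hF : ContinuousOn F (Set.Icc t₁ t₂)) (h1 : 0 < F t₁) (h2 : 0 < F t₂) :
    ∃ h₀ > 0, ∃ δ₀ > 0, ∀ h, 0 < h → h ≤ h₀ → ∀ δ ≤ δ₀, ∃ jm jp, Window F t₀ t₁ t₂ h δ jm jp := by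
  obtain ⟨a, ha, b, hb, H⟩ := exists_first_interval (G := fun u => F (t₀ + u)) (T := t₂ - t₀)
    (by linarith [ht.2]) (hF.comp (by fun_prop) fun u hu =>
      ⟨by linarith [ht.1, hu.1], by linarith [hu.2]⟩) (by simpa using h2)
  obtain ⟨a', ha', b', hb', H'⟩ := exists_first_interval (G := fun u => F (t₀ - u)) (T := t₀ - t₁)
    (by linarith [ht.1]) (hF.comp (by fun_prop) fun u hu =>
      ⟨by linarith [hu.2], by linarith [ht.2, hu.1]⟩) (by simpa using h1)
  refine ⟨min a a', lt_min ha ha', min b b', lt_min hb hb', fun h hh hh0 δ hδ => ?_⟩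
  obtain ⟨jp, p1, p2, p3⟩ := H h hh (hh0.trans (min_le_left _ _)) δ (hδ.trans (min_le_left _ _))
  obtain ⟨jm, m1, m2, m3⟩ := H' h hh (hh0.trans (min_le_right _ _)) δ (hδ.trans (min_le_right _ _))
  refine ⟨jm, jp, by linarith, by linarith, fun t ht => ?_, fun t ht => ?_, fun i hi1 hi2 => ?_⟩
  · have := m2 (t₀ - t) ⟨by linarith [ht.2], by linarith [ht.1]⟩
    simpa using this
  · have := p2 (t - t₀) ⟨by linarith [ht.1], by linarith [ht.2]⟩
    simpa using this
  · rcases lt_or_ge i 0 with hi | hi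
    · obtain ⟨m, rfl⟩ : ∃ m : ℕ, i = -(m + 1) := ⟨(-i - 1).toNat, by omega⟩
      obtain ⟨u, hu, hu'⟩ := m3 m (by omega)
      refine ⟨t₀ - u, ⟨?_, ?_⟩, hu'⟩ <;> push_cast <;> nlinarith [hu.1, hu.2]
    · obtain ⟨m, rfl⟩ : ∃ m : ℕ, i = m := ⟨i.toNat, by omega⟩
      obtain ⟨u, hu, hu'⟩ := p3 m (by omega)
      refine ⟨t₀ + u, ⟨?_, ?_⟩, hu'⟩ <;> push_cast <;> linarith [hu.1, hu.2]

variable {F : ℝ → ℝ} {t₀ t₁ t₂ h δ : ℝ} {jm jp : ℕ}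

theorem Window.exists_points (hW : Window F t₀ t₁ t₂ h δ jm jp) (hh : 0 < h)
    (hF : ∀ t ∈ Set.Icc t₁ t₂, 0 ≤ F t) {k : ℕ} {b : ℤ} (hb : -(jm : ℤ) ≤ b)
    (hb' : b + 2 * 2 ^ k ≤ jp) :
    ∃ p : ℕ → ℝ, (∀ j < 2 ^ k, p j ∈ Set.Icc (t₀ + b * h) (t₀ + (b + 2 * 2 ^ k) * h)) ∧
      (∀ j, j + 1 < 2 ^ k → p j + h ≤ p (j + 1)) ∧ ∀ j < 2 ^ k, |F (p j)| ≤ δ := by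
  -- One point is taken from every second step; the skipped steps provide the gaps.
  have H : ∀ j : ℕ, ∃ p, j < 2 ^ k →
      p ∈ Set.Icc (t₀ + (b + 2 * j : ℤ) * h) (t₀ + ((b + 2 * j : ℤ) + 1) * h) ∧ F p < δ := by
    intro j
    by_cases hj : j < 2 ^ k
    · have hj' : (j : ℤ) < 2 ^ k := by exact_mod_cast hj
      obtain ⟨p, hp, hp'⟩ := hW.inner (b + 2 * j) (by omega) (by linarith)
      exact ⟨p, fun _ => ⟨hp, hp'⟩⟩
    · exact ⟨0, fun h => absurd h hj⟩
  choose p hp using H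
  have hbR : -(jm : ℝ) ≤ b := by exact_mod_cast hb
  have hbR' : (b : ℝ) + 2 * 2 ^ k ≤ jp := by exact_mod_cast hb'
  have hmem : ∀ j < 2 ^ k, p j ∈ Set.Icc (t₀ + b * h) (t₀ + (b + 2 * 2 ^ k) * h) := by
    intro j hj
    obtain ⟨h1, h2⟩ := (hp j hj).1
    have hj' : (j : ℝ) + 1 ≤ 2 ^ k := by exact_mod_cast hj
    push_cast at h1 h2
    have hj0 : (0 : ℝ) ≤ j := Nat.cast_nonneg j
    constructor <;> nlinarith
  refine ⟨p, hmem, fun j hj => ?_, fun j hj => ?_⟩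
  · have h1 := (hp j (by omega)).1.2
    have h2 := (hp (j + 1) hj).1.1
    push_cast at h1 h2
    linarith
  · have h1 := hmem j hj
    have h2 := hW.left
    have h3 := hW.right
    rw [abs_of_nonneg (hF _ ⟨by nlinarith [h1.1], by nlinarith [h1.2]⟩)]
    exact (hp j hj).2.le

/-- If the window is long, then the derivative is small on it. -/
theorem exists_abs_deriv_le_of_window {g : ℕ → ℝ → ℝ} (k : ℕ) (hk : 1 ≤ k)
    (hg : ∀ i, ∀ t ∈ Set.Icc t₁ t₂, HasDerivAt (g i) (g (i + 1) t) t)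
    (hF : ∀ t ∈ Set.Icc t₁ t₂, 0 ≤ g 0 t) :
    ∃ A, ∀ h, 0 < h → ∀ δ ≤ h ^ k, ∀ jm jp, Window (g 0) t₀ t₁ t₂ h δ jm jp →
      2 * 2 ^ k ≤ jm + jp → ∀ t ∈ Set.Icc (t₀ - (jm + 1) * h) (t₀ + (jp + 1) * h),
        |g 1 t| ≤ A * h ^ (k - 1) := by
  obtain ⟨C, hC⟩ := isCompact_Icc.exists_bound_of_continuousOn (f := g k) (s := Set.Icc t₁ t₂)
    fun t ht => (hg k t ht).continuousAt.continuousWithinAt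
  obtain ⟨A, hA⟩ := exists_abs_deriv_le_of_points k (2 * 2 ^ k + 2) |C| (by positivity)
    (abs_nonneg C)
  refine ⟨A, fun h hh δ hδ jm jp hW hj t ht => ?_⟩
  -- A block of 2·2^k inner steps that comes within one step of t. The extra step at each end covers
  -- the two bounding steps, which need not contain points where the function is small.
  obtain ⟨b, hb1, hb2, hb3, hb4⟩ : ∃ b : ℤ, -(jm : ℤ) ≤ b ∧ b + 2 * 2 ^ k ≤ jp ∧
      t₀ + ((b : ℝ) - 1) * h ≤ t ∧ t ≤ t₀ + ((b : ℝ) + 2 * 2 ^ k + 1) * h := by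
    set i := ⌊(t - t₀) / h⌋ with hi
    have h1 : (i : ℝ) * h ≤ t - t₀ := by
      rw [← le_div_iff₀ hh]; exact Int.floor_le _
    have h2 : t - t₀ < (i + 1) * h := by
      rw [← div_lt_iff₀ hh]; exact Int.lt_floor_add_one _
    have hj' : (2 * 2 ^ k : ℤ) ≤ jm + jp := by exact_mod_cast hj
    have hpos : (0 : ℝ) < 2 ^ k := by positivity
    rcases lt_or_ge i (-jm) with h3 | h3
    · have h3' : (i : ℝ) + 1 ≤ -jm := by exact_mod_cast h3
      refine ⟨-jm, le_rfl, by linarith, ?_, ?_⟩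
      · push_cast; linarith [ht.1]
      · push_cast; nlinarith
    · rcases le_or_gt (i + 2 * 2 ^ k) jp with h4 | h4
      · exact ⟨i, h3, h4, by nlinarith, by nlinarith⟩
      · have h4' : (jp : ℝ) < i + 2 * 2 ^ k := by exact_mod_cast h4
        refine ⟨jp - 2 * 2 ^ k, by linarith, by linarith, ?_, ?_⟩
        · push_cast; nlinarith
        · push_cast; linarith [ht.2]
  obtain ⟨p, hp1, hp2, hp3⟩ := hW.exists_points hh hF hb1 hb2
  have hbR : -(jm : ℝ) ≤ b := by exact_mod_cast hb1
  have hbR' : (b : ℝ) + 2 * 2 ^ k ≤ jp := by exact_mod_cast hb2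
  have hsub : Set.Icc (t₀ + ((b : ℝ) - 1) * h) (t₀ + ((b : ℝ) + 2 * 2 ^ k + 1) * h)
      ⊆ Set.Icc t₁ t₂ := Set.Icc_subset_Icc
    (hW.left.trans (by nlinarith)) (le_trans (by nlinarith) hW.right)
  refine hA h hh _ _ δ (by linarith) hδ g (fun i s hs => hg i s (hsub hs))
    (fun s hs => (hC s (hsub hs)).trans (le_abs_self C)) p (fun j hj => ?_) hp2 hp3 1 hk t
    ⟨hb3, hb4⟩
  exact Set.Icc_subset_Icc (by nlinarith) (by nlinarith) (hp1 j hj)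

/-- If some derivative does not vanish at `t₀`, then the window is short. -/
theorem exists_window_le {g : ℕ → ℝ → ℝ} (k : ℕ) (ht : t₀ ∈ Set.Icc t₁ t₂) (hk : g k t₀ ≠ 0)
    (hg : ∀ i, ∀ t ∈ Set.Icc t₁ t₂, HasDerivAt (g i) (g (i + 1) t) t)
    (hF : ∀ t ∈ Set.Icc t₁ t₂, 0 ≤ g 0 t) :
    ∃ h₀ > 0, ∀ h, 0 < h → h ≤ h₀ → ∀ δ ≤ h ^ (k + 1), ∀ jm jp,
      Window (g 0) t₀ t₁ t₂ h δ jm jp → jm < 2 * 2 ^ k ∧ jp < 2 * 2 ^ k := by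
  have hpos : 0 < |g k t₀| := abs_pos.2 hk
  obtain ⟨r, hr, hr'⟩ := Metric.continuousAt_iff.1 (hg k t₀ ht).continuousAt (|g k t₀| / 2)
    (by positivity)
  have h2k : (0 : ℝ) < 2 ^ k := by positivity
  -- The first bound keeps a block of 2·2^k steps that touches t₀ in the region where g k stays
  -- within half of |g k t₀| of its value at t₀. The second one makes the interpolation bound 2^k h
  -- at most a quarter of |g k t₀|, a contradiction.
  refine ⟨min (r / (4 * 2 ^ k)) (|g k t₀| / (4 * 2 ^ k)), by positivity,
    fun h hh hh0 δ hδ jm jp hW => ?_⟩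
  have hh1 : h * (4 * 2 ^ k) ≤ r := by
    rw [← le_div_iff₀ (by positivity)]; exact hh0.trans (min_le_left _ _)
  have hh2 : h * (4 * 2 ^ k) ≤ |g k t₀| := by
    rw [← le_div_iff₀ (by positivity)]; exact hh0.trans (min_le_right _ _)
  have key : ∀ b : ℤ, -(jm : ℤ) ≤ b → b + 2 * 2 ^ k ≤ jp → b ≤ 0 → -(2 * 2 ^ k) ≤ b → False := by
    intro b hb1 hb2 hb3 hb4
    obtain ⟨p, hp1, hp2, hp3⟩ := hW.exists_points hh hF hb1 hb2
    have hbR : -(jm : ℝ) ≤ b := by exact_mod_cast hb1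
    have hbR' : (b : ℝ) + 2 * 2 ^ k ≤ jp := by exact_mod_cast hb2
    have hb3R : (b : ℝ) ≤ 0 := by exact_mod_cast hb3
    have hb4R : -(2 * 2 ^ k : ℝ) ≤ b := by exact_mod_cast hb4
    have hsub : Set.Icc (t₀ + (b : ℝ) * h) (t₀ + ((b : ℝ) + 2 * 2 ^ k) * h)
        ⊆ Set.Icc t₁ t₂ := Set.Icc_subset_Icc
      (hW.left.trans (by nlinarith)) (le_trans (by nlinarith) hW.right)
    obtain ⟨q, hq, hq'⟩ := exists_abs_iterate_deriv_le hh k g (fun i s hs => hg i s (hsub hs)) δ p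
      hp1 hp2 hp3
    have h1 : dist q t₀ < r := by
      rw [Real.dist_eq, abs_lt]
      constructor <;> nlinarith [hq.1, hq.2, mul_pos hh h2k, mul_le_mul_of_nonneg_right hb4R hh.le,
        mul_le_mul_of_nonneg_right hb3R hh.le]
    have h2 := hr' h1
    have h3 : |g k q| ≤ 2 ^ k * h := by
      refine hq'.trans ?_
      calc δ * (2 / h) ^ k ≤ h ^ (k + 1) * (2 / h) ^ k := by gcongr
        _ = (h * (2 / h)) ^ k * h := by rw [mul_pow]; ring
        _ = _ := by rw [mul_div_cancel₀ _ hh.ne']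
    rw [Real.dist_eq] at h2
    have h4 := abs_sub_abs_le_abs_sub (g k t₀) (g k q)
    rw [abs_sub_comm] at h4
    linarith
  constructor
  · by_contra hcon
    push Not at hcon
    have : (2 * 2 ^ k : ℤ) ≤ jm := by exact_mod_cast hcon
    have h0 : (0 : ℤ) < 2 ^ k := by positivity
    exact key (-(2 * 2 ^ k)) (by linarith) (by linarith [Int.natCast_nonneg jp]) (by linarith) le_rfl
  · by_contra hcon
    push Not at hcon
    have : (2 * 2 ^ k : ℤ) ≤ jp := by exact_mod_cast hcon
    have h0 : (0 : ℤ) < 2 ^ k := by positivity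
    exact key 0 (by linarith [Int.natCast_nonneg jm]) (by linarith) le_rfl (by linarith)

end Windows

end Transport

namespace Transport

/-! ### The dichotomy for windows, and the cut-offs in time. -/

section Cutoffs

variable {n d : ℕ} {S : Symbols n d} {P : Phase n} {y₀ : Fin d → ℝ} {J : Set ℝ} {L r : ℕ}
  {t₀ t₁ t₂ : ℝ}

theorem Sm.hasDerivAt_iteratedDeriv {G : ℝ → ℝ} {t : ℝ} (hG : Sm G t) (i : ℕ) :
    HasDerivAt (_root_.iteratedDeriv i G) (_root_.iteratedDeriv (i + 1) G t) t := by
  have h : Sm (_root_.iteratedDeriv i G) t := by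
    induction i with
    | zero => simpa [iteratedDeriv_zero] using hG
    | succ i ih =>
      rw [iteratedDeriv_succ]
      exact ih.fderiv_apply 1
  rw [iteratedDeriv_succ]
  exact h.differentiableAt.hasDerivAt

/-- Either the window is short, or the coefficients with `β = 0` are small on it. -/
theorem exists_window_dichotomy (hP : IsPhase S P L r t₁ t₂) (hr : 2 ≤ r) (h : SmoothPhase P J)
    (hJ : Set.Icc t₁ t₂ ⊆ J) (hS : SmoothSymbols S P y₀ t₁ t₂) (ht₀ : t₀ ∈ Set.Ioo t₁ t₂)
    (hcond : (∀ k : ℕ, iteratedDeriv k (fcurve S P) t₀ = 0) → GradBound S P y₀ t₁ t₂) :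
    ∃ (p : ℕ) (A η h₀ : ℝ), 0 < η ∧ 0 < h₀ ∧ ∀ h, 0 < h → h ≤ h₀ → ∀ δ ≤ h ^ p, ∀ jm jp : ℕ,
      Window (fun t => (P.w0 t).im) t₀ t₁ t₂ h δ jm jp → (jm + jp + 1 : ℝ) ≤ A ∨
      ∀ t ∈ Set.Icc (t₀ - (jm + 1) * h) (t₀ + (jp + 1) * h), ∀ y : Fin d → ℝ, ‖y‖ ≤ η →
        (∀ j, ‖coefA0 S P L 0 j t‖ ≤ A * h ^ 4) ∧ (∀ j, ‖coefA1 S P y₀ L 0 j t y‖ ≤ A * h ^ 4) ∧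
        ∀ j l, ‖coefA2 S P y₀ L 0 j l t y‖ ≤ A * h ^ 4 := by
  have ht : t₁ ≤ t₂ := (ht₀.1.trans ht₀.2).le
  set G : ℝ → ℝ := fun t => (P.w0 t).im with hGdef
  have hsm : ∀ t ∈ Set.Icc t₁ t₂, Sm G t := fun t ht =>
    Sm.comp_contDiff (φ := Complex.im) Complex.imCLM.contDiff (h.sm_w0 (hJ ht))
  have hg : ∀ i, ∀ t ∈ Set.Icc t₁ t₂,
      HasDerivAt (iteratedDeriv i G) (iteratedDeriv (i + 1) G t) t :=
    fun i t ht => (hsm t ht).hasDerivAt_iteratedDeriv i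
  have hg0 : iteratedDeriv 0 G = G := iteratedDeriv_zero
  have hG0 : ∀ t ∈ Set.Icc t₁ t₂, 0 ≤ iteratedDeriv 0 G t := fun t ht => by
    rw [hg0]; exact hP.im_w0_nonneg t ht
  have hd : ∀ t ∈ Set.Icc t₁ t₂, deriv G t = -fcurve S P t := fun t ht =>
    (hP.hasDerivAt_im_w0 hr h hJ ht).deriv
  by_cases hinf : ∀ k : ℕ, iteratedDeriv k (fcurve S P) t₀ = 0
  · obtain ⟨C, ε, η, hC, hε, hη, hb⟩ := (hcond hinf).exists_coef_le ht hP hr h hJ hS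
    -- Both k - 1 and (k - 1)ε are at least 4, so |f| = O(h^{k-1}) makes |f| and |f|^ε of size
    -- O(h⁴).
    set k := 5 + ⌈4 / ε⌉₊ with hk
    obtain ⟨A, hA⟩ := exists_abs_deriv_le_of_window (t₀ := t₀) k (by omega) hg hG0
    have hkε : 4 ≤ ((k - 1 : ℕ) : ℝ) * ε := by
      rw [← div_le_iff₀ hε]
      refine (Nat.le_ceil _).trans ?_
      exact_mod_cast (by omega : ⌈4 / ε⌉₊ ≤ k - 1)
    refine ⟨k, max (2 * 2 ^ k + 1) (C * (|A| ^ ε + |A|)), η, 1, hη, one_pos,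
      fun h hh hh1 δ hδ jm jp hW => ?_⟩
    rcases lt_or_ge (jm + jp) (2 * 2 ^ k) with hj | hj
    · left
      refine le_trans ?_ (le_max_left _ _)
      have : ((jm + jp : ℕ) : ℝ) ≤ ((2 * 2 ^ k : ℕ) : ℝ) := by exact_mod_cast hj.le
      push_cast at this
      linarith
    · right
      intro t ht y hy
      have htt : t ∈ Set.Icc t₁ t₂ := ⟨hW.left.trans ht.1, ht.2.trans hW.right⟩
      have h1 := hA h hh δ hδ jm jp (by rw [hg0]; exact hW) hj t ht
      rw [iteratedDeriv_one, hd t htt, abs_neg] at h1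
      replace h1 : |fcurve S P t| ≤ |A| * h ^ (k - 1) :=
        h1.trans (mul_le_mul_of_nonneg_right (le_abs_self A) (by positivity))
      have h2 : |fcurve S P t| ≤ |A| * h ^ 4 := h1.trans
        (mul_le_mul_of_nonneg_left (pow_le_pow_of_le_one hh.le hh1 (by omega)) (abs_nonneg A))
      have h3 : |fcurve S P t| ^ ε ≤ |A| ^ ε * h ^ 4 := by
        refine (Real.rpow_le_rpow (abs_nonneg _) h1 hε.le).trans ?_
        rw [Real.mul_rpow (abs_nonneg A) (by positivity), ← Real.rpow_natCast_mul hh.le]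
        refine mul_le_mul_of_nonneg_left ?_ (Real.rpow_nonneg (abs_nonneg A) _)
        rw [← Real.rpow_natCast h 4]
        exact Real.rpow_le_rpow_of_exponent_ge hh hh1 (by exact_mod_cast hkε)
      have h4 : C * (|fcurve S P t| ^ ε + |fcurve S P t|)
          ≤ max (2 * 2 ^ k + 1) (C * (|A| ^ ε + |A|)) * h ^ 4 := by
        calc _ ≤ C * (|A| ^ ε * h ^ 4 + |A| * h ^ 4) := by gcongr
          _ = C * (|A| ^ ε + |A|) * h ^ 4 := by ring
          _ ≤ _ := mul_le_mul_of_nonneg_right (le_max_right _ _) (by positivity)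
      obtain ⟨b0, b1, b2⟩ := hb t htt y hy
      exact ⟨fun j => (b0 j).trans h4, fun j => (b1 j).trans h4, fun j l => (b2 j l).trans h4⟩
  · push Not at hinf
    obtain ⟨k, hk⟩ := hinf
    -- The relation G' = -f is known on [t₁, t₂] only, but t₀ is an interior point.
    have hk' : iteratedDeriv (k + 1) G t₀ ≠ 0 := by
      have he : deriv G =ᶠ[𝓝 t₀] -fcurve S P := by
        filter_upwards [Icc_mem_nhds ht₀.1 ht₀.2] with t ht
        simpa using hd t ht
      rw [iteratedDeriv_succ', he.iteratedDeriv_eq k, iteratedDeriv_neg]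
      exact neg_ne_zero.2 hk
    obtain ⟨h₀, hh₀, H⟩ := exists_window_le (k + 1) (Set.Ioo_subset_Icc_self ht₀) hk' hg hG0
    refine ⟨k + 1 + 1, 4 * 2 ^ (k + 1), 1, h₀, one_pos, hh₀, fun h hh hh0 δ hδ jm jp hW => ?_⟩
    left
    obtain ⟨h1, h2⟩ := H h hh hh0 δ hδ jm jp (by rw [hg0]; exact hW)
    have : ((jm + jp + 1 : ℕ) : ℝ) ≤ ((4 * 2 ^ (k + 1) : ℕ) : ℝ) := by
      exact_mod_cast (by omega)
    push_cast at this
    exact this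

/-- A smooth step from `0` on `(-∞, 0]` to `1` on `[1/3, ∞)`. -/
noncomputable def smoothStep (x : ℝ) : ℝ := Real.smoothTransition (3 * x)

theorem smoothStep_eq_zero {x : ℝ} (hx : x ≤ 0) : smoothStep x = 0 :=
  Real.smoothTransition.zero_of_nonpos (by linarith)

theorem smoothStep_eq_one {x : ℝ} (hx : 1 / 3 ≤ x) : smoothStep x = 1 :=
  Real.smoothTransition.one_of_one_le (by linarith)

theorem UB.smoothStep {ι : Type*} : UB (fun _ : ι => Transport.smoothStep) := by
  have h1 : ContDiff ℝ ∞ Transport.smoothStep :=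
    Real.smoothTransition.contDiff.comp (contDiff_const.mul contDiff_id)
  refine UB.of_bounded_of_fderiv h1 (C := 1) (fun x => ?_)
    (HasCompactSupport.intro (K := Set.Icc 0 (1 / 3)) isCompact_Icc fun x hx => ?_)
  · rw [Transport.smoothStep, Real.norm_eq_abs, abs_of_nonneg (Real.smoothTransition.nonneg _)]
    exact Real.smoothTransition.le_one _
  · rcases lt_or_ge x 0 with h0 | h0
    · have : Transport.smoothStep =ᶠ[𝓝 x] fun _ => 0 := by
        filter_upwards [Iio_mem_nhds h0] with z hz using smoothStep_eq_zero (le_of_lt hz)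
      rw [this.fderiv_eq]
      simp
    · have h2 : 1 / 3 < x := by
        by_contra h3
        exact hx ⟨h0, not_lt.1 h3⟩
      have : Transport.smoothStep =ᶠ[𝓝 x] fun _ => 1 := by
        filter_upwards [Ioi_mem_nhds h2] with z hz using smoothStep_eq_one (le_of_lt hz)
      rw [this.fderiv_eq]
      simp

/-- A smooth cut-off to a window. -/
noncomputable def windowCutoff (jm jp : ℕ) (s : ℝ) : ℝ :=
  smoothStep (jm + 2 / 3 + s) * smoothStep (jp + 2 / 3 - s)

/-- Only the position of the two slopes depends on the window, not their steepness, so the bounds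
hold for windows of any length. -/
theorem UB.windowCutoff {ι : Type*} (jm jp : ι → ℕ) :
    UB (fun i => Transport.windowCutoff (jm i) (jp i)) := by
  have h1 := (UB.smoothStep (ι := ι)).comp_affine (fun i => (jm i : ℝ) + 2 / 3)
    (fun _ => ContinuousLinearMap.id ℝ ℝ) (fun _ => ContinuousLinearMap.norm_id_le)
  have h2 := (UB.smoothStep (ι := ι)).comp_affine (fun i => (jp i : ℝ) + 2 / 3)
    (fun _ => -ContinuousLinearMap.id ℝ ℝ) (fun _ => by
      rw [norm_neg]; exact ContinuousLinearMap.norm_id_le)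
  refine (UB.bilin (ContinuousLinearMap.mul ℝ ℝ) h1 h2).congr fun i s => ?_
  simp [Transport.windowCutoff, sub_eq_add_neg]

theorem windowCutoff_ne_zero {jm jp : ℕ} {s : ℝ} (h : windowCutoff jm jp s ≠ 0) :
    -(jm + 2 / 3 : ℝ) < s ∧ s < jp + 2 / 3 := by
  constructor
  · by_contra hc
    exact h (by rw [windowCutoff, smoothStep_eq_zero (by linarith), zero_mul])
  · by_contra hc
    exact h (by rw [windowCutoff, smoothStep_eq_zero (x := jp + 2 / 3 - s) (by linarith), mul_zero])

theorem windowCutoff_eq_one {jm jp : ℕ} {s : ℝ} (h1 : -(jm + 1 / 3 : ℝ) ≤ s)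
    (h2 : s ≤ jp + 1 / 3) : windowCutoff jm jp s = 1 := by
  rw [windowCutoff, smoothStep_eq_one (by linarith), smoothStep_eq_one (by linarith), mul_one]

/-- A family of cut-offs `χ` in the scaled time variable `s = ϱ³(t - t₀)`, with support in
`[t₁, t₂]` and in `|s| ≤ ℓ`. -/
structure IsCutoff {ι : Type*} (t₀ t₁ t₂ : ℝ) (ϱ ℓ : ι → ℝ) (χ : ι → ℝ → ℝ) : Prop where
  ub : UB χ
  one : ∀ i, χ i 0 = 1
  length_pos : ∀ i, 0 < ℓ i
  length_le : ∃ C, ∀ i, ℓ i ≤ C * ϱ i ^ 3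
  abs_le : ∀ i s, χ i s ≠ 0 → |s| ≤ ℓ i
  mem : ∀ i s, χ i s ≠ 0 → t₀ + s / ϱ i ^ 3 ∈ Set.Icc t₁ t₂

/-- The cut-offs adapted to the sublevel sets `λ Im w₀ < λ^{1/2}`, where `λ = ϱ^N`. -/
theorem exists_cutoff_family (hP : IsPhase S P L r t₁ t₂) (hr : 2 ≤ r) (h : SmoothPhase P J)
    (hJ : Set.Icc t₁ t₂ ⊆ J) (hS : SmoothSymbols S P y₀ t₁ t₂) (ht₀ : t₀ ∈ Set.Ioo t₁ t₂)
    (hcond : (∀ k : ℕ, iteratedDeriv k (fcurve S P) t₀ = 0) → GradBound S P y₀ t₁ t₂) :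
    ∃ η > 0, ∃ N₀ : ℕ, 10 ≤ N₀ ∧ ∀ N, N₀ ≤ N → ∀ R₀ : ℝ, ∃ lam₀ : ℝ, 1 ≤ lam₀ ∧
    ∀ ϱ : {lam : ℝ // lam₀ ≤ lam} → ℝ, (∀ i, ϱ i = (i : ℝ) ^ (1 / (N : ℝ))) →
    (∀ i, 1 ≤ ϱ i ∧ R₀ ≤ ϱ i) ∧
    ∃ (ℓ : {lam : ℝ // lam₀ ≤ lam} → ℝ) (χ : {lam : ℝ // lam₀ ≤ lam} → ℝ → ℝ),
      IsCutoff t₀ t₁ t₂ ϱ ℓ χ ∧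
      (∀ i : {lam : ℝ // lam₀ ≤ lam}, ∀ t ∈ Set.Icc t₁ t₂, (i : ℝ) * (P.w0 t).im < (i : ℝ) ^ (1 / 2 : ℝ) →
        (∀ᶠ s in 𝓝 (ϱ i ^ 3 * (t - t₀)), χ i s = 1) ∨
        ∀ᶠ s in 𝓝 (ϱ i ^ 3 * (t - t₀)), χ i s = 0) ∧
      ∃ A : ℝ, ∀ i, ℓ i ≤ A ∨ ∀ s, χ i s ≠ 0 → ∀ y : Fin d → ℝ, ‖y‖ ≤ η →
        (∀ j, ‖coefA0 S P L 0 j (t₀ + s / ϱ i ^ 3)‖ ≤ A * (ϱ i)⁻¹ ^ 12) ∧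
        (∀ j, ‖coefA1 S P y₀ L 0 j (t₀ + s / ϱ i ^ 3) y‖ ≤ A * (ϱ i)⁻¹ ^ 12) ∧
        ∀ j l, ‖coefA2 S P y₀ L 0 j l (t₀ + s / ϱ i ^ 3) y‖ ≤ A * (ϱ i)⁻¹ ^ 12 := by
  obtain ⟨p, A, η, h₀, hη, hh₀, hdich⟩ := exists_window_dichotomy hP hr h hJ hS ht₀ hcond
  obtain ⟨h₁, hh₁, δ₁, hδ₁, hwin⟩ := exists_window (F := fun t => (P.w0 t).im) ht₀
    (fun t ht => ((Complex.continuous_im.continuousAt.comp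
      (h.sm_w0 (hJ ht)).contDiffAt.continuousAt)).continuousWithinAt)
    hP.im_w0_left hP.im_w0_right
  -- With N ≥ 6p the threshold satisfies λ^{-1/2} = ϱ^{-N/2} ≤ ϱ^{-3p} = h^p.
  refine ⟨η, hη, max 10 (6 * p), le_max_left _ _, fun N hN R₀ => ?_⟩
  have hN10 : 10 ≤ N := (le_max_left _ _).trans hN
  have hNp : 6 * p ≤ N := (le_max_right _ _).trans hN
  -- A lower bound for ϱ that makes the step ϱ⁻³ and the threshold λ^{-1/2} at most R⁻¹, hence
  -- admissible for the window lemmas. It is ensured by λ₀ = R^N.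
  set R : ℝ := max 1 (max R₀ (max h₀⁻¹ (max h₁⁻¹ δ₁⁻¹))) with hR
  have hR1 : 1 ≤ R := le_max_left _ _
  have hRR : R₀ ≤ R := (le_max_left _ _).trans (le_max_right _ _)
  have hRh0 : h₀⁻¹ ≤ R := (le_max_left _ _).trans ((le_max_right _ _).trans (le_max_right _ _))
  have hRh1 : h₁⁻¹ ≤ R := (le_max_left _ _).trans ((le_max_right _ _).trans
    ((le_max_right _ _).trans (le_max_right _ _)))
  have hRδ : δ₁⁻¹ ≤ R := (le_max_right _ _).trans ((le_max_right _ _).trans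
    ((le_max_right _ _).trans (le_max_right _ _)))
  refine ⟨R ^ N, one_le_pow₀ hR1, fun ϱ hϱ => ?_⟩
  have hpos : ∀ i : {lam : ℝ // R ^ N ≤ lam}, 0 < (i : ℝ) := fun i =>
    lt_of_lt_of_le (by positivity) i.2
  have hϱN : ∀ i, ϱ i ^ N = i := fun i => by
    rw [hϱ, one_div, Real.rpow_inv_natCast_pow (hpos i).le (by omega)]
  have hRϱ : ∀ i, R ≤ ϱ i := fun i => by
    have h1 := Real.rpow_le_rpow (by positivity) i.2 (by positivity : 0 ≤ 1 / (N : ℝ))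
    rw [one_div, Real.pow_rpow_inv_natCast (by positivity) (by omega)] at h1
    rwa [hϱ, one_div]
  have hϱ1 : ∀ i, 1 ≤ ϱ i := fun i => hR1.trans (hRϱ i)
  have hϱ0 : ∀ i, 0 < ϱ i := fun i => one_pos.trans_le (hϱ1 i)
  refine ⟨fun i => ⟨hϱ1 i, hRR.trans (hRϱ i)⟩, ?_⟩
  -- the step and the threshold
  set st : {lam : ℝ // R ^ N ≤ lam} → ℝ := fun i => (ϱ i ^ 3)⁻¹ with hst
  set th : {lam : ℝ // R ^ N ≤ lam} → ℝ := fun i => (Real.sqrt i)⁻¹ with hth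
  have hst0 : ∀ i, 0 < st i := fun i => by have := hϱ0 i; positivity
  have hstR : ∀ i, st i ≤ R⁻¹ := fun i => by
    refine inv_anti₀ (by positivity) ((hRϱ i).trans ?_)
    exact le_self_pow₀ (hϱ1 i) (by norm_num)
  have hthR : ∀ i, th i ≤ R⁻¹ := fun i => by
    refine inv_anti₀ (by positivity) (Real.le_sqrt_of_sq_le ?_)
    refine le_trans ?_ i.2
    exact pow_le_pow_right₀ hR1 (by omega)
  have hinv : ∀ {x : ℝ}, 0 < x → x⁻¹ ≤ R → R⁻¹ ≤ x := fun hx h => by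
    rw [inv_le_comm₀ (by positivity) hx]; exact h
  have hthp : ∀ i, th i ≤ st i ^ p := fun i => by
    rw [hth, hst]
    simp only
    rw [inv_pow, ← pow_mul]
    refine inv_anti₀ (pow_pos (hϱ0 i) _) (Real.le_sqrt_of_sq_le ?_)
    rw [← pow_mul, ← hϱN i]
    exact pow_le_pow_right₀ (hϱ1 i) (by omega)
  choose jm jp hW using fun i => hwin (st i) (hst0 i) ((hstR i).trans (hinv hh₁ hRh1)) (th i)
    ((hthR i).trans (hinv hδ₁ hRδ))
  have hmem : ∀ i s, windowCutoff (jm i) (jp i) s ≠ 0 → t₀ + s / ϱ i ^ 3 ∈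
      Set.Icc (t₀ - (jm i + 1) * st i) (t₀ + (jp i + 1) * st i) := fun i s hs => by
    obtain ⟨h1, h2⟩ := windowCutoff_ne_zero hs
    rw [div_eq_mul_inv]
    constructor <;> nlinarith [hst0 i]
  -- In the variable s each step has length 1, so ℓ essentially counts steps.
  refine ⟨fun i => jm i + jp i + 1, fun i => windowCutoff (jm i) (jp i),
    ⟨UB.windowCutoff jm jp, fun i => ?_, fun i => by positivity, ⟨t₂ - t₁, fun i => ?_⟩,
      fun i s hs => ?_, fun i s hs => ?_⟩, fun i t ht hlt => ?_, A, fun i => ?_⟩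
  · exact windowCutoff_eq_one (by linarith [(Nat.cast_nonneg (jm i) : (0 : ℝ) ≤ jm i)])
      (by linarith [(Nat.cast_nonneg (jp i) : (0 : ℝ) ≤ jp i)])
  · have h1 := (hW i).left
    have h2 := (hW i).right
    have h3 : (jm i + jp i + 1) * st i ≤ t₂ - t₁ := by nlinarith [hst0 i]
    rwa [hst, ← div_eq_mul_inv, div_le_iff₀ (pow_pos (hϱ0 i) 3)] at h3
  · obtain ⟨h1, h2⟩ := windowCutoff_ne_zero hs
    rw [abs_le]
    constructor <;> linarith [(Nat.cast_nonneg (jm i) : (0 : ℝ) ≤ jm i),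
      (Nat.cast_nonneg (jp i) : (0 : ℝ) ≤ jp i)]
  · exact ⟨(hW i).left.trans (hmem i s hs).1, (hmem i s hs).2.trans (hW i).right⟩
  · have hlt' : (P.w0 t).im < th i := by
      have h1 : (i : ℝ) * th i = (i : ℝ) ^ (1 / 2 : ℝ) := by
        rw [← Real.sqrt_eq_rpow, hth]
        simp only
        rw [← div_eq_mul_inv, Real.div_sqrt]
      rw [← h1] at hlt
      exact lt_of_mul_lt_mul_left hlt (hpos i).le
    set s := ϱ i ^ 3 * (t - t₀) with hs
    have hts : t = t₀ + s * st i := by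
      rw [hs, hst]
      simp only
      rw [mul_comm (ϱ i ^ 3), mul_assoc, mul_inv_cancel₀ (pow_pos (hϱ0 i) 3).ne']
      ring
    have h0 := hst0 i
    -- Below the threshold t cannot lie in a bounding step. Thus s is strictly between these steps,
    -- where the cut-off is 1, or strictly beyond one of them, where it is 0.
    have hleft : s < -(jm i + 1) ∨ -jm i < s := by
      by_contra hc
      push Not at hc
      exact absurd ((hW i).le_left t ⟨by rw [hts]; nlinarith, by rw [hts]; nlinarith⟩)
        (not_le.2 hlt')
    have hright : s < jp i ∨ jp i + 1 < s := by
      by_contra hc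
      push Not at hc
      exact absurd ((hW i).le_right t ⟨by rw [hts]; nlinarith, by rw [hts]; nlinarith⟩)
        (not_le.2 hlt')
    have hzero : ∀ z : ℝ, (z < -(jm i + 1) ∨ jp i + 1 < z) → windowCutoff (jm i) (jp i) z = 0 := by
      intro z hz
      by_contra hc
      obtain ⟨h1, h2⟩ := windowCutoff_ne_zero hc
      rcases hz with hz | hz <;> linarith
    rcases hleft with hl | hl
    · right
      filter_upwards [Iio_mem_nhds hl] with z hz using hzero z (Or.inl hz)
    · rcases hright with hr | hr
      · left
        filter_upwards [Ioo_mem_nhds hl hr] with z hz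
        exact windowCutoff_eq_one (by linarith [hz.1]) (by linarith [hz.2])
      · right
        filter_upwards [Ioi_mem_nhds hr] with z hz using hzero z (Or.inr hz)
  · have hp4 : st i ^ 4 = (ϱ i)⁻¹ ^ 12 := by
      rw [hst]
      simp only
      rw [← inv_pow, ← pow_mul]
    refine (hdich (st i) (hst0 i) ((hstR i).trans (hinv hh₀ hRh0)) (th i) (hthp i) (jm i) (jp i)
      (hW i)).imp id fun H s hs y hy => ?_
    rw [← hp4]
    exact H _ (hmem i s hs) y hy

end Cutoffs

end Transport

namespace Transport

/-! ### Regular families with bounded support in y. -/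

section RegularFamilies

variable {ι : Type*} {n d : ℕ}

/-- A family of functions of `(s, y)` with uniformly bounded derivatives, vanishing where
`‖y‖ > 1`. -/
structure Reg (v : ι → ℝ → (Fin d → ℝ) → ℂ) : Prop where
  ub : UB fun i (z : ℝ × (Fin d → ℝ)) => v i z.1 z.2
  ysupp : ∀ i s y, 1 < ‖y‖ → v i s y = 0

variable {v : ι → ℝ → (Fin d → ℝ) → ℂ}

theorem Reg.zero : Reg (fun (_ : ι) (_ : ℝ) (_ : Fin d → ℝ) => (0 : ℂ)) :=
  ⟨UB.zero, fun _ _ _ _ => rfl⟩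

theorem Reg.const_mul (hv : Reg v) (c : ℂ) : Reg fun i s y => c * v i s y :=
  ⟨(UB.const_family (c := fun _ => c) fun _ => le_rfl).mul hv.ub,
    fun i s y hy => by rw [hv.ysupp i s y hy, mul_zero]⟩

theorem eventually_one_lt_norm {y : Fin d → ℝ} (hy : 1 < ‖y‖) : ∀ᶠ z in 𝓝 y, 1 < ‖z‖ :=
  continuous_norm.continuousAt.eventually (lt_mem_nhds hy)

theorem Reg.pderiv (hv : Reg v) (j : Fin d) : Reg fun i s => pderiv j (v i s) := by
  refine ⟨(hv.ub.fderiv_apply (0, Pi.single j 1)).congr fun i z => ?_, fun i s y hy => ?_⟩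
  · exact (DifferentiableAt.fderiv_snd (hv.ub.differentiable i z) (Pi.single j 1)).symm
  · have : v i s =ᶠ[𝓝 y] fun _ => 0 := by
      filter_upwards [eventually_one_lt_norm hy] with z hz using hv.ysupp i s z hz
    rw [Transport.pderiv, this.fderiv_eq]
    simp

theorem Reg.pderiv_iterate (hv : Reg v) (j : Fin d) (k : ℕ) :
    Reg fun i s => (Transport.pderiv j)^[k] (v i s) := by
  induction k with
  | zero => exact hv
  | succ k ih =>
    simp only [Function.iterate_succ_apply']
    exact ih.pderiv j

theorem Reg.mderiv (hv : Reg v) (μ : Fin d → ℕ) : Reg fun i s => mderiv μ (v i s) := by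
  unfold Transport.mderiv
  induction List.finRange d with
  | nil => exact hv
  | cons j l ih =>
    simp only [List.foldr_cons]
    exact ih.pderiv_iterate j (μ j)

theorem Reg.iteratedDeriv (hv : Reg v) (k : ℕ) :
    Reg fun i s y => iteratedDeriv k (fun s => v i s y) s := by
  induction k with
  | zero => simpa only [iteratedDeriv_zero] using hv
  | succ k ih =>
    simp only [iteratedDeriv_succ]
    refine ⟨(ih.ub.fderiv_apply (1, 0)).congr fun i z => ?_, fun i s y hy => ?_⟩
    · exact (ih.ub.hasDerivAt_fst i z.1 z.2).deriv.symm
    · have : _root_.iteratedDeriv k (fun s => v i s y) = fun _ => 0 := by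
        funext s
        exact ih.ysupp i s y hy
      rw [this]
      simp

theorem Reg.Dy (hv : Reg v) (j : Fin d) : Reg fun i s => Dy j (v i s) :=
  (hv.pderiv j).const_mul _

theorem Reg.DtDy (hv : Reg v) (ϱ : ℝ) (k : ℕ) (μ : Fin d → ℕ) : Reg fun i => DtDy ϱ k μ (v i) :=
  ((hv.mderiv μ).iteratedDeriv k).const_mul _

end RegularFamilies

/-! ### Source terms that can be integrated in s. -/

section LowerTerms

variable {ι : Type} {n d : ℕ} {t₀ t₁ t₂ : ℝ} {ϱ ℓ : ι → ℝ} {χ : ι → ℝ → ℝ}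

/-- The coefficients that are admitted in the lower order terms: in the support of the cut-off
they are `O(1/ℓ)`. -/
structure Small (ℓ : ι → ℝ) (χ : ι → ℝ → ℝ) (c : ι → ℝ × (Fin d → ℝ) → ℂ) : Prop where
  ub : UB c
  slice : ∀ m : ℕ, ∃ C : ℝ, ∀ i s y, χ i s ≠ 0 → ‖y‖ ≤ 1 →
    ‖iteratedFDeriv ℝ m (fun y => c i (s, y)) y‖ * ℓ i ≤ C

theorem UB.ofReal {X : Type*} [NormedAddCommGroup X] [NormedSpace ℝ X] {u : ι → X → ℝ}
    (hu : UB u) : UB fun i z => (u i z : ℂ) := hu.clm_comp Complex.ofRealCLM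

theorem UB.comp_fst {X Y F : Type*} [NormedAddCommGroup X] [NormedSpace ℝ X]
    [NormedAddCommGroup Y] [NormedSpace ℝ Y] [NormedAddCommGroup F] [NormedSpace ℝ F]
    {u : ι → X → F} (hu : UB u) : UB fun i (z : X × Y) => u i z.1 := by
  refine (hu.comp_affine (fun _ => 0) (fun _ => ContinuousLinearMap.fst ℝ X Y) fun _ =>
    ContinuousLinearMap.norm_fst_le ℝ X Y).congr fun i z => ?_
  simp

/-- The coefficient is controlled only where χ ≠ 0 and ‖y‖ ≤ 1. Elsewhere the product vanishes with
all its y-derivatives, because of χ or of v. -/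
theorem Small.ib (hχ : IsCutoff t₀ t₁ t₂ ϱ ℓ χ) {c : ι → ℝ × (Fin d → ℝ) → ℂ}
    (hc : Small ℓ χ c) {v : ι → ℝ → (Fin d → ℝ) → ℂ} (hv : Reg v) :
    IB ℓ fun i z => (χ i z.1 : ℂ) * (c i z * v i z.1 z.2) := by
  obtain ⟨X, hX⟩ := hχ.ub.exists_norm_le
  have hχ' : UB fun i (z : ℝ × (Fin d → ℝ)) => (χ i z.1 : ℂ) := hχ.ub.ofReal.comp_fst
  refine ⟨hχ'.mul (hc.ub.mul hv.ub), fun i s y hs => ?_, fun m => ?_⟩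
  · have : χ i s = 0 := by
      by_contra h
      exact absurd (hχ.abs_le i s h) (not_le.2 hs)
    simp [this]
  choose C hC using hc.slice
  choose D hD using hv.ub.slice
  set B := ContinuousLinearMap.mul ℝ ℂ
  refine ⟨|X| * (‖B‖ * ∑ j ∈ Finset.range (m + 1), (m.choose j : ℝ) * |C j| * |D (m - j)|),
    fun i s y => ?_⟩
  have hℓ := hχ.length_pos i
  change ‖iteratedFDeriv ℝ m (fun y => (χ i s : ℂ) * (c i (s, y) * v i s y)) y‖ * ℓ i ≤ _
  by_cases hs : χ i s = 0
  · have : (fun y => (χ i s : ℂ) * (c i (s, y) * v i s y)) = fun _ => 0 := by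
      funext y
      simp [hs]
    rw [this, iteratedFDeriv_fun_zero, Pi.zero_apply, norm_zero, zero_mul]
    positivity
  rcases lt_or_ge 1 ‖y‖ with hy | hy
  · have : (fun y => (χ i s : ℂ) * (c i (s, y) * v i s y)) =ᶠ[𝓝 y] fun _ => 0 := by
      filter_upwards [eventually_one_lt_norm hy] with z hz
      simp [hv.ysupp i s z hz]
    have h0 := (this.iteratedFDeriv ℝ m).self_of_nhds
    rw [h0, iteratedFDeriv_fun_zero, Pi.zero_apply, norm_zero, zero_mul]
    positivity
  · have hcs := contDiff_slice (hc.ub.1 i) s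
    have hvs : ContDiff ℝ ∞ (v i s) := contDiff_slice (hv.ub.1 i) s
    have h1 : ‖iteratedFDeriv ℝ m (fun y => (χ i s : ℂ) * (c i (s, y) * v i s y)) y‖
        ≤ |X| * ‖iteratedFDeriv ℝ m (fun y => B (c i (s, y)) (v i s y)) y‖ := by
      have h2 := (ContinuousLinearMap.mul ℝ ℂ (χ i s : ℂ)).norm_iteratedFDeriv_comp_left
        (f := fun y => B (c i (s, y)) (v i s y)) (x := y) (N := ∞) (n := m)
        (hcs.mul hvs).contDiffAt (by exact_mod_cast le_top)
      refine h2.trans (mul_le_mul_of_nonneg_right ?_ (norm_nonneg _))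
      refine (ContinuousLinearMap.opNorm_mul_apply_le ℝ ℂ _).trans ?_
      rw [Complex.norm_real]
      exact (hX i s).trans (le_abs_self X)
    refine (mul_le_mul_of_nonneg_right h1 hℓ.le).trans ?_
    rw [mul_assoc]
    refine mul_le_mul_of_nonneg_left ?_ (abs_nonneg X)
    refine (mul_le_mul_of_nonneg_right (B.norm_iteratedFDeriv_le_of_bilinear hcs hvs y
      (by exact_mod_cast le_top)) hℓ.le).trans ?_
    rw [mul_assoc, Finset.sum_mul]
    refine mul_le_mul_of_nonneg_left (Finset.sum_le_sum fun j _ => ?_) (norm_nonneg B)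
    have h3 := (hC j i s y hs hy).trans (le_abs_self _)
    have h4 := (hD (m - j) i s y).trans (le_abs_self _)
    calc _ = (m.choose j : ℝ) * (‖iteratedFDeriv ℝ j (fun y => c i (s, y)) y‖ * ℓ i)
          * ‖iteratedFDeriv ℝ (m - j) (v i s) y‖ := by ring
      _ ≤ _ := by gcongr

/-- A factor ϱ⁻³ is O(1/ℓ), because the window lies in [t₁, t₂] and so ℓ = O(ϱ³). -/
theorem Small.of_ub (hχ : IsCutoff t₀ t₁ t₂ ϱ ℓ χ) (hϱ : ∀ i, 1 ≤ ϱ i)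
    {c : ι → ℝ × (Fin d → ℝ) → ℂ} (hc : UB c) :
    Small ℓ χ fun i z => ((ϱ i ^ 3 : ℝ) : ℂ)⁻¹ * c i z := by
  have hϱ0 : ∀ i, 0 < ϱ i := fun i => one_pos.trans_le (hϱ i)
  refine ⟨UB.mul (UB.const_family (C := 1) fun i => ?_) hc, fun m => ?_⟩
  · rw [norm_inv, Complex.norm_real, Real.norm_of_nonneg (by have := hϱ0 i; positivity)]
    exact inv_le_one_of_one_le₀ (one_le_pow₀ (hϱ i))
  · obtain ⟨C, hC⟩ := hχ.length_le
    obtain ⟨D, hD⟩ := hc.slice m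
    refine ⟨|D| * C, fun i s y _ _ => ?_⟩
    have hcs := contDiff_slice (hc.1 i) s
    have h2 := (ContinuousLinearMap.mul ℝ ℂ ((ϱ i ^ 3 : ℝ) : ℂ)⁻¹).norm_iteratedFDeriv_comp_left
      (f := fun y => c i (s, y)) (x := y) (N := ∞) (n := m) hcs.contDiffAt
      (by exact_mod_cast le_top)
    have h3 : ‖ContinuousLinearMap.mul ℝ ℂ ((ϱ i ^ 3 : ℝ) : ℂ)⁻¹‖ ≤ (ϱ i ^ 3)⁻¹ := by
      refine (ContinuousLinearMap.opNorm_mul_apply_le ℝ ℂ _).trans ?_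
      rw [norm_inv, Complex.norm_real, Real.norm_of_nonneg (by have := hϱ0 i; positivity)]
    have h4 := pow_pos (hϱ0 i) 3
    have h5 := (hD i s y).trans (le_abs_self D)
    calc _ ≤ ((ϱ i ^ 3)⁻¹ * |D|) * (C * ϱ i ^ 3) := by
          refine mul_le_mul (h2.trans ?_) (hC i) (hχ.length_pos i).le (by positivity)
          exact mul_le_mul h3 h5 (norm_nonneg _) (by positivity)
      _ = _ := by
        have := (hϱ0 i).ne'
        field_simp

/-- A linear expression in the functions `φ_{k',α'}` with `k' < k`, or `k' = k` and `|α'| < a`,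
that is admitted as a source term. -/
structure LowerTerm (ℓ : ι → ℝ) (χ : ι → ℝ → ℝ) (k a : ℕ)
    (T : ι → (ℕ → (Fin n → ℕ) → ℝ → (Fin d → ℝ) → ℂ) → ℝ → (Fin d → ℝ) → ℂ) : Prop where
  ib : ∀ u : ι → ℕ → (Fin n → ℕ) → ℝ → (Fin d → ℝ) → ℂ, (∀ k α, Reg fun i => u i k α) →
    IB ℓ fun i z => (χ i z.1 : ℂ) * T i (u i) z.1 z.2
  ysupp : ∀ u : ι → ℕ → (Fin n → ℕ) → ℝ → (Fin d → ℝ) → ℂ, (∀ k α, Reg fun i => u i k α) →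
    ∀ i s y, 1 < ‖y‖ → T i (u i) s y = 0
  congr : ∀ i φ φ', (∀ k' α', k' < k ∨ k' = k ∧ mdeg α' < a → φ k' α' = φ' k' α') → T i φ = T i φ'

variable {k a : ℕ} {T T' : ι → (ℕ → (Fin n → ℕ) → ℝ → (Fin d → ℝ) → ℂ) → ℝ → (Fin d → ℝ) → ℂ}

theorem LowerTerm.add (hχ : IsCutoff t₀ t₁ t₂ ϱ ℓ χ) (h : LowerTerm ℓ χ k a T)
    (h' : LowerTerm ℓ χ k a T') : LowerTerm ℓ χ k a fun i φ s y => T i φ s y + T' i φ s y := by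
  refine ⟨fun u hu => ?_, fun u hu i s y hy => ?_, fun i φ φ' hφ => ?_⟩
  · have := (h.ib u hu).add hχ.length_pos (h'.ib u hu)
    simpa only [mul_add] using this
  · rw [h.ysupp u hu i s y hy, h'.ysupp u hu i s y hy, add_zero]
  · simp only [h.congr i φ φ' hφ, h'.congr i φ φ' hφ]

theorem LowerTerm.zero : LowerTerm ℓ χ k a
    fun _ (_ : ℕ → (Fin n → ℕ) → ℝ → (Fin d → ℝ) → ℂ) _ _ => 0 :=
  ⟨fun u hu => by simpa only [mul_zero] using IB.zero ℓ, fun _ _ _ _ _ _ => rfl,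
    fun _ _ _ _ => rfl⟩

theorem LowerTerm.sum {κ : Type*} (hχ : IsCutoff t₀ t₁ t₂ ϱ ℓ χ) {I : Finset κ}
    {T : κ → ι → (ℕ → (Fin n → ℕ) → ℝ → (Fin d → ℝ) → ℂ) → ℝ → (Fin d → ℝ) → ℂ}
    (h : ∀ j ∈ I, LowerTerm ℓ χ k a (T j)) :
    LowerTerm ℓ χ k a fun i φ s y => ∑ j ∈ I, T j i φ s y := by
  classical
  induction I using Finset.induction_on with
  | empty => simpa only [Finset.sum_empty] using LowerTerm.zero
  | insert b I hb ih =>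
    simp only [Finset.sum_insert hb]
    exact (h b (Finset.mem_insert_self _ _)).add hχ
      (ih fun j hj => h j (Finset.mem_insert_of_mem hj))

theorem LowerTerm.const_mul (hχ : IsCutoff t₀ t₁ t₂ ϱ ℓ χ) (h : LowerTerm ℓ χ k a T) (b : ℂ) :
    LowerTerm ℓ χ k a fun i φ s y => b * T i φ s y := by
  refine ⟨fun u hu => ?_, fun u hu i s y hy => ?_, fun i φ φ' hφ => ?_⟩
  · have := IB.bilin (ContinuousLinearMap.mul ℝ ℂ) hχ.length_pos
      (UB.const_family (ι := ι) (X := ℝ × (Fin d → ℝ)) (c := fun _ => b) fun _ => le_rfl)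
      (h.ib u hu)
    have he : (fun i (z : ℝ × (Fin d → ℝ)) => (χ i z.1 : ℂ) * (b * T i (u i) z.1 z.2))
        = fun i z => ContinuousLinearMap.mul ℝ ℂ b ((χ i z.1 : ℂ) * T i (u i) z.1 z.2) := by
      funext i z
      simp only [ContinuousLinearMap.mul_apply']
      ring
    rw [he]
    exact this
  · rw [h.ysupp u hu i s y hy, mul_zero]
  · simp only [h.congr i φ φ' hφ]

theorem Reg.lev {u : ι → ℕ → (Fin n → ℕ) → ℝ → (Fin d → ℝ) → ℂ}
    (hu : ∀ k α, Reg fun i => u i k α) (m : ℤ) (α : Fin n → ℕ) :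
    Reg fun i => lev (u i) m α := by
  unfold Transport.lev
  split_ifs
  · exact hu _ _
  · exact Reg.zero

/-- A single term of the transport equation. -/
theorem LowerTerm.of_small (hχ : IsCutoff t₀ t₁ t₂ ϱ ℓ χ) {c : ι → ℝ × (Fin d → ℝ) → ℂ}
    (hc : Small ℓ χ c) {Q : (ℝ → (Fin d → ℝ) → ℂ) → ℝ → (Fin d → ℝ) → ℂ}
    (hQ : ∀ v : ι → ℝ → (Fin d → ℝ) → ℂ, Reg v → Reg fun i => Q (v i)) {m : ℤ} {α : Fin n → ℕ}
    (hm : m < k ∨ m = k ∧ mdeg α < a) :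
    LowerTerm ℓ χ k a fun i φ s y => c i (s, y) * Q (lev φ m α) s y := by
  refine ⟨fun u hu => hc.ib hχ (hQ _ (Reg.lev hu m α)), fun u hu i s y hy => ?_,
    fun i φ φ' hφ => ?_⟩
  · rw [(hQ _ (Reg.lev hu m α)).ysupp i s y hy, mul_zero]
  · have : lev φ m α = lev φ' m α := by
      unfold lev
      split_ifs with h0
      · exact hφ _ _ (by omega)
      · rfl
    simp only [this]

end LowerTerms

end Transport

namespace Transport

/-! ### The order of recursion: own terms and lower terms. -/

section Recursion

variable {ι : Type} {n d : ℕ}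

/-- Functions of `(t, y)` that play the role of the coefficients of the transport equations. -/
structure Coeffs (n d : ℕ) where
  A0 : (Fin n → ℕ) → Fin n → ℝ × (Fin d → ℝ) → ℂ
  A1 : (Fin n → ℕ) → Fin d → ℝ × (Fin d → ℝ) → ℂ
  A2 : (Fin n → ℕ) → Fin d → Fin d → ℝ × (Fin d → ℝ) → ℂ
  R : ℕ → (Fin n → ℕ) → ℕ → (Fin n → ℕ) → (Fin d → ℕ) → ℝ × (Fin d → ℝ) → ℂ

/-- The coefficients are smooth and compactly supported. -/
structure Coeffs.Smooth (c : Coeffs n d) : Prop where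
  A0 : ∀ β j, ContDiff ℝ ∞ (c.A0 β j) ∧ HasCompactSupport (c.A0 β j)
  A1 : ∀ β j, ContDiff ℝ ∞ (c.A1 β j) ∧ HasCompactSupport (c.A1 β j)
  A2 : ∀ β j l, ContDiff ℝ ∞ (c.A2 β j l) ∧ HasCompactSupport (c.A2 β j l)
  R : ∀ m β ℓ ν μ, ContDiff ℝ ∞ (c.R m β ℓ ν μ) ∧ HasCompactSupport (c.R m β ℓ ν μ)
  A0_supp : ∃ T : ℝ, ∀ β j t y, T < |t| → c.A0 β j (t, y) = 0

section Sums

variable (c : Coeffs n d) (I : Finset (Fin n → ℕ)) (q : ℝ × (Fin d → ℝ))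
  (φ : ℕ → (Fin n → ℕ) → ℝ → (Fin d → ℝ) → ℂ) (k : ℕ) (α : Fin n → ℕ) (s : ℝ) (y : Fin d → ℝ)

noncomputable def Coeffs.sumA0 : ℂ := ∑ β ∈ I, ∑ j, c.A0 β j q * ((α j + 1 - β j : ℕ) : ℂ) *
  lev φ (k + 2 - 2 * mdeg β) (α + Pi.single j 1 - β) s y

noncomputable def Coeffs.sumA1 : ℂ := ∑ β ∈ I, ∑ j, c.A1 β j q *
  Dy j (lev φ (k + 1 - 2 * mdeg β) (α - β) s) y

noncomputable def Coeffs.sumA2 : ℂ := ∑ β ∈ I, ∑ j, ∑ l, c.A2 β j l q *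
  Dy j (Dy l (lev φ (k + 2 - 2 * mdeg β) (α - β) s)) y

noncomputable def Coeffs.sumA00 : ℂ := ∑ j, c.A0 0 j q * ((α j + 1 : ℕ) : ℂ) *
  lev φ (k - 1) (α + Pi.single j 1) s y

noncomputable def Coeffs.sumA10 : ℂ := ∑ j, c.A1 0 j q * Dy j (lev φ (k - 2) α s) y

noncomputable def Coeffs.sumA20 : ℂ := ∑ j, ∑ l, c.A2 0 j l q * Dy j (Dy l (lev φ (k - 1) α s)) y

/-- The terms of the right hand side, except for the one with `m = 0` and `β = 0`. -/
noncomputable def Coeffs.sumR (N : ℕ) : ℂ :=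
  ∑ m ∈ Finset.range (k + 7), ∑ β ∈ Finset.Iic α, ∑ ℓ ∈ Finset.range (ordR m + 1),
    ∑ ν ∈ midx n (ordR m), ∑ μ ∈ midx d (ordR m),
      if ℓ + mdeg ν + mdeg μ ≤ ordR m then
        if m = 0 ∧ β = 0 then 0 else
        c.R m β ℓ ν μ q * cmon α β ν *
          DtDy 1 ℓ μ
            (lev φ (k - ((m : ℤ) * N + 2 * mdeg β - 3 * ℓ - 2 * mdeg ν - mdeg μ)) (α + ν - β))
            s y
      else 0

end Sums

section Terms

variable (c : Coeffs n d) (N : ℕ) (t₀ ϱ : ℝ)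
  (φ : ℕ → (Fin n → ℕ) → ℝ → (Fin d → ℝ) → ℂ) (k : ℕ) (α : Fin n → ℕ) (s : ℝ) (y : Fin d → ℝ)

/-- The terms of the transport equation that involve `φ_{k,α'}` with `|α'| = |α|`. -/
noncomputable def Coeffs.own : ℂ :=
  -∑ β ∈ (Finset.Iic α).filter (fun β => mdeg β = 1), ∑ j,
      c.A0 β j (t₀ + s / ϱ ^ 3, 0) * ((α j + 1 - β j : ℕ) : ℂ) *
        φ k (α + Pi.single j 1 - β) s y
    - Complex.I * c.R 0 0 0 0 0 (unscale t₀ ϱ (s, y)) * φ k α s y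

/-- The terms of the transport equation that involve `φ_{k',α'}` with `k' < k` or
`|α'| < |α|`. -/
noncomputable def Coeffs.lower : ℂ :=
  ((ϱ ^ 3 : ℝ) : ℂ)⁻¹ *
      c.sumA0 ((Finset.Iic α).filter (fun β => 1 < mdeg β)) (unscale t₀ ϱ (s, y)) φ k α s y * (-1)
    + ((ϱ ^ 3 : ℝ) : ℂ)⁻¹ *
      c.sumA1 ((Finset.Iic α).filter (fun β => β ≠ 0)) (unscale t₀ ϱ (s, y)) φ k α s y * (-Complex.I)
    + ((ϱ ^ 3 : ℝ) : ℂ)⁻¹ *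
      c.sumA2 ((Finset.Iic α).filter (fun β => β ≠ 0)) (unscale t₀ ϱ (s, y)) φ k α s y * (-Complex.I)
    + ((ϱ ^ 3 : ℝ) : ℂ)⁻¹ * c.sumR (unscale t₀ ϱ (s, y)) φ k α s y N * (-Complex.I)
    + c.sumA00 (unscale t₀ ϱ (s, y)) φ k α s y * (-1)
    + c.sumA10 (unscale t₀ ϱ (s, y)) φ k α s y * (-Complex.I)
    + c.sumA20 (unscale t₀ ϱ (s, y)) φ k α s y * (-Complex.I)

end Terms

variable {t₀ t₁ t₂ : ℝ} {ϱ ℓ : ι → ℝ} {χ : ι → ℝ → ℝ} {k a : ℕ} {α β : Fin n → ℕ}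
  {c : Coeffs n d}

theorem LowerTerm.of_eq
    {T T' : ι → (ℕ → (Fin n → ℕ) → ℝ → (Fin d → ℝ) → ℂ) → ℝ → (Fin d → ℝ) → ℂ}
    (h : LowerTerm ℓ χ k a T) (he : ∀ i φ s y, T' i φ s y = T i φ s y) : LowerTerm ℓ χ k a T' := by
  have : T' = T := by
    funext i φ s y
    exact he i φ s y
  exact this ▸ h

theorem UB.coeff {f : ℝ × (Fin d → ℝ) → ℂ} (hf : ContDiff ℝ ∞ f ∧ HasCompactSupport f) (t₀ : ℝ)
    (hϱ : ∀ i, 1 ≤ ϱ i) : UB fun i z => f (unscale t₀ (ϱ i) z) :=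
  (UB.of_hasCompactSupport hf.1 hf.2).comp_unscale t₀ hϱ

theorem mdeg_sub (h : β ≤ α) : mdeg (α - β) + mdeg β = mdeg α := by
  simp only [mdeg, ← Finset.sum_add_distrib, Pi.sub_apply]
  exact Finset.sum_congr rfl fun i _ => Nat.sub_add_cancel (h i)

theorem mdeg_add (α β : Fin n → ℕ) : mdeg (α + β) = mdeg α + mdeg β := by
  simp [mdeg, Finset.sum_add_distrib]

theorem mdeg_single (j : Fin n) : mdeg (Pi.single j 1 : Fin n → ℕ) = 1 := by
  simp [mdeg]

theorem mdeg_add_single_sub (h : β ≤ α) (hβ : mdeg β = 1) (j : Fin n) :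
    mdeg (α + Pi.single j 1 - β) = mdeg α := by
  have h1 := mdeg_sub (h.trans (le_self_add (b := Pi.single j 1)))
  rw [mdeg_add, mdeg_single] at h1
  omega

/-- For |β| ≥ 2 the level k + 2 - 2|β| is less than k. The case |β| = 1 keeps both level and degree
and belongs to `own`. -/
theorem lowerTerm_sumA0 (hχ : IsCutoff t₀ t₁ t₂ ϱ ℓ χ) (hϱ : ∀ i, 1 ≤ ϱ i) (hc : c.Smooth) :
    LowerTerm ℓ χ k (mdeg α) fun i φ s y => ((ϱ i ^ 3 : ℝ) : ℂ)⁻¹ *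
      c.sumA0 ((Finset.Iic α).filter (fun β => 1 < mdeg β)) (unscale t₀ (ϱ i) (s, y)) φ k α s y := by
  refine LowerTerm.of_eq (LowerTerm.sum hχ
    (I := (Finset.Iic α).filter (fun β => 1 < mdeg β)) fun β hβ =>
      LowerTerm.sum hχ (I := Finset.univ) fun j _ =>
        (LowerTerm.of_small hχ (Small.of_ub hχ hϱ (UB.coeff (hc.A0 β j) t₀ hϱ)) (Q := fun g => g)
          (fun v hv => hv) (m := k + 2 - 2 * mdeg β) (α := α + Pi.single j 1 - β) ?_).const_mul hχ
          ((α j + 1 - β j : ℕ) : ℂ)) fun i φ s y => ?_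
  · have := (Finset.mem_filter.1 hβ).2
    omega
  · simp only [Coeffs.sumA0, Finset.mul_sum]
    refine Finset.sum_congr rfl fun β _ => Finset.sum_congr rfl fun j _ => ?_
    ring

theorem lowerTerm_sumA1 (hχ : IsCutoff t₀ t₁ t₂ ϱ ℓ χ) (hϱ : ∀ i, 1 ≤ ϱ i) (hc : c.Smooth) :
    LowerTerm ℓ χ k (mdeg α) fun i φ s y => ((ϱ i ^ 3 : ℝ) : ℂ)⁻¹ *
      c.sumA1 ((Finset.Iic α).filter (fun β => β ≠ 0)) (unscale t₀ (ϱ i) (s, y)) φ k α s y := by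
  refine LowerTerm.of_eq (LowerTerm.sum hχ
    (I := (Finset.Iic α).filter (fun β => β ≠ 0)) fun β hβ =>
      LowerTerm.sum hχ (I := Finset.univ) fun j _ =>
        LowerTerm.of_small hχ (Small.of_ub hχ hϱ (UB.coeff (hc.A1 β j) t₀ hϱ))
          (Q := fun g s => Dy j (g s)) (fun v hv => hv.Dy j) (m := k + 1 - 2 * mdeg β)
          (α := α - β) ?_) fun i φ s y => ?_
  · have := mt mdeg_eq_zero.1 (Finset.mem_filter.1 hβ).2
    omega
  · simp only [Coeffs.sumA1, Finset.mul_sum]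
    refine Finset.sum_congr rfl fun β _ => Finset.sum_congr rfl fun j _ => ?_
    ring

/-- For |β| = 1 the level stays equal to k, and it is the degree |α - β| that drops. -/
theorem lowerTerm_sumA2 (hχ : IsCutoff t₀ t₁ t₂ ϱ ℓ χ) (hϱ : ∀ i, 1 ≤ ϱ i) (hc : c.Smooth) :
    LowerTerm ℓ χ k (mdeg α) fun i φ s y => ((ϱ i ^ 3 : ℝ) : ℂ)⁻¹ *
      c.sumA2 ((Finset.Iic α).filter (fun β => β ≠ 0)) (unscale t₀ (ϱ i) (s, y)) φ k α s y := by
  refine LowerTerm.of_eq (LowerTerm.sum hχ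
    (I := (Finset.Iic α).filter (fun β => β ≠ 0)) fun β hβ =>
      LowerTerm.sum hχ (I := Finset.univ) fun j _ => LowerTerm.sum hχ (I := Finset.univ) fun l _ =>
        LowerTerm.of_small hχ (Small.of_ub hχ hϱ (UB.coeff (hc.A2 β j l) t₀ hϱ))
          (Q := fun g s => Dy j (Dy l (g s))) (fun v hv => (hv.Dy l).Dy j)
          (m := k + 2 - 2 * mdeg β) (α := α - β) ?_) fun i φ s y => ?_
  · have h1 := mt mdeg_eq_zero.1 (Finset.mem_filter.1 hβ).2
    have h2 := mdeg_sub (Finset.mem_Iic.1 (Finset.mem_filter.1 hβ).1)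
    omega
  · simp only [Coeffs.sumA2, Finset.mul_sum]
    refine Finset.sum_congr rfl fun β _ => Finset.sum_congr rfl fun j _ =>
      Finset.sum_congr rfl fun l _ => ?_
    ring

/-- If m > 0, the level drops by at least mN - 3(m + 2) ≥ 7m - 6 ≥ 1, as N ≥ 10. If m = 0, it drops
by 2|β|, and β ≠ 0 since that term is excluded. -/
theorem lowerTerm_sumR (hχ : IsCutoff t₀ t₁ t₂ ϱ ℓ χ) (hϱ : ∀ i, 1 ≤ ϱ i) (hc : c.Smooth) {N : ℕ}
    (hN : 10 ≤ N) :
    LowerTerm ℓ χ k (mdeg α) fun i φ s y => ((ϱ i ^ 3 : ℝ) : ℂ)⁻¹ *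
      c.sumR (unscale t₀ (ϱ i) (s, y)) φ k α s y N := by
  refine LowerTerm.of_eq (LowerTerm.sum hχ (I := Finset.range (k + 7)) fun m _ =>
    LowerTerm.sum hχ (I := Finset.Iic α) fun β _ =>
    LowerTerm.sum hχ (I := Finset.range (ordR m + 1)) fun r _ =>
    LowerTerm.sum hχ (I := midx n (ordR m)) fun ν _ =>
    LowerTerm.sum hχ (I := midx d (ordR m)) (T := fun μ i φ s y =>
      if r + mdeg ν + mdeg μ ≤ ordR m then
        if m = 0 ∧ β = 0 then 0 else
        cmon α β ν * ((((ϱ i ^ 3 : ℝ) : ℂ)⁻¹ * c.R m β r ν μ (unscale t₀ (ϱ i) (s, y))) *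
          DtDy 1 r μ
            (lev φ (k - ((m : ℤ) * N + 2 * mdeg β - 3 * r - 2 * mdeg ν - mdeg μ)) (α + ν - β))
            s y)
      else 0) fun μ _ => ?_) fun i φ s y => ?_
  · by_cases h1 : r + mdeg ν + mdeg μ ≤ ordR m
    · by_cases h2 : m = 0 ∧ β = 0
      · simp only [if_pos h1, if_pos h2]
        exact LowerTerm.zero
      · simp only [if_pos h1, if_neg h2]
        refine (LowerTerm.of_small hχ (Small.of_ub hχ hϱ (UB.coeff (hc.R m β r ν μ) t₀ hϱ))
          (Q := DtDy 1 r μ) (fun v hv => hv.DtDy 1 r μ) ?_).const_mul hχ _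
        left
        rcases Nat.eq_zero_or_pos m with hm | hm
        · subst hm
          have h3 : mdeg β ≠ 0 := fun h => h2 ⟨rfl, mdeg_eq_zero.1 h⟩
          simp only [ordR, if_pos] at h1
          have h4 : r = 0 ∧ mdeg ν = 0 ∧ mdeg μ = 0 := by omega
          rw [h4.1, h4.2.1, h4.2.2]
          push_cast
          omega
        · rw [ordR, if_neg (by omega)] at h1
          have h5 : (m : ℤ) * 10 ≤ m * N := by
            have : m * 10 ≤ m * N := Nat.mul_le_mul_left m hN
            exact_mod_cast this
          omega
    · simp only [if_neg h1]
      exact LowerTerm.zero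
  · simp only [Coeffs.sumR, Finset.mul_sum]
    refine Finset.sum_congr rfl fun m _ => Finset.sum_congr rfl fun β _ =>
      Finset.sum_congr rfl fun r _ => Finset.sum_congr rfl fun ν _ =>
      Finset.sum_congr rfl fun μ _ => ?_
    split_ifs
    · ring
    · ring
    · ring

/-- The coefficients with `β = 0` are small in the support of the cut-off. -/
structure Coeffs.SmallZero (c : Coeffs n d) (t₀ : ℝ) (ϱ ℓ : ι → ℝ) (χ : ι → ℝ → ℝ) : Prop where
  A0 : ∀ j, Small ℓ χ fun i z => c.A0 0 j (unscale t₀ (ϱ i) z)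
  A1 : ∀ j, Small ℓ χ fun i z => c.A1 0 j (unscale t₀ (ϱ i) z)
  A2 : ∀ j l, Small ℓ χ fun i z => c.A2 0 j l (unscale t₀ (ϱ i) z)

/-- The terms with β = 0 have no factor ϱ⁻³ left; they are the only ones that need `SmallZero`.
Their level drops by 1 or 2, so the raised degree in A₀ does no harm. -/
theorem lowerTerm_lower (hχ : IsCutoff t₀ t₁ t₂ ϱ ℓ χ) (hϱ : ∀ i, 1 ≤ ϱ i) (hc : c.Smooth)
    (hz : c.SmallZero t₀ ϱ ℓ χ) {N : ℕ} (hN : 10 ≤ N) :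
    LowerTerm ℓ χ k (mdeg α) fun i φ s y => c.lower N t₀ (ϱ i) φ k α s y := by
  have h0 : LowerTerm ℓ χ k (mdeg α) fun i φ s y =>
      c.sumA00 (unscale t₀ (ϱ i) (s, y)) φ k α s y := by
    refine LowerTerm.of_eq (LowerTerm.sum hχ (I := Finset.univ) fun j _ =>
        (LowerTerm.of_small hχ (hz.A0 j) (Q := fun g => g) (fun v hv => hv) (m := k - 1)
          (α := α + Pi.single j 1) (by omega)).const_mul hχ ((α j + 1 : ℕ) : ℂ)) fun i φ s y => ?_
    exact Finset.sum_congr rfl fun j _ => by ring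
  have h1 : LowerTerm ℓ χ k (mdeg α) fun i φ s y =>
      c.sumA10 (unscale t₀ (ϱ i) (s, y)) φ k α s y :=
    LowerTerm.sum hχ (I := Finset.univ) fun j _ =>
        LowerTerm.of_small hχ (hz.A1 j) (Q := fun g s => Dy j (g s)) (fun v hv => hv.Dy j)
          (m := k - 2) (α := α) (by omega)
  have h2 : LowerTerm ℓ χ k (mdeg α) fun i φ s y =>
      c.sumA20 (unscale t₀ (ϱ i) (s, y)) φ k α s y :=
    LowerTerm.sum hχ (I := Finset.univ) fun j _ => LowerTerm.sum hχ (I := Finset.univ) fun l _ =>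
        LowerTerm.of_small hχ (hz.A2 j l) (Q := fun g s => Dy j (Dy l (g s)))
          (fun v hv => (hv.Dy l).Dy j) (m := k - 1) (α := α) (by omega)
  refine LowerTerm.of_eq ((((((((lowerTerm_sumA0 hχ hϱ hc).const_mul hχ (-1)).add hχ
    ((lowerTerm_sumA1 hχ hϱ hc).const_mul hχ (-Complex.I))).add hχ
    ((lowerTerm_sumA2 hχ hϱ hc).const_mul hχ (-Complex.I))).add hχ
    ((lowerTerm_sumR hχ hϱ hc hN).const_mul hχ (-Complex.I))).add hχ
    (h0.const_mul hχ (-1))).add hχ (h1.const_mul hχ (-Complex.I))).add hχ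
    (h2.const_mul hχ (-Complex.I))) fun i φ s y => ?_
  rw [Coeffs.lower]
  ring

theorem IB.clm_comp {E F G : Type*} [NormedAddCommGroup E] [NormedSpace ℝ E]
    [NormedAddCommGroup F] [NormedSpace ℝ F] [NormedAddCommGroup G] [NormedSpace ℝ G]
    (hℓ : ∀ i, 0 < ℓ i) {g : ι → ℝ × E → F} (hg : IB ℓ g) (T : F →L[ℝ] G) :
    IB ℓ fun i z => T (g i z) := by
  have h := IB.bilin (ContinuousLinearMap.smulRight (1 : ℝ →L[ℝ] ℝ) T) hℓ
    (UB.const_family (ι := ι) (X := ℝ × E) (c := fun _ => (1 : ℝ)) fun _ => le_rfl) hg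
  simpa using h

theorem IB.pi {E κ : Type*} [Fintype κ] [DecidableEq κ] [NormedAddCommGroup E] [NormedSpace ℝ E]
    (hℓ : ∀ i, 0 < ℓ i) {g : ι → ℝ × E → κ → ℂ} (hg : ∀ j, IB ℓ fun i z => g i z j) : IB ℓ g := by
  have h := IB.sum hℓ (s := Finset.univ) fun (j : κ) _ =>
    (hg j).clm_comp hℓ (ContinuousLinearMap.single ℝ (fun _ : κ => ℂ) j)
  have he : (fun i z => ∑ j, ContinuousLinearMap.single ℝ (fun _ : κ => ℂ) j (g i z j)) = g := by
    funext i z j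
    simp [Finset.sum_apply, Pi.single_apply]
  rwa [he] at h

end Recursion

end Transport

namespace Transport

/-! ### Recursive solution of the globalized transport equations. -/

section Solution

variable {ι : Type} {n d : ℕ} {t₀ t₁ t₂ : ℝ} {ϱ ℓ : ι → ℝ} {χ : ι → ℝ → ℝ} {c : Coeffs n d}

/-- The coordinate with index `α`, or `0` if `|α| > M`. -/
noncomputable def coordCLM (M : ℕ) (α : Fin n → ℕ) :
    ({α : Fin n → ℕ // α ∈ midx n M} → ℂ) →L[ℝ] ℂ :=
  if h : α ∈ midx n M then ContinuousLinearMap.proj ⟨α, h⟩ else 0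

theorem coordCLM_apply {M : ℕ} {α : Fin n → ℕ} (h : α ∈ midx n M)
    (v : {α : Fin n → ℕ // α ∈ midx n M} → ℂ) : coordCLM M α v = v ⟨α, h⟩ := by
  rw [coordCLM, dif_pos h]
  rfl

theorem coordCLM_smul {M : ℕ} {α : Fin n → ℕ} (b : ℂ)
    (v : {α : Fin n → ℕ // α ∈ midx n M} → ℂ) : coordCLM M α (b • v) = b * coordCLM M α v := by
  unfold coordCLM
  split_ifs <;> simp

/-- The matrix coupling the functions `φ_{k,α}` with the same `|α|`. -/
noncomputable def Coeffs.matrix (c : Coeffs n d) (M : ℕ) (t : ℝ) :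
    ({α : Fin n → ℕ // α ∈ midx n M} → ℂ) →L[ℝ] ({α : Fin n → ℕ // α ∈ midx n M} → ℂ) :=
  ContinuousLinearMap.pi fun α => ∑ β ∈ (Finset.Iic α.1).filter (fun β => mdeg β = 1), ∑ j,
    (ContinuousLinearMap.mul ℝ ℂ (-(c.A0 β j (t, 0) * ((α.1 j + 1 - β j : ℕ) : ℂ)))).comp
      (coordCLM M (α.1 + Pi.single j 1 - β))

theorem Coeffs.matrix_apply (M : ℕ) (t : ℝ) (v : {α : Fin n → ℕ // α ∈ midx n M} → ℂ)
    (α : {α : Fin n → ℕ // α ∈ midx n M}) :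
    c.matrix M t v α = ∑ β ∈ (Finset.Iic α.1).filter (fun β => mdeg β = 1), ∑ j,
      -(c.A0 β j (t, 0) * ((α.1 j + 1 - β j : ℕ) : ℂ))
        * coordCLM M (α.1 + Pi.single j 1 - β) v := by
  simp [Coeffs.matrix]

theorem Coeffs.Smooth.contDiff_matrix (hc : c.Smooth) (M : ℕ) : ContDiff ℝ ∞ (c.matrix M) := by
  refine contDiff_clm_apply_iff.2 fun v => contDiff_pi.2 fun α => ?_
  simp only [Coeffs.matrix_apply]
  refine ContDiff.sum fun β _ => ContDiff.sum fun j _ => ?_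
  exact ((((hc.A0 β j).1.comp (contDiff_id.prodMk contDiff_const)).mul contDiff_const).neg).mul
    contDiff_const

theorem Coeffs.Smooth.hasCompactSupport_matrix (hc : c.Smooth) (M : ℕ) :
    HasCompactSupport (c.matrix M) := by
  obtain ⟨T, hT⟩ := hc.A0_supp
  refine HasCompactSupport.intro (K := Set.Icc (-T) T) isCompact_Icc fun t ht => ?_
  have ht' : T < |t| := by
    by_contra h
    exact ht (abs_le.1 (not_lt.1 h))
  ext v α
  rw [Coeffs.matrix_apply]
  refine Finset.sum_eq_zero fun β _ => Finset.sum_eq_zero fun j _ => ?_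
  simp [hT β j t 0 ht']

/-- The rank k(M + 1) + |α| encodes the lexicographic order of (k, |α|) and is the induction
variable below. -/
theorem rank_lt {M k k' a a' : ℕ} (ha' : a' ≤ M) (h : k' < k ∨ k' = k ∧ a' < a) :
    k' * (M + 1) + a' < k * (M + 1) + a := by
  rcases h with h | ⟨rfl, h⟩
  · have : (k' + 1) * (M + 1) ≤ k * (M + 1) := Nat.mul_le_mul_right _ h
    linarith
  · omega

/-- Existence of solutions of the (globalized) transport equations, with uniform bounds. -/
theorem exists_transport_solution (hχ : IsCutoff t₀ t₁ t₂ ϱ ℓ χ) (hϱ : ∀ i, 1 ≤ ϱ i)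
    (hc : c.Smooth) (hz : c.SmallZero t₀ ϱ ℓ χ) {N : ℕ} (hN : 10 ≤ N) {a b δ : ℝ} (hab : a < b)
    (hδ : 0 < δ) (hδϱ : ∀ i, (ϱ i)⁻¹ ≤ δ) (ht₀ : t₀ ∈ Set.Ioo a b) {b₀ : (Fin d → ℝ) → ℂ}
    (hb₀ : ContDiff ℝ ∞ b₀) (hb₀y : ∀ y, 1 < ‖y‖ → b₀ y = 0) (K M : ℕ) :
    ∃ u : ι → ℕ → (Fin n → ℕ) → ℝ → (Fin d → ℝ) → ℂ, (∀ k α, Reg fun i => u i k α) ∧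
      (∀ i k α, ¬(k ≤ K ∧ mdeg α ≤ M) → u i k α = 0) ∧
      (∀ i y, u i 0 0 0 y = b₀ y) ∧ (∀ i k α y, k ≠ 0 ∨ α ≠ 0 → u i k α 0 y = 0) ∧
      ∀ i, ∀ k ≤ K, ∀ α, mdeg α ≤ M → ∀ s y, t₀ + s / ϱ i ^ 3 ∈ Set.Ioo a b →
        deriv (fun s => u i k α s y) s
          = ((ϱ i ^ 3 : ℝ) : ℂ)⁻¹ * c.own t₀ (ϱ i) (u i) k α s y
            + χ i s * c.lower N t₀ (ϱ i) (u i) k α s y := by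
  -- After p steps the equations of rank less than p hold; no equations are imposed yet for larger
  -- rank.
  suffices H : ∀ p : ℕ, ∃ u : ι → ℕ → (Fin n → ℕ) → ℝ → (Fin d → ℝ) → ℂ,
      (∀ k α, Reg fun i => u i k α) ∧
      (∀ i k α, ¬(k ≤ K ∧ mdeg α ≤ M) → u i k α = 0) ∧
      (∀ i, ∀ k ≤ K, ∀ α, mdeg α ≤ M → k * (M + 1) + mdeg α < p → (∀ y, u i k α 0 y
        = if k = 0 ∧ α = 0 then b₀ y else 0) ∧ ∀ s y, t₀ + s / ϱ i ^ 3 ∈ Set.Ioo a b →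
        deriv (fun s => u i k α s y) s
          = ((ϱ i ^ 3 : ℝ) : ℂ)⁻¹ * c.own t₀ (ϱ i) (u i) k α s y
            + χ i s * c.lower N t₀ (ϱ i) (u i) k α s y) by
    obtain ⟨u, h1, h2, h3⟩ := H ((K + 1) * (M + 1))
    have h3' := fun i k hk α hα => h3 i k hk α hα (by
      have : k * (M + 1) ≤ K * (M + 1) := Nat.mul_le_mul_right _ hk
      linarith)
    refine ⟨u, h1, h2, fun i y => ?_, fun i k α y hkα => ?_, fun i k hk α hα => (h3' i k hk α hα).2⟩
    · rw [(h3' i 0 (Nat.zero_le _) 0 (by simp [mdeg])).1, if_pos ⟨rfl, rfl⟩]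
    · by_cases hr : k ≤ K ∧ mdeg α ≤ M
      · rw [(h3' i k hr.1 α hr.2).1, if_neg (by tauto)]
      · rw [h2 i k α hr]
        rfl
  intro p
  induction p with
  | zero =>
    exact ⟨fun _ _ _ _ _ => 0, fun k α => Reg.zero, fun i k α _ => rfl,
      fun i k _ α _ h => absurd h (Nat.not_lt_zero _)⟩
  | succ p ih =>
    obtain ⟨u, hu, hu0, hueq⟩ := ih
    -- Decode the rank p as (k, r). All α with |α| = r are solved for at once, as one system at
    -- level k.
    set k := p / (M + 1) with hk
    set r := p % (M + 1) with hr
    have hp : k * (M + 1) + r = p := Nat.div_add_mod' p (M + 1)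
    have hrM : r ≤ M := Nat.lt_succ_iff.1 (Nat.mod_lt _ (Nat.succ_pos _))
    by_cases hkK : k ≤ K
    swap
    · refine ⟨u, hu, hu0, fun i k' hk' α hα hlt => hueq i k' hk' α hα ?_⟩
      have h1 : (k' + 1) * (M + 1) ≤ k * (M + 1) := Nat.mul_le_mul_right _ (by omega)
      linarith
    -- the source term and the initial data
    set g : ι → ℝ × (Fin d → ℝ) → {α : Fin n → ℕ // α ∈ midx n M} → ℂ := fun i z α =>
      if mdeg α.1 = r then (χ i z.1 : ℂ) * c.lower N t₀ (ϱ i) (u i) k α.1 z.1 z.2 else 0 with hg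
    have hgi : IB ℓ g := IB.pi hχ.length_pos fun α => by
      simp only [hg]
      split_ifs with h
      · exact (lowerTerm_lower hχ hϱ hc hz hN).ib u hu
      · exact IB.zero ℓ
    have hgy : YSupp g := fun i s y hy => by
      funext α
      simp only [hg]
      split_ifs with h
      · rw [(lowerTerm_lower (k := k) (α := α.1) hχ hϱ hc hz hN).ysupp u hu i s y hy, mul_zero]
        rfl
      · rfl
    obtain ⟨v, hv, hvy, hv0, hveq⟩ := exists_scaled_evolution hϱ hχ.length_pos hab hδ hδϱ t₀ ht₀
      (hc.contDiff_matrix M) (hc.hasCompactSupport_matrix M)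
      (fun t b v => by
        funext α
        simp only [Coeffs.matrix_apply, coordCLM_smul, Pi.smul_apply, smul_eq_mul, Finset.mul_sum]
        exact Finset.sum_congr rfl fun β _ => Finset.sum_congr rfl fun j _ => by ring)
      (R := fun z => -Complex.I * c.R 0 0 0 0 0 z) (contDiff_const.mul (hc.R 0 0 0 0 0).1)
      ((hc.R 0 0 0 0 0).2.mul_left) hgi hgy
      (u₀ := fun y α => if k = 0 ∧ α.1 = 0 then b₀ y else 0)
      (contDiff_pi.2 fun α => by
        split_ifs
        · exact hb₀
        · exact contDiff_const)
      (fun y hy => by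
        funext α
        simp [hb₀y y hy])
    have hvα : ∀ α, Reg fun i s y => coordCLM M α (v i (s, y)) := fun α =>
      ⟨hv.clm_comp (coordCLM M α), fun i s y hy => by simp [hvy i s y hy]⟩
    set u' : ι → ℕ → (Fin n → ℕ) → ℝ → (Fin d → ℝ) → ℂ := fun i k' α =>
      if k' = k ∧ mdeg α = r then fun s y => coordCLM M α (v i (s, y)) else u i k' α with hu'
    have hne : ∀ i k' α, ¬(k' = k ∧ mdeg α = r) → u' i k' α = u i k' α := fun i k' α h => by
      simp only [hu', if_neg h]
    have heq : ∀ i α (h : α ∈ midx n M), mdeg α = r → ∀ s y,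
        u' i k α s y = v i (s, y) ⟨α, h⟩ := fun i α h hr s y => by
      simp only [hu', hr, and_self, if_true]
      exact coordCLM_apply h _
    -- Replacing the functions of rank p does not change the lower terms in equations of rank at
    -- most p, so the equations already solved persist.
    have hlow : ∀ i k' α, mdeg α ≤ M → k' * (M + 1) + mdeg α < p + 1 → ∀ s y,
        c.lower N t₀ (ϱ i) (u' i) k' α s y = c.lower N t₀ (ϱ i) (u i) k' α s y := by
      intro i k' α hα hlt s y
      refine congrFun (congrFun ((lowerTerm_lower hχ hϱ hc hz hN).congr i _ _
        fun k'' α'' h => hne _ _ _ ?_) s) y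
      rintro ⟨rfl, h2⟩
      have := rank_lt (M := M) (a' := r) hrM (h2 ▸ h)
      omega
    refine ⟨u', fun k' α => ?_, fun i k' α h => ?_, fun i k' hk' α hα hlt => ?_⟩
    · by_cases h : k' = k ∧ mdeg α = r
      · simp only [hu', if_pos h]
        exact hvα α
      · simp only [hu', if_neg h]
        exact hu k' α
    · rw [hne i k' α fun h' => h ⟨h'.1 ▸ hkK, h'.2 ▸ hrM⟩]
      exact hu0 i k' α h
    have hmem : α ∈ midx n M := mem_midx.2 hα
    by_cases h : k' = k ∧ mdeg α = r
    · obtain ⟨rfl, hαr⟩ := h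
      have hus : ∀ s y, u' i k α s y = v i (s, y) ⟨α, hmem⟩ := heq i α hmem hαr
      refine ⟨fun y => by rw [hus, hv0], fun s y hs => ?_⟩
      have h1 : HasDerivAt (fun s => u' i k α s y)
          (fderiv ℝ (v i) (s, y) (1, 0) ⟨α, hmem⟩) s := by
        simp only [hus]
        exact hasDerivAt_pi.1 (hv.hasDerivAt_fst i s y) ⟨α, hmem⟩
      rw [h1.deriv, hveq i s y hs, hlow i k α hα hlt]
      simp only [Pi.add_apply, Pi.smul_apply, Coeffs.matrix_apply, Coeffs.own]
      congr 1
      · rw [Complex.real_smul, Complex.ofReal_inv, hus, sub_eq_add_neg, ← Finset.sum_neg_distrib]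
        congr 2
        · refine Finset.sum_congr rfl fun β hβ => ?_
          rw [← Finset.sum_neg_distrib]
          refine Finset.sum_congr rfl fun j _ => ?_
          have hd : mdeg (α + Pi.single j 1 - β) = mdeg α :=
            mdeg_add_single_sub (Finset.mem_Iic.1 (Finset.mem_filter.1 hβ).1)
              (Finset.mem_filter.1 hβ).2 j
          have hm : α + Pi.single j 1 - β ∈ midx n M := mem_midx.2 (hd ▸ hα)
          rw [coordCLM_apply hm, heq i _ hm (hd ▸ hαr), neg_mul]
        · rw [smul_eq_mul]
          ring
      · simp [hg, hαr]
    · have hlt' : k' * (M + 1) + mdeg α < p := by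
        rcases Nat.lt_succ_iff_lt_or_eq.1 hlt with h1 | h1
        · exact h1
        · exfalso
          apply h
          have h2 : k' = k := by
            rw [hk, ← h1, add_comm, Nat.add_mul_div_right _ _ (Nat.succ_pos M),
              Nat.div_eq_of_lt (by omega), zero_add]
          exact ⟨h2, by subst h2; omega⟩
      have hus := hne i k' α h
      obtain ⟨h1, h2⟩ := hueq i k' hk' α hα hlt'
      refine ⟨fun y => by rw [hus, h1], fun s y hs => ?_⟩
      rw [hus, h2 s y hs, hlow i k' α hα hlt]
      congr 2
      simp only [Coeffs.own, hus]
      congr 2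
      refine Finset.sum_congr rfl fun β hβ => Finset.sum_congr rfl fun j _ => ?_
      have hd : mdeg (α + Pi.single j 1 - β) = mdeg α :=
        mdeg_add_single_sub (Finset.mem_Iic.1 (Finset.mem_filter.1 hβ).1)
          (Finset.mem_filter.1 hβ).2 j
      rw [hne i k' _ (by rwa [hd])]

end Solution

end Transport

namespace Transport

/-! ### Smallness of coefficients and of their y-derivatives. -/

section SmallCoefficients

/-- Landau's inequality: a function that is small and has bounded second derivatives has a small
first derivative. -/
theorem norm_fderiv_le_of_small {E F : Type*} [NormedAddCommGroup E] [NormedSpace ℝ E]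
    [NormedAddCommGroup F] [NormedSpace ℝ F] {g : E → F} (hg : ContDiff ℝ ∞ g) {A C κ r : ℝ}
    (hC : ∀ y, ‖iteratedFDeriv ℝ 2 g y‖ ≤ C) (hκ : 0 < κ) (hκr : κ ≤ r)
    (hA : ∀ y, ‖y‖ ≤ 2 * r → ‖g y‖ ≤ A * κ ^ 2) {y : E} (hy : ‖y‖ ≤ r) :
    ‖fderiv ℝ g y‖ ≤ (C + 2 * A) * κ := by
  have hC0 : 0 ≤ C := (norm_nonneg _).trans (hC 0)
  have hA0 : 0 ≤ A := by
    have := (norm_nonneg _).trans (hA 0 (by rw [norm_zero]; linarith))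
    exact nonneg_of_mul_nonneg_left this (by positivity)
  have hd : Differentiable ℝ g := hg.differentiable (by simp)
  have hd2 : Differentiable ℝ (fderiv ℝ g) :=
    (hg.fderiv_right (m := ∞) (by simp)).differentiable (by simp)
  -- Taylor expansion with an increment of length κ: the difference of g is at most 2Aκ² and the
  -- remainder at most Cκ².
  have key : ∀ w : E, ‖w‖ = κ → ‖fderiv ℝ g y w‖ ≤ (C + 2 * A) * κ ^ 2 := by
    intro w hw
    have h1 : ∀ x ∈ Metric.closedBall y κ, ‖fderiv ℝ g x - fderiv ℝ g y‖ ≤ C * κ := by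
      intro x hx
      refine (convex_univ.norm_image_sub_le_of_norm_fderiv_le (fun z _ => hd2 z)
        (fun z _ => by
          rw [← norm_iteratedFDeriv_one, norm_iteratedFDeriv_fderiv]
          exact hC z) (Set.mem_univ y) (Set.mem_univ x)).trans ?_
      rw [← dist_eq_norm]
      exact mul_le_mul_of_nonneg_left hx hC0
    have h2 := (convex_closedBall y κ).norm_image_sub_le_of_norm_hasFDerivWithin_le'
      (f := g) (f' := fderiv ℝ g) (φ := fderiv ℝ g y) (x := y) (y := y + w)
      (fun x _ => (hd x).hasFDerivAt.hasFDerivWithinAt) h1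
      (Metric.mem_closedBall_self hκ.le) (by simp [hw])
    rw [add_sub_cancel_left, hw] at h2
    have h3 := hA y (by linarith [norm_nonneg y])
    have h4 := hA (y + w) ((norm_add_le _ _).trans (by linarith))
    have h5 : fderiv ℝ g y w = g (y + w) - g y - (g (y + w) - g y - fderiv ℝ g y w) := by abel
    rw [h5]
    refine (norm_sub_le _ _).trans ((add_le_add (norm_sub_le _ _) h2).trans ?_)
    nlinarith
  refine ContinuousLinearMap.opNorm_le_bound _ (by positivity) fun v => ?_
  rcases eq_or_ne v 0 with rfl | hv
  · simp
  have hv' : 0 < ‖v‖ := norm_pos_iff.2 hv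
  have h1 := key ((κ / ‖v‖) • v) (by
    rw [norm_smul, Real.norm_of_nonneg (by positivity), div_mul_cancel₀ _ hv'.ne'])
  rw [map_smul, norm_smul, Real.norm_of_nonneg (by positivity), div_mul_eq_mul_div,
    div_le_iff₀ hv'] at h1
  have h2 : κ * ‖fderiv ℝ g y v‖ ≤ κ * ((C + 2 * A) * κ * ‖v‖) := by linarith
  exact le_of_mul_le_mul_left h2 hκ

variable {ι : Type} {n d : ℕ} {t₀ t₁ t₂ : ℝ} {ϱ ℓ : ι → ℝ} {χ : ι → ℝ → ℝ}

/-- When ℓ is not bounded, all y-derivatives of f(·, y/ϱ) have to be O(ϱ⁻³). The scaling yields ϱ⁻ᵐ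
for order m, which suffices if m ≥ 3. For m = 1, 2 Landau's inequality is applied once or twice; it
takes ϱ⁻¹² to ϱ⁻⁶ and then to ϱ⁻³, halving the radius each time. Hence the exponent 12 and the
radius 4r. -/
theorem Small.of_norm_le (hχ : IsCutoff t₀ t₁ t₂ ϱ ℓ χ) (hϱ : ∀ i, 1 ≤ ϱ i)
    {f : ℝ × (Fin d → ℝ) → ℂ} (hf : ContDiff ℝ ∞ f ∧ HasCompactSupport f) {A r : ℝ}
    (hr : ∀ i, (ϱ i)⁻¹ ≤ r)
    (hA : ∀ i, ℓ i ≤ A ∨ ∀ s, χ i s ≠ 0 → ∀ y : Fin d → ℝ, ‖y‖ ≤ 2 * (2 * r) →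
      ‖f (t₀ + s / ϱ i ^ 3, y)‖ ≤ A * (ϱ i)⁻¹ ^ 12) :
    Small ℓ χ fun i z => f (unscale t₀ (ϱ i) z) := by
  have hϱ0 : ∀ i, 0 < (ϱ i)⁻¹ := fun i => inv_pos.2 (one_pos.trans_le (hϱ i))
  have hϱ1 : ∀ i, (ϱ i)⁻¹ ≤ 1 := fun i => inv_le_one_of_one_le₀ (hϱ i)
  refine ⟨UB.coeff hf t₀ hϱ, fun m => ?_⟩
  obtain ⟨C, hC⟩ := hχ.length_le
  choose D hD using (UB.of_hasCompactSupport (ι := Unit) hf.1 hf.2).slice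
  obtain ⟨D', hD'⟩ := (UB.coeff (ϱ := ϱ) hf t₀ hϱ).slice m
  have hbound : ∀ i s y, χ i s ≠ 0 → ‖y‖ ≤ 1 → ℓ i ≤ A ∨
      ‖iteratedFDeriv ℝ m (fun y => f (unscale t₀ (ϱ i) (s, y))) y‖
        ≤ (|A| + |D m| + (D 2 + 2 * A) + (D 3 + 2 * (D 2 + 2 * A))) * (ϱ i)⁻¹ ^ 3 := by
    intro i s y hs hy
    refine (hA i).imp id fun H => ?_
    set e := (ϱ i)⁻¹ with he
    have he0 : 0 < e := hϱ0 i
    have he1 : e ≤ 1 := hϱ1 i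
    have her : e ≤ r := hr i
    set g : (Fin d → ℝ) → ℂ := fun y => f (t₀ + s / ϱ i ^ 3, y) with hg
    have hgs : ContDiff ℝ ∞ g := contDiff_slice hf.1 _
    have hgD : ∀ m y, ‖iteratedFDeriv ℝ m g y‖ ≤ D m := fun m y => hD m () _ y
    have hgA : ∀ y, ‖y‖ ≤ 2 * (2 * r) → ‖g y‖ ≤ A * e ^ 12 := H s hs
    have hA0 : 0 ≤ A := by
      have := (norm_nonneg _).trans (hgA 0 (by rw [norm_zero]; linarith))
      exact nonneg_of_mul_nonneg_left this (by positivity)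
    have hD0 : ∀ m, 0 ≤ D m := fun m => (norm_nonneg _).trans (hgD m 0)
    have hg3 : ∀ y, ‖iteratedFDeriv ℝ 2 (fderiv ℝ g) y‖ ≤ D 3 := fun y => by
      rw [norm_iteratedFDeriv_fderiv]
      exact hgD 3 y
    have hpow : ∀ j, 1 ≤ j → e ^ j ≤ r := fun j hj =>
      (pow_le_of_le_one he0.le he1 (by omega)).trans her
    have hgs' : ContDiff ℝ ∞ (fderiv ℝ g) := hgs.fderiv_right (by simp)
    have h1 : ∀ y, ‖y‖ ≤ 2 * r → ‖fderiv ℝ g y‖ ≤ (D 2 + 2 * A) * (e ^ 3) ^ 2 := fun y hy =>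
      (norm_fderiv_le_of_small hgs (hgD 2) (pow_pos he0 6) ((hpow 6 (by norm_num)).trans (by linarith))
        (fun y hy => (hgA y hy).trans_eq (by ring)) hy).trans_eq (by ring)
    have h2 : ∀ y, ‖y‖ ≤ r → ‖fderiv ℝ (fderiv ℝ g) y‖ ≤ (D 3 + 2 * (D 2 + 2 * A)) * e ^ 3 :=
      fun y hy => norm_fderiv_le_of_small hgs' hg3 (pow_pos he0 3) (hpow 3 (by norm_num)) h1 hy
    have hscale : ‖iteratedFDeriv ℝ m (fun y => f (unscale t₀ (ϱ i) (s, y))) y‖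
        ≤ ‖iteratedFDeriv ℝ m g (e • y)‖ * e ^ m := by
      have h := norm_iteratedFDeriv_comp_affine_le hgs 0
        (e • ContinuousLinearMap.id ℝ (Fin d → ℝ)) m y
      simp only [zero_add, _root_.smul_apply, ContinuousLinearMap.id_apply] at h
      refine h.trans (mul_le_mul_of_nonneg_left (pow_le_pow_left₀ (norm_nonneg _) ?_ m)
        (norm_nonneg _))
      rw [norm_smul, Real.norm_of_nonneg he0.le]
      exact mul_le_of_le_one_right he0.le ContinuousLinearMap.norm_id_le
    have hye : ‖e • y‖ ≤ r := by
      rw [norm_smul, Real.norm_of_nonneg he0.le]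
      exact (mul_le_of_le_one_right he0.le hy).trans her
    have he3 : 0 < e ^ 3 := by positivity
    have t1 : 0 ≤ D 2 + 2 * A := by linarith [hD0 2]
    have t2 : 0 ≤ D 3 + 2 * (D 2 + 2 * A) := by linarith [hD0 3]
    refine hscale.trans ?_
    rcases lt_or_ge m 3 with hm | hm
    · have hle : ‖iteratedFDeriv ℝ m g (e • y)‖
          ≤ (|A| + |D m| + (D 2 + 2 * A) + (D 3 + 2 * (D 2 + 2 * A))) * e ^ 3 := by
        have hr0 : 0 ≤ r := he0.le.trans her
        have hDm := abs_nonneg (D m)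
        interval_cases m
        · rw [norm_iteratedFDeriv_zero]
          refine (hgA _ (by linarith)).trans (mul_le_mul ?_
            (pow_le_pow_of_le_one he0.le he1 (by norm_num)) (by positivity) (by positivity))
          linarith [le_abs_self A]
        · rw [norm_iteratedFDeriv_one]
          refine (h1 _ (by linarith)).trans (mul_le_mul ?_ ?_ (by positivity) (by positivity))
          · linarith [abs_nonneg A]
          · exact pow_le_of_le_one he3.le (pow_le_one₀ he0.le he1) (by norm_num)
        · rw [← norm_iteratedFDeriv_fderiv, norm_iteratedFDeriv_one]
          refine (h2 _ hye).trans (mul_le_mul_of_nonneg_right ?_ he3.le)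
          linarith [abs_nonneg A]
      exact (mul_le_of_le_one_right (norm_nonneg _) (pow_le_one₀ he0.le he1)).trans hle
    · refine mul_le_mul ?_ (pow_le_pow_of_le_one he0.le he1 hm) (by positivity) (by positivity)
      have h3 := (hgD m (e • y)).trans (le_abs_self _)
      linarith [abs_nonneg A]
  refine ⟨|D'| * |A| + |(|A| + |D m| + (D 2 + 2 * A) + (D 3 + 2 * (D 2 + 2 * A)))| * |C|,
    fun i s y hs hy => ?_⟩
  have hℓ := hχ.length_pos i
  rcases hbound i s y hs hy with h | h
  · have h1 : ‖iteratedFDeriv ℝ m (fun y => f (unscale t₀ (ϱ i) (s, y))) y‖ * ℓ i ≤ |D'| * |A| :=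
      mul_le_mul ((hD' i s y).trans (le_abs_self _)) (h.trans (le_abs_self _)) hℓ.le
        (abs_nonneg _)
    refine h1.trans (le_add_of_nonneg_right (by positivity))
  · set B := (|A| + |D m| + (D 2 + 2 * A) + (D 3 + 2 * (D 2 + 2 * A)))
    have h0 : 0 < ϱ i := one_pos.trans_le (hϱ i)
    have h1 : ‖iteratedFDeriv ℝ m (fun y => f (unscale t₀ (ϱ i) (s, y))) y‖ * ℓ i ≤ |B| * |C| := by
      calc _ ≤ (|B| * (ϱ i)⁻¹ ^ 3) * (|C| * ϱ i ^ 3) := by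
            refine mul_le_mul (h.trans (mul_le_mul_of_nonneg_right (le_abs_self B) ?_))
              ((hC i).trans (mul_le_mul_of_nonneg_right (le_abs_self C) (by positivity))) hℓ.le
              (by positivity)
            positivity
        _ = _ := by
            have := h0.ne'
            field_simp
    refine h1.trans (le_add_of_nonneg_left (by positivity))

end SmallCoefficients

/-! ### Extension of the coefficients to compactly supported functions. -/

section Globalization

variable {n d : ℕ} {S : Symbols n d} {P : Phase n} {J : Set ℝ} {y₀ : Fin d → ℝ} {t₁ t₂ : ℝ}

/-- The functions `c` coincide with the coefficients of the transport equations for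
`t ∈ [a, b]` and `‖y‖ ≤ δ`. -/
structure Coeffs.Agree (c : Coeffs n d) (S : Symbols n d) (P : Phase n) (y₀ : Fin d → ℝ) (L : ℕ)
    (a b δ : ℝ) : Prop where
  A0 : ∀ β j, ∀ t ∈ Set.Icc a b, ∀ y, ‖y‖ ≤ δ → c.A0 β j (t, y) = coefA0 S P L β j t
  A1 : ∀ β j, ∀ t ∈ Set.Icc a b, ∀ y, ‖y‖ ≤ δ → c.A1 β j (t, y) = coefA1 S P y₀ L β j t y
  A2 : ∀ β j l, ∀ t ∈ Set.Icc a b, ∀ y, ‖y‖ ≤ δ → c.A2 β j l (t, y) = coefA2 S P y₀ L β j l t y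
  R : ∀ m β ℓ ν μ, ∀ t ∈ Set.Icc a b, ∀ y, ‖y‖ ≤ δ →
    c.R m β ℓ ν μ (t, y) = coefR S m β ℓ ν μ t y

/-- A single cut-off near the curve serves for all coefficients, so their supports in time have a
common bound. The agreement extends beyond [t₁, t₂], which makes the equations available at the end
points. -/
theorem exists_coeffs (h : SmoothPhase P J) {η : ℝ} (hη : 0 < η) (ht : t₁ < t₂)
    (hadm : ∀ t ∈ Set.Icc (t₁ - η) (t₂ + η), ∀ y, ‖y‖ ≤ η → t ∈ J ∧ Admissible S P y₀ t y)
    (L : ℕ) : ∃ c : Coeffs n d, c.Smooth ∧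
      c.Agree S P y₀ L (t₁ - η / 2) (t₂ + η / 2) (η / 2) := by
  obtain ⟨κ, hκ, hκc, hκ1, hκs⟩ := exists_cutoff (E := Fin d → ℝ) (a := t₁ - η / 2)
    (b := t₂ + η / 2) (δ := η / 2) (η := η / 2) (by linarith) (by positivity) (by positivity)
  have hmem : ∀ q ∈ tsupport κ, q.1 ∈ J ∧ Admissible S P y₀ q.1 q.2 := fun q hq => by
    obtain ⟨h1, h2⟩ := hκs hq
    rw [mem_closedBall_zero_iff] at h2
    exact hadm q.1 ⟨by linarith [h1.1], by linarith [h1.2]⟩ q.2 (by linarith)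
  have hcs : ∀ f : ℝ × (Fin d → ℝ) → ℂ, (∀ q ∈ tsupport κ, Sm f q) →
      ContDiff ℝ ∞ (fun q => (κ q : ℂ) * f q) ∧ HasCompactSupport fun q => (κ q : ℂ) * f q :=
    fun f hf => ⟨contDiff_cutoff_mul hκ hf,
      HasCompactSupport.mul_right (hκc.comp_left (g := fun x : ℝ => (x : ℂ)) Complex.ofReal_zero)⟩
  have heq : ∀ t ∈ Set.Icc (t₁ - η / 2) (t₂ + η / 2), ∀ y, ‖y‖ ≤ η / 2 → ∀ z : ℂ,
      (κ (t, y) : ℂ) * z = z := fun t ht y hy z => by rw [hκ1 t ht y hy, Complex.ofReal_one, one_mul]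
  refine ⟨⟨fun β j q => κ q * coefA0 S P L β j q.1, fun β j q => κ q * coefA1 S P y₀ L β j q.1 q.2,
    fun β j l q => κ q * coefA2 S P y₀ L β j l q.1 q.2,
    fun m β ℓ ν μ q => κ q * coefR S m β ℓ ν μ q.1 q.2⟩, ⟨fun β j => hcs _ fun q hq => ?_,
    fun β j => hcs _ fun q hq => ?_, fun β j l => hcs _ fun q hq => ?_,
    fun m β ℓ ν μ => hcs _ fun q hq => ?_, ⟨|t₁ - η| + |t₂ + η|, fun β j t y hT => ?_⟩⟩,
    ⟨fun β j t ht y hy => heq t ht y hy _, fun β j t ht y hy => heq t ht y hy _,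
      fun β j l t ht y hy => heq t ht y hy _, fun m β ℓ ν μ t ht y hy => heq t ht y hy _⟩⟩
  · obtain ⟨h1, h2⟩ := hmem q hq
    exact Sm.comp (f := coefA0 S P L β j) (h := Prod.fst) (h.sm_coefA0 h2.f h1 L β j)
      (ContDiff.sm contDiff_fst)
  · obtain ⟨h1, h2⟩ := hmem q hq
    exact h.sm_coefA1 h2 h1 L β j
  · obtain ⟨h1, h2⟩ := hmem q hq
    exact h.sm_coefA2 h2 h1 L β j l
  · obtain ⟨h1, h2⟩ := hmem q hq
    exact sm_coefR h2 m β ℓ ν μ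
  · have : κ (t, y) = 0 := by
      by_contra hne
      obtain ⟨h1, -⟩ := hκs (subset_tsupport _ hne)
      refine absurd hT (not_lt.2 (abs_le.2 ⟨?_, ?_⟩))
      · linarith [h1.1, neg_abs_le (t₁ - η), abs_nonneg (t₂ + η)]
      · linarith [h1.2, le_abs_self (t₂ + η), abs_nonneg (t₁ - η)]
    simp [this]

end Globalization

end Transport

namespace Transport

/-! ### From the evolution equations in s back to the transport equations in t. -/

section Equations

variable {n d : ℕ} {S : Symbols n d} {P : Phase n} {y₀ : Fin d → ℝ} {L N : ℕ} {ϱ t₀ : ℝ}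
  {φ ψ : ℕ → (Fin n → ℕ) → ℝ → (Fin d → ℝ) → ℂ} {k : ℕ} {α : Fin n → ℕ} {t : ℝ} {y : Fin d → ℝ}

/-- The coefficients of the transport equations. -/
noncomputable def Coeffs.ofSymbols (S : Symbols n d) (P : Phase n) (y₀ : Fin d → ℝ) (L : ℕ) :
    Coeffs n d where
  A0 β j q := coefA0 S P L β j q.1
  A1 β j q := coefA1 S P y₀ L β j q.1 q.2
  A2 β j l q := coefA2 S P y₀ L β j l q.1 q.2
  R m β ℓ ν μ q := coefR S m β ℓ ν μ q.1 q.2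

/-- All terms of the right hand side. -/
noncomputable def Coeffs.sumRAll (c : Coeffs n d) (q : ℝ × (Fin d → ℝ))
    (φ : ℕ → (Fin n → ℕ) → ℝ → (Fin d → ℝ) → ℂ) (k : ℕ) (α : Fin n → ℕ) (s : ℝ) (y : Fin d → ℝ)
    (N : ℕ) : ℂ :=
  ∑ m ∈ Finset.range (k + 7), ∑ β ∈ Finset.Iic α, ∑ ℓ ∈ Finset.range (ordR m + 1),
    ∑ ν ∈ midx n (ordR m), ∑ μ ∈ midx d (ordR m),
      if ℓ + mdeg ν + mdeg μ ≤ ordR m then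
        c.R m β ℓ ν μ q * cmon α β ν *
          DtDy 1 ℓ μ
            (lev φ (k - ((m : ℤ) * N + 2 * mdeg β - 3 * ℓ - 2 * mdeg ν - mdeg μ)) (α + ν - β))
            s y
      else 0

theorem iteratedDeriv_comp_rescale (g : ℝ → ℂ) (b t₀ : ℝ) (m : ℕ) :
    iteratedDeriv m (fun t => g (b * (t - t₀)))
      = fun t => (b : ℂ) ^ m * iteratedDeriv m g (b * (t - t₀)) := by
  induction m with
  | zero => simp
  | succ m ih =>
    funext t
    have h1 := deriv_comp_sub_const (f := fun t => iteratedDeriv m g (b * t)) t₀ t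
    have h2 := deriv_comp_mul_left b (iteratedDeriv m g) (t - t₀)
    rw [iteratedDeriv_succ, ih, deriv_const_mul_field, h1, h2, iteratedDeriv_succ, pow_succ,
      Complex.real_smul]
    ring

theorem lev_rescale (h : ∀ k α, φ k α t = ψ k α (ϱ ^ 3 * (t - t₀))) (m : ℤ) (α : Fin n → ℕ) :
    lev φ m α t = lev ψ m α (ϱ ^ 3 * (t - t₀)) := by
  unfold lev
  split_ifs
  · exact h _ _
  · rfl

/-- In the scaled time ϱ⁻³D_t is D_s, whence the parameter 1 on the right. The relation of φ to ψ is
required in a neighbourhood because it is differentiated in t. -/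
theorem DtDy_rescale (hϱ : ϱ ≠ 0) (h : ∀ᶠ t in 𝓝 t, ∀ k α, φ k α t = ψ k α (ϱ ^ 3 * (t - t₀)))
    (m : ℤ) (α : Fin n → ℕ) (r : ℕ) (μ : Fin d → ℕ) (y : Fin d → ℝ) :
    DtDy ϱ r μ (lev φ m α) t y = DtDy 1 r μ (lev ψ m α) (ϱ ^ 3 * (t - t₀)) y := by
  have h1 : (fun t => mderiv μ (lev φ m α t) y)
      =ᶠ[𝓝 t] fun t => mderiv μ (lev ψ m α (ϱ ^ 3 * (t - t₀))) y := by
    filter_upwards [h] with t ht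
    rw [lev_rescale ht]
  have hc : ((ϱ ^ 3 : ℝ) : ℂ) ≠ 0 := by exact_mod_cast pow_ne_zero 3 hϱ
  rw [DtDy, DtDy, h1.iteratedDeriv_eq,
    iteratedDeriv_comp_rescale (fun s => mderiv μ (lev ψ m α s) y) (ϱ ^ 3) t₀ r]
  rw [one_pow, Complex.ofReal_one, inv_one, one_pow, one_mul, inv_pow]
  field_simp

theorem transportLHS_eq (h : ∀ᶠ t in 𝓝 t, ∀ k α, φ k α t = ψ k α (ϱ ^ 3 * (t - t₀))) :
    transportLHS S P y₀ L ϱ φ k α t y =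
      -Complex.I * (((ϱ ^ 3 : ℝ) : ℂ) * deriv (fun s => ψ k α s y) (ϱ ^ 3 * (t - t₀)))
      - Complex.I * (Coeffs.ofSymbols S P y₀ L).sumA0 ((Finset.Iic α).filter (fun β => β ≠ 0))
          (t, ϱ⁻¹ • y) ψ k α (ϱ ^ 3 * (t - t₀)) y
      + (Coeffs.ofSymbols S P y₀ L).sumA1 ((Finset.Iic α).filter (fun β => β ≠ 0))
          (t, ϱ⁻¹ • y) ψ k α (ϱ ^ 3 * (t - t₀)) y
      + (Coeffs.ofSymbols S P y₀ L).sumA2 ((Finset.Iic α).filter (fun β => β ≠ 0))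
          (t, ϱ⁻¹ • y) ψ k α (ϱ ^ 3 * (t - t₀)) y
      - Complex.I * ((ϱ ^ 3 : ℝ) : ℂ) * (Coeffs.ofSymbols S P y₀ L).sumA00
          (t, ϱ⁻¹ • y) ψ k α (ϱ ^ 3 * (t - t₀)) y
      + ((ϱ ^ 3 : ℝ) : ℂ) * (Coeffs.ofSymbols S P y₀ L).sumA10
          (t, ϱ⁻¹ • y) ψ k α (ϱ ^ 3 * (t - t₀)) y
      + ((ϱ ^ 3 : ℝ) : ℂ) * (Coeffs.ofSymbols S P y₀ L).sumA20
          (t, ϱ⁻¹ • y) ψ k α (ϱ ^ 3 * (t - t₀)) y := by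
  have h1 : (fun t => φ k α t y) =ᶠ[𝓝 t] fun t => ψ k α (ϱ ^ 3 * (t - t₀)) y := by
    filter_upwards [h] with t ht
    rw [ht]
  have h2 : deriv (fun t => ψ k α (ϱ ^ 3 * (t - t₀)) y) t
      = ((ϱ ^ 3 : ℝ) : ℂ) * deriv (fun s => ψ k α s y) (ϱ ^ 3 * (t - t₀)) := by
    have := congrFun (iteratedDeriv_comp_rescale (fun s => ψ k α s y) (ϱ ^ 3) t₀ 1) t
    simpa only [iteratedDeriv_one, pow_one] using this
  have h3 := lev_rescale h.self_of_nhds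
  unfold transportLHS
  rw [h1.deriv_eq, h2]
  simp only [h3]
  rfl

theorem transportRHS_eq (hϱ : ϱ ≠ 0)
    (h : ∀ᶠ t in 𝓝 t, ∀ k α, φ k α t = ψ k α (ϱ ^ 3 * (t - t₀))) :
    transportRHS S N ϱ φ k α t y =
      -(Coeffs.ofSymbols S P y₀ L).sumRAll (t, ϱ⁻¹ • y) ψ k α (ϱ ^ 3 * (t - t₀)) y N := by
  unfold transportRHS
  simp only [DtDy_rescale hϱ h]
  rfl

variable {c c' : Coeffs n d} {s : ℝ} {q : ℝ × (Fin d → ℝ)} {I : Finset (Fin n → ℕ)}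

/-- If all the functions that occur in the transport equation vanish at a point, it holds
there. -/
theorem transport_eq_of_vanish (hϱ : ϱ ≠ 0)
    (h : ∀ᶠ t in 𝓝 t, ∀ k α, φ k α t = ψ k α (ϱ ^ 3 * (t - t₀)))
    (h0 : ∀ k α, deriv (fun s => ψ k α s y) (ϱ ^ 3 * (t - t₀)) = 0)
    (h1 : ∀ m α, lev ψ m α (ϱ ^ 3 * (t - t₀)) y = 0)
    (h2 : ∀ m α j, Dy j (lev ψ m α (ϱ ^ 3 * (t - t₀))) y = 0)
    (h3 : ∀ m α j l, Dy j (Dy l (lev ψ m α (ϱ ^ 3 * (t - t₀)))) y = 0)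
    (h4 : ∀ m α r μ, DtDy 1 r μ (lev ψ m α) (ϱ ^ 3 * (t - t₀)) y = 0) :
    transportLHS S P y₀ L ϱ φ k α t y = transportRHS S N ϱ φ k α t y := by
  rw [transportLHS_eq h, transportRHS_eq (P := P) (y₀ := y₀) (L := L) hϱ h]
  simp [Coeffs.sumA0, Coeffs.sumA1, Coeffs.sumA2, Coeffs.sumA00, Coeffs.sumA10, Coeffs.sumA20,
    Coeffs.sumRAll, h0, h1, h2, h3, h4]

/-- For ‖y‖ > 1 nothing is known about the coefficients at y/ϱ, which may lie outside the tube; but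
all functions and their derivatives vanish there. -/
theorem transport_eq_of_reg {ι : Type} {u : ι → ℕ → (Fin n → ℕ) → ℝ → (Fin d → ℝ) → ℂ}
    (hu : ∀ k α, Reg fun i => u i k α) (i : ι) (hϱ : ϱ ≠ 0)
    (h : ∀ᶠ t in 𝓝 t, ∀ k α, φ k α t = u i k α (ϱ ^ 3 * (t - t₀))) (hy : 1 < ‖y‖) :
    transportLHS S P y₀ L ϱ φ k α t y = transportRHS S N ϱ φ k α t y := by
  have h0 : ∀ k α, deriv (fun s => u i k α s y) (ϱ ^ 3 * (t - t₀)) = 0 := fun k α => by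
    have := ((hu k α).iteratedDeriv 1).ysupp i (ϱ ^ 3 * (t - t₀)) y hy
    simpa only [iteratedDeriv_one] using this
  have h1 : ∀ m α, lev (u i) m α (ϱ ^ 3 * (t - t₀)) y = 0 :=
    fun m α => (Reg.lev hu m α).ysupp i _ y hy
  have h2 : ∀ m α j, Dy j (lev (u i) m α (ϱ ^ 3 * (t - t₀))) y = 0 :=
    fun m α j => ((Reg.lev hu m α).Dy j).ysupp i _ y hy
  have h3 : ∀ m α j l, Dy j (Dy l (lev (u i) m α (ϱ ^ 3 * (t - t₀)))) y = 0 :=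
    fun m α j l => (((Reg.lev hu m α).Dy l).Dy j).ysupp i _ y hy
  have h4 : ∀ m α r μ, DtDy 1 r μ (lev (u i) m α) (ϱ ^ 3 * (t - t₀)) y = 0 :=
    fun m α r μ => ((Reg.lev hu m α).DtDy 1 r μ).ysupp i _ y hy
  exact transport_eq_of_vanish (ψ := u i) hϱ h h0 h1 h2 h3 h4

theorem pderiv_zero_fun (j : Fin d) : pderiv j (0 : (Fin d → ℝ) → ℂ) = 0 := by
  funext y
  simp [pderiv]

theorem mderiv_zero_fun (μ : Fin d → ℕ) : mderiv μ (0 : (Fin d → ℝ) → ℂ) = 0 := by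
  unfold mderiv
  induction List.finRange d with
  | nil => rfl
  | cons j l ih =>
    rw [List.foldr_cons, ih]
    exact Function.iterate_fixed (pderiv_zero_fun j) (μ j)

theorem transport_eq_of_eventually_zero (hϱ : ϱ ≠ 0) (h : ∀ᶠ t in 𝓝 t, ∀ k α, φ k α t = 0) :
    transportLHS S P y₀ L ϱ φ k α t y = transportRHS S N ϱ φ k α t y := by
  have hlev : ∀ (m : ℤ) (α : Fin n → ℕ) (s : ℝ),
      lev (fun _ _ _ => 0 : ℕ → (Fin n → ℕ) → ℝ → (Fin d → ℝ) → ℂ) m α s = 0 := fun m α s => by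
    unfold lev
    split_ifs <;> rfl
  have hDy : ∀ j, Dy j (0 : (Fin d → ℝ) → ℂ) = 0 := fun j => by
    funext y
    simp [Dy, pderiv_zero_fun]
  refine transport_eq_of_vanish (ψ := fun _ _ _ => 0) (t₀ := 0) hϱ h (fun k α => ?_)
    (fun m α => ?_) (fun m α j => ?_) (fun m α j l => ?_) (fun m α r μ => ?_)
  · simp
  · rw [hlev]; rfl
  · rw [hlev, hDy]; rfl
  · rw [hlev, hDy, hDy]; rfl
  · simp only [DtDy, hlev, mderiv_zero_fun, Pi.zero_apply]
    rw [iteratedDeriv_fun_const_zero, mul_zero]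

theorem midx_zero : midx n 0 = {0} := by
  ext α
  rw [mem_midx, Nat.le_zero, mdeg_eq_zero, Finset.mem_singleton]

/-- Only the multiplication by R₀ at x = 0 involves φ_{k,α} itself. It is separated, as it has to go
into the propagator rather than the source. -/
theorem Coeffs.sumRAll_eq : c.sumRAll q φ k α s y N
    = c.sumR q φ k α s y N + c.R 0 0 0 0 0 q * φ k α s y := by
  have h1 : c.sumRAll q φ k α s y N = c.sumR q φ k α s y N
      + ∑ m ∈ Finset.range (k + 7), ∑ β ∈ Finset.Iic α, ∑ ℓ ∈ Finset.range (ordR m + 1),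
        ∑ ν ∈ midx n (ordR m), ∑ μ ∈ midx d (ordR m),
          if m = 0 ∧ β = 0 then
            if ℓ + mdeg ν + mdeg μ ≤ ordR m then
              c.R m β ℓ ν μ q * cmon α β ν *
                DtDy 1 ℓ μ (lev φ (k - ((m : ℤ) * N + 2 * mdeg β - 3 * ℓ - 2 * mdeg ν - mdeg μ))
                  (α + ν - β)) s y
            else 0
          else 0 := by
    simp only [Coeffs.sumRAll, Coeffs.sumR, ← Finset.sum_add_distrib]
    refine Finset.sum_congr rfl fun m _ => Finset.sum_congr rfl fun β _ =>
      Finset.sum_congr rfl fun r _ => Finset.sum_congr rfl fun ν _ =>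
      Finset.sum_congr rfl fun μ _ => ?_
    split_ifs <;> ring
  have ho : ordR 0 = 0 := if_pos rfl
  rw [h1, Finset.sum_eq_single 0, Finset.sum_eq_single 0]
  · simp [ho, midx_zero, cmon, mdeg, DtDy, mderiv_zero, lev]
  · intro β _ hβ
    simp [hβ]
  · intro h
    exact absurd (Finset.mem_Iic.2 (fun i => Nat.zero_le (α i))) h
  · intro m _ hm
    simp [hm]
  · intro h
    exact absurd (Finset.mem_range.2 (by omega)) h

theorem Coeffs.sumA0_split : c.sumA0 ((Finset.Iic α).filter (fun β => β ≠ 0)) q φ k α s y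
    = c.sumA0 ((Finset.Iic α).filter (fun β => mdeg β = 1)) q φ k α s y
      + c.sumA0 ((Finset.Iic α).filter (fun β => 1 < mdeg β)) q φ k α s y := by
  unfold Coeffs.sumA0
  rw [← Finset.sum_union]
  · refine Finset.sum_congr ?_ fun _ _ => rfl
    ext β
    simp only [Finset.mem_filter, Finset.mem_union, ne_eq, ← mdeg_eq_zero (α := β)]
    constructor
    · rintro ⟨h1, h2⟩
      rcases Nat.lt_or_ge 1 (mdeg β) with h | h
      · exact Or.inr ⟨h1, h⟩
      · exact Or.inl ⟨h1, by omega⟩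
    · rintro (⟨h1, h2⟩ | ⟨h1, h2⟩)
      · exact ⟨h1, by omega⟩
      · exact ⟨h1, by omega⟩
  · refine Finset.disjoint_filter.2 fun β _ h1 h2 => ?_
    omega

/-- The evolution equation implies the transport equation where the cut-off is `1`. -/
theorem transport_eq_of_evolution {a b δ : ℝ} (hc : c.Agree S P y₀ L a b δ) (hϱ : 0 < ϱ)
    (h : ∀ᶠ t in 𝓝 t, ∀ k α, φ k α t = ψ k α (ϱ ^ 3 * (t - t₀)))
    (ht : t ∈ Set.Icc a b) (hδ : 0 ≤ δ) (hy : ‖ϱ⁻¹ • y‖ ≤ δ)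
    (hev : deriv (fun s => ψ k α s y) (ϱ ^ 3 * (t - t₀))
      = ((ϱ ^ 3 : ℝ) : ℂ)⁻¹ * c.own t₀ ϱ ψ k α (ϱ ^ 3 * (t - t₀)) y
        + c.lower N t₀ ϱ ψ k α (ϱ ^ 3 * (t - t₀)) y) :
    transportLHS S P y₀ L ϱ φ k α t y = transportRHS S N ϱ φ k α t y := by
  rw [transportLHS_eq h, transportRHS_eq (P := P) (y₀ := y₀) (L := L) hϱ.ne' h, hev]
  set s := ϱ ^ 3 * (t - t₀) with hs
  set c' := Coeffs.ofSymbols S P y₀ L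
  have hts : t₀ + s / ϱ ^ 3 = t := by
    rw [hs, mul_div_cancel_left₀ _ (pow_ne_zero 3 hϱ.ne')]
    ring
  have hq : unscale t₀ ϱ (s, y) = (t, ϱ⁻¹ • y) := by
    simp [unscale, hts]
  have e0 : ∀ β j, c'.A0 β j (t, ϱ⁻¹ • y) = c.A0 β j (t, ϱ⁻¹ • y) :=
    fun β j => (hc.A0 β j t ht _ hy).symm
  -- `Coeffs.own` uses A₀ at y = 0 to have a matrix depending on t only. Nothing changes, since
  -- `coefA0` is independent of y and `c` agrees with it at both points.
  have e0' : ∀ β j, c.A0 β j (t, 0) = c.A0 β j (t, ϱ⁻¹ • y) := fun β j =>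
    (hc.A0 β j t ht 0 (by simpa using hδ)).trans (hc.A0 β j t ht _ hy).symm
  have e1 : ∀ β j, c'.A1 β j (t, ϱ⁻¹ • y) = c.A1 β j (t, ϱ⁻¹ • y) :=
    fun β j => (hc.A1 β j t ht _ hy).symm
  have e2 : ∀ β j l, c'.A2 β j l (t, ϱ⁻¹ • y) = c.A2 β j l (t, ϱ⁻¹ • y) :=
    fun β j l => (hc.A2 β j l t ht _ hy).symm
  have e3 : ∀ m β r ν μ, c'.R m β r ν μ (t, ϱ⁻¹ • y) = c.R m β r ν μ (t, ϱ⁻¹ • y) :=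
    fun m β r ν μ => (hc.R m β r ν μ t ht _ hy).symm
  have s0 : ∀ I, c'.sumA0 I (t, ϱ⁻¹ • y) ψ k α s y = c.sumA0 I (t, ϱ⁻¹ • y) ψ k α s y := fun I => by
    simp only [Coeffs.sumA0, e0]
  have s1 : ∀ I, c'.sumA1 I (t, ϱ⁻¹ • y) ψ k α s y = c.sumA1 I (t, ϱ⁻¹ • y) ψ k α s y := fun I => by
    simp only [Coeffs.sumA1, e1]
  have s2 : ∀ I, c'.sumA2 I (t, ϱ⁻¹ • y) ψ k α s y = c.sumA2 I (t, ϱ⁻¹ • y) ψ k α s y := fun I => by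
    simp only [Coeffs.sumA2, e2]
  have s00 : c'.sumA00 (t, ϱ⁻¹ • y) ψ k α s y = c.sumA00 (t, ϱ⁻¹ • y) ψ k α s y := by
    simp only [Coeffs.sumA00, e0]
  have s10 : c'.sumA10 (t, ϱ⁻¹ • y) ψ k α s y = c.sumA10 (t, ϱ⁻¹ • y) ψ k α s y := by
    simp only [Coeffs.sumA10, e1]
  have s20 : c'.sumA20 (t, ϱ⁻¹ • y) ψ k α s y = c.sumA20 (t, ϱ⁻¹ • y) ψ k α s y := by
    simp only [Coeffs.sumA20, e2]
  have sR : c'.sumRAll (t, ϱ⁻¹ • y) ψ k α s y N = c.sumRAll (t, ϱ⁻¹ • y) ψ k α s y N := by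
    simp only [Coeffs.sumRAll, e3]
  have hown : c.own t₀ ϱ ψ k α s y
      = -c.sumA0 ((Finset.Iic α).filter (fun β => mdeg β = 1)) (t, ϱ⁻¹ • y) ψ k α s y
        - Complex.I * c.R 0 0 0 0 0 (t, ϱ⁻¹ • y) * ψ k α s y := by
    rw [Coeffs.own, hq, hts]
    congr 2
    refine Finset.sum_congr rfl fun β hβ => Finset.sum_congr rfl fun j _ => ?_
    rw [e0', (Finset.mem_filter.1 hβ).2]
    simp [lev]
  rw [s0, s1, s2, s00, s10, s20, sR, Coeffs.sumRAll_eq, Coeffs.sumA0_split, hown, Coeffs.lower, hq]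
  -- What remains is that the evolution equation is the transport equation divided by -iϱ³ and
  -- solved for ∂_s ψ, an identity in which the sums may be treated as unknowns.
  have hϱ3 : ((ϱ ^ 3 : ℝ) : ℂ) ≠ 0 := by exact_mod_cast pow_ne_zero 3 hϱ.ne'
  generalize c.sumA0 ((Finset.Iic α).filter (fun β => mdeg β = 1)) (t, ϱ⁻¹ • y) ψ k α s y = b1
  generalize c.sumA0 ((Finset.Iic α).filter (fun β => 1 < mdeg β)) (t, ϱ⁻¹ • y) ψ k α s y = b2
  generalize c.sumA1 ((Finset.Iic α).filter (fun β => β ≠ 0)) (t, ϱ⁻¹ • y) ψ k α s y = b3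
  generalize c.sumA2 ((Finset.Iic α).filter (fun β => β ≠ 0)) (t, ϱ⁻¹ • y) ψ k α s y = b4
  generalize c.sumA00 (t, ϱ⁻¹ • y) ψ k α s y = b5
  generalize c.sumA10 (t, ϱ⁻¹ • y) ψ k α s y = b6
  generalize c.sumA20 (t, ϱ⁻¹ • y) ψ k α s y = b7
  generalize c.sumR (t, ϱ⁻¹ • y) ψ k α s y N = b8
  generalize c.R 0 0 0 0 0 (t, ϱ⁻¹ • y) = b9
  generalize ψ k α s y = b10
  generalize ((ϱ ^ 3 : ℝ) : ℂ) = z at hϱ3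
  field_simp
  ring_nf
  simp only [Complex.I_sq]
  ring

end Equations

end Transport

namespace Transport

/-! ### Uniform bounds for the amplitudes. -/

section Amplitudes

variable {ι : Type} {n d : ℕ} {t₀ t₁ t₂ : ℝ} {ϱ ℓ : ι → ℝ} {χ : ι → ℝ → ℝ}

theorem contDiff_mpow (α : Fin n → ℕ) :
    ContDiff ℝ ∞ fun x : Fin n → ℝ => mpow (fun i => (x i : ℂ)) α := by
  unfold mpow
  exact contDiff_prod fun i _ => (Complex.ofRealCLM.contDiff.comp (contDiff_apply ℝ ℝ i)).pow _

/-- The amplitudes in the scaled variables. -/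
noncomputable def amplitude (M : ℕ) (ψ : (Fin n → ℝ) → ℝ) (χ : ℝ → ℝ)
    (v : (Fin n → ℕ) → ℝ → (Fin d → ℝ) → ℂ) (z : ℝ × (Fin n → ℝ) × (Fin d → ℝ)) : ℂ :=
  (ψ z.2.1 : ℂ) * ∑ α ∈ midx n M,
    ((χ z.1 : ℂ) * v α z.1 z.2.2) * mpow (fun i => (z.2.1 i : ℂ)) α

/-- The unbounded monomials in x are harmless after multiplication by the compactly supported ψ. -/
theorem UB.amplitude {M : ℕ} {ψ : (Fin n → ℝ) → ℝ} (hψ : ContDiff ℝ ∞ ψ)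
    (hψc : HasCompactSupport ψ) (hχ : UB χ) {v : ι → (Fin n → ℕ) → ℝ → (Fin d → ℝ) → ℂ}
    (hv : ∀ α, Reg fun i => v i α) : UB fun i => amplitude M ψ (χ i) (v i) := by
  have h1 : ∀ α, UB fun (_ : ι) (z : ℝ × (Fin n → ℝ) × (Fin d → ℝ)) =>
      (ψ z.2.1 : ℂ) * mpow (fun i => (z.2.1 i : ℂ)) α := fun α => by
    have h2 : UB fun (_ : ι) (x : Fin n → ℝ) => (ψ x : ℂ) * mpow (fun i => (x i : ℂ)) α :=
      UB.of_hasCompactSupport ((Complex.ofRealCLM.contDiff.comp hψ).mul (contDiff_mpow α))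
        (HasCompactSupport.mul_right
          (hψc.comp_left (g := fun x : ℝ => (x : ℂ)) Complex.ofReal_zero))
    have h3 := h2.comp_affine (X' := ℝ × (Fin n → ℝ) × (Fin d → ℝ)) (fun _ => 0)
      (fun _ => (ContinuousLinearMap.fst ℝ (Fin n → ℝ) (Fin d → ℝ)).comp
        (ContinuousLinearMap.snd ℝ ℝ ((Fin n → ℝ) × (Fin d → ℝ)))) fun _ =>
      (ContinuousLinearMap.opNorm_comp_le _ _).trans
        (mul_le_one₀ (ContinuousLinearMap.norm_fst_le ..) (norm_nonneg _)
          (ContinuousLinearMap.norm_snd_le ..))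
    simpa using h3
  have h4 : UB fun i (z : ℝ × (Fin n → ℝ) × (Fin d → ℝ)) => (χ i z.1 : ℂ) := hχ.ofReal.comp_fst
  have h5 : ∀ α, UB fun i (z : ℝ × (Fin n → ℝ) × (Fin d → ℝ)) => v i α z.1 z.2.2 := fun α => by
    have h3 := (hv α).ub.comp_affine (X' := ℝ × (Fin n → ℝ) × (Fin d → ℝ)) (fun _ => 0)
      (fun _ => (ContinuousLinearMap.fst ℝ ℝ ((Fin n → ℝ) × (Fin d → ℝ))).prod
        ((ContinuousLinearMap.snd ℝ (Fin n → ℝ) (Fin d → ℝ)).comp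
        (ContinuousLinearMap.snd ℝ ℝ ((Fin n → ℝ) × (Fin d → ℝ))))) fun _ => by
      refine ContinuousLinearMap.opNorm_le_bound _ zero_le_one fun z => ?_
      rw [ContinuousLinearMap.prod_apply, Prod.norm_def, one_mul]
      exact max_le (norm_fst_le z) ((norm_snd_le z.2).trans (norm_snd_le z))
    simpa using h3
  refine (UB.sum (s := midx n M) fun α _ => (h1 α).mul (h4.mul (h5 α))).congr fun i z => ?_
  rw [Transport.amplitude, Finset.mul_sum]
  exact Finset.sum_congr rfl fun α _ => by ring

end Amplitudes

end Transport

/-! ### The main theorem. -/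

open Transport in
theorem proposition6p3 {n d : ℕ} (S : Transport.Symbols n d) (P : Transport.Phase n)
    (y₀ : Fin d → ℝ) (t₁ t₂ : ℝ) (L r : ℕ) (hr : 2 ≤ r) (hL : r ≤ L + 1)
    (hS : Transport.SmoothSymbols S P y₀ t₁ t₂)
    (hP : Transport.IsPhase S P L r t₁ t₂)
    (t₀ : ℝ) (ht₀ : t₀ ∈ Set.Ioo t₁ t₂) (hw₀ : (P.w0 t₀).im = 0)
    (hcond : (∀ k : ℕ, iteratedDeriv k (Transport.fcurve S P) t₀ = 0) →
      Transport.GradBound S P y₀ t₁ t₂) :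
    ∃ ε : ℝ, 0 < ε ∧ ∃ N₀ : ℕ, 10 ≤ N₀ ∧ ∀ N : ℕ, N₀ ≤ N → ∃ lam₀ : ℝ, 1 ≤ lam₀ ∧
    ∀ K M : ℕ, ∃ (M' : ℕ) (ψ : (Fin n → ℝ) → ℝ) (C : ℕ → ℝ) (C₀ : ℝ),
      ContDiff ℝ ∞ ψ ∧ HasCompactSupport ψ ∧ (∀ᶠ x in 𝓝 0, ψ x = 1) ∧
      ∀ lam : ℝ, lam₀ ≤ lam → ∀ ϱ : ℝ, ϱ = lam ^ (1 / (N : ℝ)) →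
      ∃ (φc : ℕ → (Fin n → ℕ) → ℝ → (Fin d → ℝ) → ℂ)
        (φ : ℕ → ℝ → (Fin n → ℝ) → (Fin d → ℝ) → ℂ)
        (Φ : ℕ → ℝ × (Fin n → ℝ) × (Fin d → ℝ) → ℂ),
        -- the coefficients are smooth, and finitely many for each `k`
        (∀ k α, ContDiff ℝ ∞ (fun z : ℝ × (Fin d → ℝ) => φc k α z.1 z.2)) ∧
        (∀ k α, M' < Transport.mdeg α → φc k α = 0) ∧
        -- they solve the transport equations on `[t₁, t₂]`, where `exp(-λ Im w₀)` is not negligible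
        (∀ k ≤ K, ∀ α, Transport.mdeg α ≤ M → ∀ t ∈ Set.Icc t₁ t₂,
          lam * (P.w0 t).im < lam ^ ε → ∀ y,
          Transport.transportLHS S P y₀ L ϱ φc k α t y
            = Transport.transportRHS S N ϱ φc k α t y) ∧
        -- the amplitudes are given by the expansions in `x`, cut off in `x`
        (∀ k ≤ K, ∀ t x y, φ k t x y
          = (ψ (ϱ ^ 2 • (x - P.x0 t)) : ℂ) * ∑ α ∈ Transport.midx n M',
              φc k α t (ϱ • (y - y₀)) *
                Transport.mpow (fun i => ((ϱ ^ 2 * (x i - P.x0 t i) : ℝ) : ℂ)) α) ∧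
        (∀ k ≤ K, ∀ t x y, φ k t x y
          = Φ k (ϱ ^ 3 * (t - t₀), ϱ ^ 2 • (x - P.x0 t), ϱ • (y - y₀))) ∧
        -- uniform smoothness, supports and normalization
        (∀ k ≤ K, ContDiff ℝ ∞ (Φ k) ∧ ∀ m z, ‖iteratedFDeriv ℝ m (Φ k) z‖ ≤ C m) ∧
        (∀ k ≤ K, ∀ s x y, Φ k (s, x, y) ≠ 0 →
          ‖x‖ + ‖y‖ ≤ C₀ ∧ |s| ≤ C₀ * ϱ ^ 3 ∧ t₀ + s / ϱ ^ 3 ∈ Set.Icc t₁ t₂) ∧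
        Φ 0 (0, 0, 0) = 1 := by
  obtain ⟨J, hJ, h⟩ := hP.smoothPhase
  have ht : t₁ < t₂ := ht₀.1.trans ht₀.2
  obtain ⟨η, hη, hadm⟩ := exists_admissible_tube ht.le h hJ hS
  obtain ⟨c, hc, hag⟩ := exists_coeffs h hη ht hadm L
  obtain ⟨η', hη', N₀, hN₀, hfam⟩ := exists_cutoff_family hP hr h hJ hS ht₀ hcond
  -- The coefficients have to be known and small for ‖y‖ ≤ 4R, as the two applications of Landau's
  -- inequality lose a factor 4 in the radius. Then ϱ ≥ R⁻¹ places y/ϱ in the ball of radius R for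
  -- ‖y‖ ≤ 1.
  set R := min (η / 2) η' / 4 with hR
  have hR0 : 0 < R := by positivity
  have hR1 : 2 * (2 * R) ≤ η / 2 := by
    rw [hR]; linarith [min_le_left (η / 2) η']
  have hR2 : 2 * (2 * R) ≤ η' := by
    rw [hR]; linarith [min_le_right (η / 2) η']
  -- The value 1/2 of ε corresponds to the threshold λ^{-1/2} for Im w₀ in the cut-offs.
  refine ⟨1 / 2, by norm_num, N₀, hN₀, fun N hN => ?_⟩
  have hN10 : 10 ≤ N := hN₀.trans hN
  obtain ⟨lam₀, hlam₀, hfam⟩ := hfam N hN R⁻¹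
  obtain ⟨hϱ, ℓ, χ, hχ, hdich, A, hA⟩ := hfam (fun i => (i : ℝ) ^ (1 / (N : ℝ))) fun _ => rfl
  set ϱ : {lam : ℝ // lam₀ ≤ lam} → ℝ := fun i => (i : ℝ) ^ (1 / (N : ℝ)) with hϱdef
  have hϱ1 : ∀ i, 1 ≤ ϱ i := fun i => (hϱ i).1
  have hϱ0 : ∀ i, 0 < ϱ i := fun i => one_pos.trans_le (hϱ1 i)
  have hϱR : ∀ i, (ϱ i)⁻¹ ≤ R := fun i => by
    rw [inv_le_comm₀ (hϱ0 i) hR0]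
    exact (hϱ i).2
  have hsub : ∀ t ∈ Set.Icc t₁ t₂, t ∈ Set.Icc (t₁ - η / 2) (t₂ + η / 2) := fun t ht =>
    ⟨by linarith [ht.1], by linarith [ht.2]⟩
  have hz : c.SmallZero t₀ ϱ ℓ χ := by
    refine ⟨fun j => Small.of_norm_le hχ hϱ1 (hc.A0 0 j) (A := A) hϱR fun i => ?_,
      fun j => Small.of_norm_le hχ hϱ1 (hc.A1 0 j) (A := A) hϱR fun i => ?_,
      fun j l => Small.of_norm_le hχ hϱ1 (hc.A2 0 j l) (A := A) hϱR fun i => ?_⟩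
    · refine (hA i).imp id fun H s hs y hy => ?_
      rw [hag.A0 0 j _ (hsub _ (hχ.mem i s hs)) y (hy.trans hR1)]
      exact (H s hs y (hy.trans hR2)).1 j
    · refine (hA i).imp id fun H s hs y hy => ?_
      rw [hag.A1 0 j _ (hsub _ (hχ.mem i s hs)) y (hy.trans hR1)]
      exact (H s hs y (hy.trans hR2)).2.1 j
    · refine (hA i).imp id fun H s hs y hy => ?_
      rw [hag.A2 0 j l _ (hsub _ (hχ.mem i s hs)) y (hy.trans hR1)]
      exact (H s hs y (hy.trans hR2)).2.2 j l
  refine ⟨lam₀, hlam₀, fun K M => ?_⟩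
  let bx : ContDiffBump (0 : Fin n → ℝ) := ⟨1, 2, one_pos, one_lt_two⟩
  let bY : ContDiffBump (0 : Fin d → ℝ) := ⟨1 / 2, 1, by norm_num, by norm_num⟩
  obtain ⟨u, hu, hu0, hub, hu1, hev⟩ := exists_transport_solution hχ hϱ1 hc hz hN10
    (a := t₁ - η / 2) (b := t₂ + η / 2) (δ := η / 2) (by linarith) (by positivity)
    (fun i => (hϱR i).trans (by linarith)) ⟨by linarith [ht₀.1], by linarith [ht₀.2]⟩
    (b₀ := fun y => (bY y : ℂ)) (Complex.ofRealCLM.contDiff.comp bY.contDiff)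
    (fun y hy => by
      rw [bY.zero_of_le_dist (by rw [dist_zero_right]; exact hy.le), Complex.ofReal_zero]) K M
  have hamp : ∀ k, UB fun i => amplitude M bx (χ i) (u i k) := fun k =>
    UB.amplitude bx.contDiff bx.hasCompactSupport hχ.ub (hu k)
  choose D hD using fun k m => (hamp k).2 m
  obtain ⟨Cℓ, hCℓ⟩ := hχ.length_le
  -- M' = M is possible because functions with |α| > M occur only as lower terms in the equations to
  -- be solved, and may be taken to be zero. The number 3 = 2 + 1 comes from the supports in x and
  -- y.
  refine ⟨M, bx, fun m => ∑ k ∈ Finset.range (K + 1), |D k m|, max 3 Cℓ, bx.contDiff,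
    bx.hasCompactSupport, bx.eventuallyEq_one, fun lam hlam ϱ' hϱ' => ?_⟩
  set i : {lam : ℝ // lam₀ ≤ lam} := ⟨lam, hlam⟩ with hi
  obtain rfl : ϱ' = ϱ i := hϱ'
  have hϱ3 : ϱ i ^ 3 ≠ 0 := pow_ne_zero 3 (hϱ0 i).ne'
  -- The functions u solve equations whose sources carry the factor χ, and are themselves not
  -- compactly supported in s. Multiplying by χ changes neither the functions nor the equations
  -- where χ = 1 locally.
  refine ⟨fun k α t y => (χ i (ϱ i ^ 3 * (t - t₀)) : ℂ) * u i k α (ϱ i ^ 3 * (t - t₀)) y,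
    fun k t x y => amplitude M bx (χ i) (u i k)
      (ϱ i ^ 3 * (t - t₀), ϱ i ^ 2 • (x - P.x0 t), ϱ i • (y - y₀)),
    fun k => amplitude M bx (χ i) (u i k), fun k α => ?_, fun k α hα => ?_,
    fun k hk α hα t ht hlt y => ?_, fun k hk t x y => ?_, fun k hk t x y => rfl,
    fun k hk => ⟨(hamp k).1 i, fun m z => ?_⟩, fun k hk s x y hne => ?_, ?_⟩
  · have h1 : ContDiff ℝ ∞ fun z : ℝ × (Fin d → ℝ) => (χ i z.1 : ℂ) * u i k α z.1 z.2 :=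
      (Complex.ofRealCLM.contDiff.comp ((hχ.ub.1 i).comp contDiff_fst)).mul ((hu k α).ub.1 i)
    have h2 : ContDiff ℝ ∞ fun z : ℝ × (Fin d → ℝ) => (ϱ i ^ 3 * (z.1 - t₀), z.2) := by fun_prop
    exact h1.comp h2
  · funext t y
    have h1 : u i k α = 0 := hu0 i k α (by omega)
    simp [h1]
  -- Where the equations are required, χ is locally constant, so no derivative of χ appears.
  · rcases hdich i t ht hlt with hone | hzero
    · have hcont : ContinuousAt (fun t => ϱ i ^ 3 * (t - t₀)) t := by fun_prop
      have hφ : ∀ᶠ t in 𝓝 t, ∀ k α,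
          (fun y => (χ i (ϱ i ^ 3 * (t - t₀)) : ℂ) * u i k α (ϱ i ^ 3 * (t - t₀)) y)
            = u i k α (ϱ i ^ 3 * (t - t₀)) := by
        filter_upwards [hcont.eventually hone] with t ht k α
        funext y
        rw [ht, Complex.ofReal_one, one_mul]
      rcases lt_or_ge 1 ‖y‖ with hy | hy
      · exact transport_eq_of_reg hu i (hϱ0 i).ne' hφ hy
      · have hts : t₀ + ϱ i ^ 3 * (t - t₀) / ϱ i ^ 3 = t := by
          rw [mul_div_cancel_left₀ _ hϱ3]
          ring
        have h1 := hev i k hk α hα (ϱ i ^ 3 * (t - t₀)) y (by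
          rw [hts]
          exact ⟨by linarith [ht.1], by linarith [ht.2]⟩)
        rw [hone.self_of_nhds, Complex.ofReal_one, one_mul] at h1
        refine transport_eq_of_evolution hag (hϱ0 i) hφ (hsub t ht) (by positivity) ?_ h1
        rw [norm_smul, Real.norm_of_nonneg (inv_pos.2 (hϱ0 i)).le]
        refine (mul_le_of_le_one_right (inv_pos.2 (hϱ0 i)).le hy).trans ((hϱR i).trans ?_)
        linarith
    · have hcont : ContinuousAt (fun t => ϱ i ^ 3 * (t - t₀)) t := by fun_prop
      refine transport_eq_of_eventually_zero (hϱ0 i).ne' ?_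
      filter_upwards [hcont.eventually hzero] with t ht k α
      funext y
      simp [ht]
  · rfl
  · refine (hD k m i z).trans ((le_abs_self _).trans ?_)
    exact Finset.single_le_sum (f := fun k => |D k m|) (fun _ _ => abs_nonneg _)
      (Finset.mem_range.2 (by omega))
  · have h1 : bx x ≠ 0 := fun h0 => hne (by simp [amplitude, h0])
    obtain ⟨α, -, hα⟩ := Finset.exists_ne_zero_of_sum_ne_zero (right_ne_zero_of_mul hne)
    have h2 : χ i s ≠ 0 := fun h0 => hα (by simp [h0])
    have h3 : u i k α s y ≠ 0 := fun h0 => hα (by simp [h0])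
    have hx : ‖x‖ ≤ 2 := by
      by_contra hc
      exact h1 (bx.zero_of_le_dist (by rw [dist_zero_right]; exact (not_le.1 hc).le))
    have hy : ‖y‖ ≤ 1 := by
      by_contra hc
      exact h3 ((hu k α).ysupp i s y (not_le.1 hc))
    refine ⟨?_, ?_, hχ.mem i s h2⟩
    · exact le_trans (by linarith) (le_max_left 3 Cℓ)
    · exact ((hχ.abs_le i s h2).trans (hCℓ i)).trans
        (mul_le_mul_of_nonneg_right (le_max_right _ _) (pow_pos (hϱ0 i) 3).le)
  · have h1 : bx 0 = 1 := bx.eventuallyEq_one.self_of_nhds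
    have h2 : bY 0 = 1 := bY.eventuallyEq_one.self_of_nhds
    simp only [amplitude, h1, hχ.one i, Complex.ofReal_one, one_mul]
    rw [Finset.sum_eq_single 0]
    · rw [hub, h2]
      simp [mpow]
    · intro α _ hα
      rw [hu1 i 0 α 0 (Or.inr hα), zero_mul]
    · intro h0
      exact absurd (mem_midx.2 (by simp [mdeg])) h0
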